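/- **Setting.** Let $n,d\ge 1$, $\mathbf q\in[0,1]^d$, $k=\|\mathbf q\|_1$, $\sigma>0$, $\mathbf X\in\mathbb R^{n\times d}$. In the spike-and-slab model, $\theta^\star\sim\pi=\bigotimes_{i\in[d]}\big((1-\mathbf q_i)\delta_0+\mathbf q_i\mathcal N(0,1)\big)$ and $\xi\sim\mathcal N(0,\sigma^2\mathbf I_n)$ are independent, and $\mathbf y=\mathbf X\theta^\star+\xi$ is observed. The posterior law of the support is $$\pi_{\rm supp}(S\mid \mathbf X,\mathbf y)\ \propto\ \frac{\prod_{i\in S}\mathbf q_i\prod_{i\notin S}(1-\mathbf q_i)}{(2\pi)^{|S|/2}}\int_{\mathbb R^S}\exp\Big(-\tfrac1{2\sigma^2}\|\mathbf y-\mathbf X\theta_S\|_2^2-\tfrac12\|\theta_S\|_2^2\Big)\,d\theta_S,\qquad S\subseteq[d],$$ where $\theta_S\in\mathbb R^S$ is padded by zeroes. $\mathbf X$ is $(\epsilon,s)$-RIP if $(1-\epsilon)\|\theta\|_2^2\le\|\mathbf X\theta\|_2^2\le(1+\epsilon)\|\theta\|_2^2$ whenever $\theta$ has at most $s$ nonzero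 entries. **Estimator.** Let $C_{\mathcal A}\ge1$, $R_{\mathcal A}:\mathbb N\times(0,1)\times(0,1)\to\mathbb R_{\ge0}$, $\delta\in(0,1)$, $k^\star\in\mathbb N$ and $\epsilon>0$ be such that $$k^\star\ge16\Big(k+\log\tfrac{40}\delta\Big),\qquad \epsilon\le\frac1{32k^\star\big(R_{\mathcal A}(k^\star,\epsilon,\tfrac{\delta^2}{320})^2+\log\tfrac{40}\delta\big)}.$$ Let $\mathcal A$ be a deterministic (measurable) estimator with the following guarantee at $(k^\star,\epsilon)$: if $\mathbf X$ is $(\epsilon,C_{\mathcal A}k^\star)$-RIP, then for every $k^\star$-sparse $\theta$ and every $\delta'\in(0,1)$, $\|\mathcal A(\mathbf X,\mathbf X\theta+\xi)-\theta\|_\infty\le\sigma R_{\mathcal A}(k^\star,\epsilon,\delta')$ with probability at least $1-\delta'$ over $\xi\sim\mathcal N(0,\sigma^2\mathbf I_n)$. Let $\widehat\theta$ be obtained from $\mathcal A(\mathbf X,\mathbf y)$ by setting to zero all entries of absolute value at most $3\sigma R_{\mathcal A}(k^\star,\epsilon,\frac{\delta^2}{320})$. **Algorithm.** Given $(\mathbf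 X,\mathbf y,\widehat\theta,\sigma,\mathbf q,k^\star,\delta)$, let $T=\mathrm{supp}(\widehat\theta)$, $m=\lfloor\frac34k^\star\rfloor$, $\Omega=\{S\subseteq[d]: T\subseteq S,\ |S|\le m\}$ (if $\Omega=\emptyset$, return $\emptyset$), $\mathbf z=\frac1{\sigma^2}\mathbf X^\top(\mathbf y-\mathbf X\widehat\theta)-\widehat\theta$, $\mathbf A_S=\frac1{\sigma^2}[\mathbf X^\top\mathbf X]_{S\times S}+\mathbf I_S$, $\mathbf r_i=\mathbf q_i\sqrt{\frac{\sigma^2}{1+\sigma^2}}\exp\big(\frac{\sigma^2}{2(1+\sigma^2)}\mathbf z_i^2\big)$ and $\mathbf p_i=\frac{\mathbf r_i}{1-\mathbf q_i+\mathbf r_i}$ for $i\notin T$. A proposal is $S=T\cup W$, where $W\subseteq T^c$ contains each $i\in T^c$ independently with probability $\mathbf p_i$, conditioned on $|W|\le m-|T|$; it is drawn by dynamic programming. For at most $\lceil9\log\frac2\delta\rceil$ rounds, draw a proposal $S$ and accept (return) it with probability $\min\{1,\frac13\frac{P(S)}{Q(S)}\}$, where $$\frac{P(S)}{Q(S)}=\frac{(1+\sigma^{-2})^{|S|/2}}{\sqrt{\det\mathbf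 A_S}}\exp\Big(\tfrac12\mathbf z_S^\top\mathbf A_S^{-1}\mathbf z_S-\tfrac{\sigma^2}{2(1+\sigma^2)}\|\mathbf z_S\|_2^2\Big);$$ if all rounds reject, return a fresh proposal. **Cost model.** A randomized real RAM in which real arithmetic, $\exp$, square roots, zero tests, memory moves and Bernoulli sampling take unit time, and multiplying, inverting and taking the determinant of $m\times m$ matrices takes time $m^\omega$, where $\omega\ge2$. **Proposition.** Suppose in addition that $\mathbf X$ is $(\epsilon,C_{\mathcal A}k^\star)$-RIP. Then, with probability at least $1-\delta$ over $(\theta^\star,\xi)$, the output law $\nu$ of the algorithm run with $\widehat\theta$ satisfies $\|\nu-\pi_{\rm supp}(\cdot\mid\mathbf X,\mathbf y)\|_{\rm TV}\le\delta$. Moreover, for every given $\mathbf y$ and $\widehat\theta$, the worst-case running time of the algorithm is at most $$K\Big(nd+\big(dk^\star+n(k^\star)^{\omega-1}\big)\log\tfrac2\delta\Big),$$ where $K$ depends only on $\omega$. -/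

import Mathlib

open MeasureTheory ProbabilityTheory
open scoped ENNReal NNReal

namespace SpikeSlab

noncomputable section

/-! ## A randomized real RAM with step counting

A program is a tree of elementary instructions. Real numbers are only combined, compared and used as
coin biases through instructions. `tick` pays for moving a stored number or an index and for loop
control; reading the operands of an instruction is part of its cost. -/

/-- Instructions, indexed by the type of their result. The square matrix operations
(multiplication, inversion, determinant) are primitives whose cost is fixed in `Instr.cost`. -/
inductive Instr : Type → Type
  | tick : Instr Unit
  | add (x y : ℝ) : Instr ℝ
  | sub (x y : ℝ) : Instr ℝ
  | mul (x y : ℝ) : Instr ℝ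
  | div (x y : ℝ) : Instr ℝ
  | exp (x : ℝ) : Instr ℝ
  | sqrt (x : ℝ) : Instr ℝ
  | isZero (x : ℝ) : Instr Bool
  | coin (p : ℝ) : Instr Bool
  | matMul {m : ℕ} (M N : Matrix (Fin m) (Fin m) ℝ) : Instr (Matrix (Fin m) (Fin m) ℝ)
  | matInv {m : ℕ} (M : Matrix (Fin m) (Fin m) ℝ) : Instr (Matrix (Fin m) (Fin m) ℝ)
  | matDet {m : ℕ} (M : Matrix (Fin m) (Fin m) ℝ) : Instr ℝ

/-- The Bernoulli law on `Bool` with bias `p`, truncated to `[0, 1]`. -/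
def bern (p : ℝ) : PMF Bool :=
  PMF.ofFintype (fun b => if b then ENNReal.ofReal (max 0 (min 1 p))
      else ENNReal.ofReal (1 - max 0 (min 1 p))) (by
    have h0 : (0 : ℝ) ≤ max 0 (min 1 p) := le_max_left _ _
    have h1 : max 0 (min 1 p) ≤ (1 : ℝ) := max_le zero_le_one (min_le_left _ _)
    rw [Fintype.sum_bool]
    simp only [if_true, Bool.false_eq_true, if_false]
    rw [← ENNReal.ofReal_add h0 (by linarith)]
    simp)

/-- The law of the result of one instruction; only `coin` is random. -/
def Instr.law : {β : Type} → Instr β → PMF β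
  | _, .tick => PMF.pure ()
  | _, .add x y => PMF.pure (x + y)
  | _, .sub x y => PMF.pure (x - y)
  | _, .mul x y => PMF.pure (x * y)
  | _, .div x y => PMF.pure (x / y)
  | _, .exp x => PMF.pure (Real.exp x)
  | _, .sqrt x => PMF.pure (Real.sqrt x)
  | _, .isZero x => PMF.pure (decide (x = 0))
  | _, .coin p => bern p
  | _, .matMul M N => PMF.pure (M * N)
  | _, .matInv M => PMF.pure M⁻¹
  | _, .matDet M => PMF.pure M.det

/-- The cost of one instruction: `m ^ ω` for the operations on `m × m` matrices, where `ω` is the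
exponent of matrix multiplication, and `1` for everything else. -/
def Instr.cost (ω : ℝ) : {β : Type} → Instr β → ℝ≥0∞
  | _, @Instr.matMul m _ _ => ENNReal.ofReal ((m : ℝ) ^ ω)
  | _, @Instr.matInv m _ => ENNReal.ofReal ((m : ℝ) ^ ω)
  | _, @Instr.matDet m _ => ENNReal.ofReal ((m : ℝ) ^ ω)
  | _, _ => 1

/-- Programs returning a value of type `α`. -/
inductive Prog (α : Type) : Type 1
  | ret (a : α) : Prog α
  | step {β : Type} (i : Instr β) (next : β → Prog α) : Prog α

namespace Prog

/-- Sequential composition. -/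
def bind {α β : Type} : Prog α → (α → Prog β) → Prog β
  | ret a, f => f a
  | step i next, f => step i (fun b => bind (next b) f)

instance : Monad Prog where
  pure := ret
  bind := bind

/-- The law of the output of a program. -/
def law {α : Type} : Prog α → PMF α
  | ret a => PMF.pure a
  | step i next => i.law.bind (fun b => law (next b))

/-- The worst-case running time of a program, over all coin outcomes of positive probability. -/
def worstTime (ω : ℝ) {α : Type} : Prog α → ℝ≥0∞
  | ret _ => 0
  | step i next => i.cost ω + ⨆ b ∈ i.law.support, worstTime ω (next b)

/-- The program consisting of a single instruction. -/
def call {β : Type} (i : Instr β) : Prog β := step i ret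

/-- Fill an array of length `m`; the `j`-th entry is computed by `f j`, and storing it costs `1`. -/
def tabulate {α : Type} : (m : ℕ) → (Fin m → Prog α) → Prog (Fin m → α)
  | 0, _ => ret Fin.elim0
  | m + 1, f => do
      let a ← f 0
      call .tick
      let v ← tabulate m (fun j => f j.succ)
      ret (Fin.cons a v)

/-- Fill a real array with entries `0, …, m - 1`, addressed by natural numbers. -/
def tabulateNat (m : ℕ) (f : ℕ → Prog ℝ) : Prog (ℕ → ℝ) := do
  let v ← tabulate m (fun j => f j)
  ret (fun j => if h : j < m then v ⟨j, h⟩ else 0)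

/-- Compute and add up `m` numbers. -/
def sum : (m : ℕ) → (Fin m → Prog ℝ) → Prog ℝ
  | 0, _ => ret 0
  | m + 1, f => do
      let a ← f 0
      let b ← sum m (fun j => f j.succ)
      call (.add a b)

/-- `x ^ m` by repeated multiplication. -/
def power (x : ℝ) : ℕ → Prog ℝ
  | 0 => ret 1
  | m + 1 => do
      let a ← power x m
      call (.mul a x)

end Prog

open Prog

/-! ## Conditional Poisson sampling

Sets of indices are stored as duplicate-free lists. -/

/-- The dynamic programming table for an index list `i₁, …, i_d`: the row `F(a, ·)` on columns
`0, …, k` for each `a = 1, …, d + 1`, the first row being returned separately. `F(a, j)` is the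
probability that exactly `j` of the independent events with probabilities `p i_a, …, p i_d` occur:
`F(d+1, j) = 1_{j = 0}` and `F(a, j) = (1 - p i_a) F(a+1, j) + p i_a F(a+1, j-1)`. The normalization
by `∏ (1 - p i)` avoids the odds `p / (1 - p)`, so that `p i = 1` is allowed. -/
def dpTable {d : ℕ} (p : Fin d → ℝ) (k : ℕ) :
    List (Fin d) → Prog ((ℕ → ℝ) × List (ℕ → ℝ))
  | [] => do
      let F ← tabulateNat (k + 1) (fun j => ret (if j = 0 then 1 else 0))
      ret (F, [])
  | i :: l => do
      let t ← dpTable p k l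
      let F ← tabulateNat (k + 1) (fun j =>
        match j with
        | 0 => do
            let b ← call (.sub 1 (p i))
            call (.mul b (t.1 0))
        | j + 1 => do
            let b ← call (.sub 1 (p i))
            let x ← call (.mul b (t.1 (j + 1)))
            let y ← call (.mul (p i) (t.1 j))
            call (.add x y))
      ret (F, t.1 :: t.2)

/-- Sample from `{j, …, j + m}` with probabilities proportional to `w`, where `rem` is the total
weight `w j + ⋯ + w (j + m)`. -/
def pickFrom (w : ℕ → ℝ) : (j m : ℕ) → (rem : ℝ) → Prog ℕ
  | j, 0, _ => ret j
  | j, m + 1, rem => do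
      let a ← call (.div (w j) rem)
      let c ← call (.coin a)
      if c then ret j
      else do
        let rem' ← call (.sub rem (w j))
        pickFrom w (j + 1) m rem'

/-- Go through the indices `i_a` in order, with `r` successes left to allocate: include `i_a` with
probability `p i_a F(a+1, r-1) / F(a, r)`, and stop when `r = 0`. -/
def selectIndices {d : ℕ} (p : Fin d → ℝ) :
    List (Fin d) → (ℕ → ℝ) → List (ℕ → ℝ) → ℕ → Prog (List (Fin d))
  | i :: l, F, F' :: Fs, r + 1 => do
      let a ← call (.mul (p i) (F' r))
      let b ← call (.div a (F (r + 1)))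
      let c ← call (.coin b)
      if c then do
        let S ← selectIndices p l F' Fs r
        call .tick
        ret (i :: S)
      else selectIndices p l F' Fs (r + 1)
  | _, _, _, _ => ret []

/-- Conditional Poisson sampling: include each `i ∈ l` independently with probability `p i`,
conditioned on at most `k` inclusions. -/
def conditionalPoisson {d : ℕ} (p : Fin d → ℝ) (l : List (Fin d)) (k : ℕ) :
    Prog (List (Fin d)) := do
  let t ← dpTable p k l
  let total ← Prog.sum (k + 1) (fun j => ret (t.1 j))
  let r ← pickFrom t.1 0 k total
  selectIndices p l t.1 t.2 r

/-! ## The recentered proposal -/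

/-- `z = σ⁻² Xᵀ (y - X θ̂) - θ̂`. -/
def computeZ {n d : ℕ} (X : Matrix (Fin n) (Fin d) ℝ) (y : Fin n → ℝ) (θhat : Fin d → ℝ)
    (σ : ℝ) : Prog (Fin d → ℝ) := do
  let u ← tabulate n (fun i => do
    let s ← Prog.sum d (fun j => call (.mul (X i j) (θhat j)))
    call (.sub (y i) s))
  let v ← call (.mul σ σ)
  tabulate d (fun j => do
    let s ← Prog.sum n (fun i => call (.mul (X i j) (u i)))
    let a ← call (.div s v)
    call (.sub a (θhat j)))

/-- Split a list of indices into those inside and those outside the support of `θhat`. -/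
def splitSupport {d : ℕ} (θhat : Fin d → ℝ) :
    List (Fin d) → Prog (List (Fin d) × List (Fin d))
  | [] => ret ([], [])
  | i :: l => do
      let t ← splitSupport θhat l
      let b ← call (.isZero (θhat i))
      call .tick
      if b then ret (t.1, i :: t.2) else ret (i :: t.1, t.2)

/-- The inclusion probabilities `p i = r i / (1 - q i + r i)`, where
`r i = q i * √(σ² / (1 + σ²)) * exp (σ² / (2 (1 + σ²)) * z i ^ 2)`. -/
def inclusionProbs {d : ℕ} (σ : ℝ) (q z : Fin d → ℝ) : Prog (Fin d → ℝ) := do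
  let v ← call (.mul σ σ)
  let v1 ← call (.add 1 v)
  let c ← call (.div v v1)
  let s ← call (.sqrt c)
  let h ← call (.div c 2)
  tabulate d (fun i => do
    let z2 ← call (.mul (z i) (z i))
    let e ← call (.mul h z2)
    let x ← call (.exp e)
    let a ← call (.mul (q i) s)
    let r ← call (.mul a x)
    let b ← call (.sub 1 (q i))
    let t ← call (.add b r)
    call (.div r t))

/-- One draw from the proposal: `T ∪ ConditionalPoisson(p, k - |T|)`, where the list `T` is the
support of the hint and the list `U` is its complement. -/
def draw {d : ℕ} (p : Fin d → ℝ) (T U : List (Fin d)) (k : ℕ) : Prog (List (Fin d)) := do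
  let W ← conditionalPoisson p U (k - T.length)
  let _ ← tabulate T.length (fun _ => ret ())
  ret (T ++ W)

/-! ## The likelihood ratio -/

/-- With `s = |S|`, the product `Bᵀ B` of the `s × s` block `B` of `X_{:S}` made of the rows
`b s, …, b s + s - 1` (rows beyond `n` are zero). -/
def gramBlock {n d : ℕ} (X : Matrix (Fin n) (Fin d) ℝ) (S : List (Fin d)) (b : ℕ) :
    Prog (Matrix (Fin S.length) (Fin S.length) ℝ) := do
  let M ← tabulate S.length (fun i => tabulate S.length (fun j =>
    ret (if h : b * S.length + i < n then X ⟨b * S.length + i, h⟩ (S.get j) else 0)))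
  let Mt ← tabulate S.length (fun j => tabulate S.length (fun i => ret (M i j)))
  call (.matMul (Matrix.of Mt) (Matrix.of M))

/-- The sum of the first `B` block products; for `B ≥ n / |S|` this is `[Xᵀ X]_{S × S}`. -/
def gram {n d : ℕ} (X : Matrix (Fin n) (Fin d) ℝ) (S : List (Fin d)) :
    ℕ → Prog (Matrix (Fin S.length) (Fin S.length) ℝ)
  | 0 => do
      let M ← tabulate S.length (fun _ => tabulate S.length (fun _ => ret (0 : ℝ)))
      ret (Matrix.of M)
  | B + 1 => do
      let G ← gram X S B
      let H ← gramBlock X S B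
      let M ← tabulate S.length (fun i => tabulate S.length (fun j =>
        call (.add (G i j) (H i j))))
      ret (Matrix.of M)

/-- The likelihood ratio `P(S) / Q(S)` of the unnormalized target
`P(S) = (∏_{i ∈ S} q i / (1 - q i)) * exp (½ z_Sᵀ A_S⁻¹ z_S) / √(det A_S)`, with
`A_S = σ⁻² [Xᵀ X]_{S × S} + I`, and the unnormalized proposal
`Q(S) = (∏_{i ∈ S} q i / (1 - q i)) * exp (σ² / (2 (1 + σ²)) * ‖z_S‖²) * (σ² / (1 + σ²))^(|S| / 2)`.
The common factor cancels, which leaves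
`√((1 + σ⁻²)^|S| / det A_S) * exp (½ z_Sᵀ A_S⁻¹ z_S - σ² / (2 (1 + σ²)) * ‖z_S‖²)`. -/
def likelihoodRatio {n d : ℕ} (X : Matrix (Fin n) (Fin d) ℝ) (σ : ℝ) (z : Fin d → ℝ)
    (S : List (Fin d)) : Prog ℝ := do
  let v ← call (.mul σ σ)
  let G ← gram X S (n / S.length + 1)
  let A ← tabulate S.length (fun i => tabulate S.length (fun j => do
    let g ← call (.div (G i j) v)
    call (.add g (if i = j then 1 else 0))))
  let Ainv ← call (.matInv (Matrix.of A))
  let det ← call (.matDet (Matrix.of A))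
  let quad ← Prog.sum S.length (fun i => do
    let s ← Prog.sum S.length (fun j => call (.mul (Ainv i j) (z (S.get j))))
    call (.mul (z (S.get i)) s))
  let nrm ← Prog.sum S.length (fun i => call (.mul (z (S.get i)) (z (S.get i))))
  let v1 ← call (.add 1 v)
  let a ← call (.div v1 v)
  let pw ← power a S.length
  let x ← call (.div pw det)
  let pre ← call (.sqrt x)
  let c ← call (.div v v1)
  let cn ← call (.mul c nrm)
  let e ← call (.sub quad cn)
  let e2 ← call (.div e 2)
  let ex ← call (.exp e2)
  call (.mul pre ex)

/-! ## Rejection sampling and the posterior support sampler -/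

/-- At most `N` rounds of rejection sampling: draw `S` and accept it with probability
`ratio S / C`. If every round rejects, return a fresh draw. -/
def rejectLoop {α : Type} (prop : Prog α) (ratio : α → Prog ℝ) (C : ℝ) : ℕ → Prog α
  | 0 => prop
  | N + 1 => do
      call .tick
      let S ← prop
      let w ← ratio S
      let a ← call (.div w C)
      let c ← call (.coin a)
      if c then ret S else rejectLoop prop ratio C N

/-- Rejection sampling with density ratio bounded by `C` above and `1 / C` below, and target
accuracy `δ`: it uses `⌈C² log (1 / δ)⌉` rounds. -/
def rejectionSample {α : Type} (prop : Prog α) (ratio : α → Prog ℝ) (C δ : ℝ) : Prog α :=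
  rejectLoop prop ratio C ⌈C ^ 2 * Real.log (1 / δ)⌉₊

/-- The posterior support sampler: rejection sampling (`C = 3`, accuracy `δ / 2`) of the target `P`
on `Ω = {S | supp θhat ⊆ S, |S| ≤ 3/4 k⋆}` with the conditional Poisson proposal recentered by
`θhat`. If `Ω` is empty the empty set is returned. -/
def posteriorSampleGaussian {n d : ℕ} (X : Matrix (Fin n) (Fin d) ℝ) (y : Fin n → ℝ)
    (θhat : Fin d → ℝ) (σ : ℝ) (q : Fin d → ℝ) (kstar : ℕ) (δ : ℝ) :
    Prog (Finset (Fin d)) := do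
  let z ← computeZ X y θhat σ
  let TU ← splitSupport θhat (List.finRange d)
  if 3 * kstar / 4 < TU.1.length then ret ∅
  else do
    let p ← inclusionProbs σ q z
    let S ← rejectionSample (draw p TU.1 TU.2 (3 * kstar / 4)) (likelihoodRatio X σ z) 3 (δ / 2)
    ret S.toFinset

/-! ## The statistical model -/

/-- The spike-and-slab prior `⊗ᵢ ((1 - q i) δ₀ + q i N(0, 1))`. -/
def prior {d : ℕ} (q : Fin d → ℝ) : Measure (Fin d → ℝ) :=
  Measure.pi (fun i => ENNReal.ofReal (1 - q i) • Measure.dirac 0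
    + ENNReal.ofReal (q i) • gaussianReal 0 1)

/-- The noise law `N(0, σ² Iₙ)`. -/
def noise (n : ℕ) (σ : ℝ) : Measure (Fin n → ℝ) :=
  Measure.pi (fun _ => gaussianReal 0 (Real.toNNReal (σ ^ 2)))

/-- The number of nonzero coordinates. -/
def nnz {d : ℕ} (θ : Fin d → ℝ) : ℕ := (Finset.univ.filter (fun i => θ i ≠ 0)).card

/-- The `(ε, s)`-restricted isometry property. -/
def IsRIP {n d : ℕ} (X : Matrix (Fin n) (Fin d) ℝ) (ε s : ℝ) : Prop :=
  ∀ θ : Fin d → ℝ, (nnz θ : ℝ) ≤ s →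
    (1 - ε) * ∑ j, θ j ^ 2 ≤ ∑ i, (X.mulVec θ) i ^ 2 ∧
      ∑ i, (X.mulVec θ) i ^ 2 ≤ (1 + ε) * ∑ j, θ j ^ 2

/-- The sparse recovery guarantee of an estimator `A` (a function of the observation `y`, for the
given measurement matrix `X` and noise level `σ`) at sparsity `k` and RIP parameter `ε`: if `X` is
`(ε, C_A k)`-RIP, then for every fixed `k`-sparse signal and every failure probability `δ`, the
`ℓ∞` error is at most `σ R(k, ε, δ)` with probability at least `1 - δ` over the noise. -/
def SparseRecovery {n d : ℕ} (X : Matrix (Fin n) (Fin d) ℝ) (σ C_A : ℝ) (R : ℕ → ℝ → ℝ → ℝ≥0)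
    (A : (Fin n → ℝ) → (Fin d → ℝ)) (k : ℕ) (ε : ℝ) : Prop :=
  IsRIP X ε (C_A * k) →
    ∀ θ : Fin d → ℝ, nnz θ ≤ k → ∀ δ : ℝ, 0 < δ → δ < 1 →
      noise n σ {ξ | ¬ ∀ j, |A (X.mulVec θ + ξ) j - θ j| ≤ σ * R k ε δ} ≤ ENNReal.ofReal δ

/-- Coordinatewise hard thresholding. -/
def clip {d : ℕ} (x : Fin d → ℝ) (α : ℝ) : Fin d → ℝ := fun i => if α < |x i| then x i else 0

/-- The thresholded estimator `clip (A y, 3 σ R(k⋆, ε, δ₀² / 5))` at `δ₀ = δ / 8`, for which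
`δ₀² / 5 = δ² / 320`. -/
def hint {n d : ℕ} (A : (Fin n → ℝ) → (Fin d → ℝ)) (R : ℕ → ℝ → ℝ → ℝ≥0) (σ : ℝ) (kstar : ℕ)
    (ε δ : ℝ) (y : Fin n → ℝ) : Fin d → ℝ :=
  clip (A y) (3 * σ * R kstar ε (δ ^ 2 / 320))

/-- Extension by zero of a vector in `ℝ^S`. -/
def pad {d : ℕ} (S : Finset (Fin d)) (t : S → ℝ) : Fin d → ℝ :=
  fun i => if h : i ∈ S then t ⟨i, h⟩ else 0

/-- The unnormalized posterior weight of the support `S`. -/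
def suppWeight {n d : ℕ} (X : Matrix (Fin n) (Fin d) ℝ) (σ : ℝ) (q : Fin d → ℝ) (y : Fin n → ℝ)
    (S : Finset (Fin d)) : ℝ :=
  (∏ i ∈ S, q i) * (∏ i ∈ Sᶜ, (1 - q i)) / (2 * Real.pi) ^ ((S.card : ℝ) / 2) *
    ∫ t : S → ℝ, Real.exp (-(1 / (2 * σ ^ 2)) * ∑ i, (y i - (X.mulVec (pad S t)) i) ^ 2
      - (1 / 2) * ∑ j, t j ^ 2)

/-- The posterior law `π_supp(· | X, y)` of the support, as a probability vector. -/
def posteriorSupp {n d : ℕ} (X : Matrix (Fin n) (Fin d) ℝ) (σ : ℝ) (q : Fin d → ℝ)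
    (y : Fin n → ℝ) (S : Finset (Fin d)) : ℝ :=
  suppWeight X σ q y S / ∑ S' : Finset (Fin d), suppWeight X σ q y S'

/-- The total variation distance of a law and a probability vector on a finite type. -/
def tvDist {α : Type} [Fintype α] (ν : PMF α) (π : α → ℝ) : ℝ :=
  (1 / 2) * ∑ a, |(ν a).toReal - π a|

end

end SpikeSlab

open SpikeSlab

/-!
The sampler targets the posterior restricted to the supports that contain `supp θhat` and have at
most `3/4 k⋆` elements, and it is accurate for the following reason.

*The algorithm.* Programs are evaluated by `Prog.expect`, and the steps before the sampling are
deterministic (`Prog.Returns`). The dynamic program realizes conditional Poisson sampling exactly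
(`expect_conditionalPoisson`). If the density ratio of target and proposal is within `[1/3, 3]`,
each rejection round accepts with probability at least `1/9`, so all rounds fail with probability
at most `δ / 2`; together with a mass of at most `δ / 2` outside the restriction this bounds the
total variation distance (`tvDist_sampler_le`).

*The posterior.* A Gaussian integral recentered at `θhat` shows that on the allowed supports the
posterior weight is a constant times the proposal weight times the computed ratio
(`suppWeight_eq_mul_ratioVal`). By the restricted isometry property the precision matrix is within
`ε / σ²` of `(1 + σ⁻²) I`, so the ratio is within `[1/3, 3]` as soon as
`ε σ² / (1 + σ²)² ‖z_S‖²` is at most `3/2` (`ratioVal_mem_Icc`). That length is controlled by the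
errors of `θhat`, the norm of the signal and the correlations `Xᵀ ξ` (`linStat_sq_le`).

*The noise correlations.* Their maximum over `d` columns is of order `σ √(log (d / δ))`, while the
hypothesis on `ε` only involves `R² + log (40 / δ)`. The gap is closed by a lower bound on `R`: an
estimator with error below `σ R` separates the `d` one-sparse signals `t e_j`, `t > 2 σ R`, and a
change of measure shows `log d ≲ t² / σ²` (`log_card_le_of_recovery`).

*The mass outside.* By Bayes' rule the expected posterior mass of the excluded supports is the
probability that the true support is excluded, which happens only if it is large or the estimator
fails; Markov's inequality concludes (`posterior_outside_le`). For this the prior is written as a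
mixture over supports (`prior_eq_sum`). A union bound over the failures of the Chernoff bounds for
the support size, the norm and the noise, of the estimator, and of this Markov bound gives `δ`.

*The running time.* It follows from a compositional bound on all runs (`Prog.Bounded`). Every set
drawn has at most `n` elements, again by the restricted isometry property, so the Gram matrix takes
at most `2 n / |S|` square block products.
-/

namespace SpikeSlab

open Prog

/-! ### Program logic: expectations, deterministic programs, running-time triples -/

/-- The probability with which `coin p` shows `true`: the bias `p` clamped to `[0, 1]`. -/
noncomputable def coinBias (p : ℝ) : ℝ := max 0 (min 1 p)

/-- The expectation of `f` over the result of one instruction. -/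
noncomputable def Instr.expect : {β : Type} → Instr β → (β → ℝ) → ℝ
  | _, .tick, f => f ()
  | _, .add x y, f => f (x + y)
  | _, .sub x y, f => f (x - y)
  | _, .mul x y, f => f (x * y)
  | _, .div x y, f => f (x / y)
  | _, .exp x, f => f (Real.exp x)
  | _, .sqrt x, f => f (Real.sqrt x)
  | _, .isZero x, f => f (decide (x = 0))
  | _, .coin p, f => coinBias p * f true + (1 - coinBias p) * f false
  | _, .matMul M N, f => f (M * N)
  | _, .matInv M, f => f M⁻¹
  | _, .matDet M, f => f M.det

/-- The expectation of `f` over the output of a program, computed by recursion on the program tree.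
Only finitely many outputs have positive probability, so no summability question arises. -/
noncomputable def Prog.expect {α : Type} : Prog α → (α → ℝ) → ℝ
  | ret a, f => f a
  | step i next, f => i.expect (fun b => (next b).expect f)

@[simp] lemma Prog.expect_ret {α : Type} (a : α) (f : α → ℝ) : (ret a).expect f = f a := rfl

@[simp] lemma Prog.expect_call {α : Type} (i : Instr α) (f : α → ℝ) :
    (call i).expect f = i.expect f := rfl

lemma Prog.step_bind {α β γ : Type} (i : Instr α) (g : α → Prog β) (f : β → Prog γ) :
    (step i g >>= f) = step i (fun b => g b >>= f) := rfl

lemma Prog.expect_bind {α β : Type} (p : Prog α) (f : α → Prog β) (g : β → ℝ) :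
    (p >>= f).expect g = p.expect (fun a => (f a).expect g) := by
  induction p with
  | ret a => rfl
  | step i next ih =>
    rw [Prog.step_bind]
    simp only [Prog.expect, ih]

lemma bern_apply_toReal (p : ℝ) (b : Bool) :
    (bern p b).toReal = if b then coinBias p else 1 - coinBias p := by
  have h0 : (0 : ℝ) ≤ max 0 (min 1 p) := le_max_left _ _
  have h1 : max 0 (min 1 p) ≤ (1 : ℝ) := max_le zero_le_one (min_le_left _ _)
  cases b
  · simp only [bern, PMF.ofFintype_apply, coinBias, Bool.false_eq_true, if_false]
    exact ENNReal.toReal_ofReal (by linarith)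
  · simp only [bern, PMF.ofFintype_apply, coinBias, if_true]
    exact ENNReal.toReal_ofReal h0

lemma Prog.law_apply_toReal {α : Type} [DecidableEq α] (p : Prog α) (a : α) :
    (p.law a).toReal = p.expect (fun b => if b = a then 1 else 0) := by
  induction p with
  | ret b =>
    simp only [Prog.law, PMF.pure_apply, Prog.expect, eq_comm]
    split_ifs <;> simp
  | step i next ih =>
    cases i
    case coin p =>
      simp only [Prog.law, Prog.expect, Instr.law, Instr.expect, PMF.bind_apply, tsum_fintype,
        Fintype.sum_bool]
      rw [ENNReal.toReal_add, ENNReal.toReal_mul, ENNReal.toReal_mul, bern_apply_toReal,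
        bern_apply_toReal, ih, ih]
      · simp
      all_goals exact ENNReal.mul_ne_top (PMF.apply_ne_top _ _) (PMF.apply_ne_top _ _)
    all_goals simp only [Prog.law, Prog.expect, Instr.law, Instr.expect, PMF.pure_bind, ih]

lemma coinBias_eq {p : ℝ} (h0 : 0 ≤ p) (h1 : p ≤ 1) : coinBias p = p := by
  simp [coinBias, h0, h1]

/-! #### Deterministic programs -/

/-- The program `p` returns `a`, whatever its coins show. -/
def Prog.Returns {α : Type} (p : Prog α) (a : α) : Prop := ∀ f : α → ℝ, p.expect f = f a

lemma Prog.returns_ret {α : Type} (a : α) : (ret a).Returns a := fun _ => rfl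

lemma Prog.Returns.bind {α β : Type} {p : Prog α} {a : α} {f : α → Prog β} {b : β}
    (h : p.Returns a) (h' : (f a).Returns b) : (p >>= f).Returns b := fun g => by
  rw [Prog.expect_bind, h, h']

lemma Prog.Returns.expect_bind {α β : Type} {p : Prog α} {a : α} (h : p.Returns a)
    (f : α → Prog β) (g : β → ℝ) : (p >>= f).expect g = (f a).expect g := by
  rw [Prog.expect_bind, h]

lemma Prog.returns_tabulate {α : Type} {m : ℕ} {f : Fin m → Prog α} {v : Fin m → α}
    (h : ∀ j, (f j).Returns (v j)) : (tabulate m f).Returns v := by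
  induction m with
  | zero =>
    intro g
    simp only [tabulate, Prog.expect_ret]
    congr 1
    exact funext fun j => j.elim0
  | succ m ih =>
    refine (h 0).bind (Prog.Returns.bind (a := ()) (fun _ => rfl) ?_)
    refine (ih (fun j => h j.succ)).bind ?_
    intro g
    simp only [Prog.expect_ret]
    congr 1
    exact funext fun j => by refine Fin.cases ?_ (fun i => ?_) j <;> rfl

lemma Prog.returns_tabulateNat {m : ℕ} {f : ℕ → Prog ℝ} {v : ℕ → ℝ}
    (h : ∀ j < m, (f j).Returns (v j)) :
    (tabulateNat m f).Returns (fun j => if j < m then v j else 0) := by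
  refine (Prog.returns_tabulate (v := fun j : Fin m => v j) (fun j => h j j.2)).bind ?_
  intro g
  simp only [Prog.expect_ret]
  congr 1

lemma Prog.returns_sum {m : ℕ} {f : Fin m → Prog ℝ} {v : Fin m → ℝ}
    (h : ∀ j, (f j).Returns (v j)) : (Prog.sum m f).Returns (∑ j, v j) := by
  induction m with
  | zero => intro g; simp [Prog.sum]
  | succ m ih =>
    refine (h 0).bind ((ih (fun j => h j.succ)).bind ?_)
    intro g
    simp [Instr.expect, Fin.sum_univ_succ]

lemma Prog.returns_power (x : ℝ) (m : ℕ) : (power x m).Returns (x ^ m) := by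
  induction m with
  | zero => intro g; simp [power]
  | succ m ih =>
    refine ih.bind ?_
    intro g
    simp [Instr.expect, pow_succ]

/-! #### Running-time triples -/

/-- Every run of `p` takes time at most `c` and ends with an output satisfying `P`. -/
def Prog.Bounded (ω : ℝ) {α : Type} (p : Prog α) (c : ℝ≥0∞) (P : α → Prop) : Prop :=
  p.worstTime ω ≤ c ∧ ∀ a ∈ p.law.support, P a

variable {ω : ℝ}

lemma Prog.bounded_ret {α : Type} {a : α} {P : α → Prop} (h : P a) :
    (ret a).Bounded ω 0 P := by
  refine ⟨le_rfl, fun b hb => ?_⟩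
  simp only [Prog.law, PMF.support_pure, Set.mem_singleton_iff] at hb
  exact hb ▸ h

lemma Prog.Bounded.mono {α : Type} {p : Prog α} {c c' : ℝ≥0∞} {P P' : α → Prop}
    (h : p.Bounded ω c P) (hc : c ≤ c') (hP : ∀ a, P a → P' a) : p.Bounded ω c' P' :=
  ⟨h.1.trans hc, fun a ha => hP a (h.2 a ha)⟩

lemma Prog.Bounded.le {α : Type} {p : Prog α} {c c' : ℝ≥0∞} {P : α → Prop}
    (h : p.Bounded ω c P) (hc : c ≤ c') : p.Bounded ω c' P := h.mono hc fun _ => id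

lemma Prog.bounded_call {α : Type} (i : Instr α) :
    (call i).Bounded ω (i.cost ω) (fun _ => True) := by
  refine ⟨?_, fun _ _ => trivial⟩
  simp [call, worstTime]

lemma Prog.Bounded.bind {α β : Type} {p : Prog α} {f : α → Prog β} {c c' : ℝ≥0∞}
    {P : α → Prop} {Q : β → Prop} (h : p.Bounded ω c P)
    (h' : ∀ a, P a → (f a).Bounded ω c' Q) : (p >>= f).Bounded ω (c + c') Q := by
  induction p generalizing c with
  | ret a =>
    have ha : P a := h.2 a (by simp [Prog.law])
    exact (h' a ha).le le_add_self
  | step i next ih =>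
    rw [Prog.step_bind]
    have key : ∀ b ∈ i.law.support,
        (next b >>= f).Bounded ω ((next b).worstTime ω + c') Q := by
      intro b hb
      refine ih b ⟨le_rfl, fun a ha => h.2 a ?_⟩
      simp only [Prog.law, PMF.mem_support_bind_iff]
      exact ⟨b, hb, ha⟩
    refine ⟨le_trans ?_ (add_le_add_left h.1 c'), ?_⟩
    · simp only [worstTime]
      rw [add_assoc]
      gcongr
      refine iSup₂_le fun b hb => (key b hb).1.trans ?_
      gcongr
      exact le_iSup₂ (f := fun b (_ : b ∈ i.law.support) => worstTime ω (next b)) b hb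
    · intro a ha
      simp only [Prog.law, PMF.mem_support_bind_iff] at ha
      obtain ⟨b, hb, ha⟩ := ha
      exact (key b hb).2 a ha

lemma Prog.Bounded.bind' {α β : Type} {p : Prog α} {f : α → Prog β} {c c' : ℝ≥0∞}
    {Q : β → Prop} (h : p.Bounded ω c (fun _ => True))
    (h' : ∀ a, (f a).Bounded ω c' Q) : (p >>= f).Bounded ω (c + c') Q :=
  h.bind fun a _ => h' a

lemma Prog.bounded_tabulate {α : Type} {m : ℕ} {f : Fin m → Prog α} {c : ℝ≥0∞}
    (h : ∀ j, (f j).Bounded ω c (fun _ => True)) :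
    (tabulate m f).Bounded ω (m * (c + 1)) (fun _ => True) := by
  induction m with
  | zero => exact (Prog.bounded_ret trivial).le (zero_le)
  | succ m ih =>
    refine ((h 0).bind' fun a => (Prog.bounded_call _).bind' fun _ =>
      (ih fun j => h j.succ).bind' fun v => Prog.bounded_ret trivial).le (le_of_eq ?_)
    simp only [Instr.cost]
    push_cast
    ring

lemma Prog.bounded_tabulateNat {m : ℕ} {f : ℕ → Prog ℝ} {c : ℝ≥0∞}
    (h : ∀ j, (f j).Bounded ω c (fun _ => True)) :
    (tabulateNat m f).Bounded ω (m * (c + 1)) (fun _ => True) :=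
  ((Prog.bounded_tabulate fun j : Fin m => h j).bind' fun _ => Prog.bounded_ret trivial).le
    (by simp)

lemma Prog.bounded_sum {m : ℕ} {f : Fin m → Prog ℝ} {c : ℝ≥0∞}
    (h : ∀ j, (f j).Bounded ω c (fun _ => True)) :
    (Prog.sum m f).Bounded ω (m * (c + 1)) (fun _ => True) := by
  induction m with
  | zero => exact (Prog.bounded_ret trivial).le (zero_le)
  | succ m ih =>
    refine ((h 0).bind' fun a => (ih fun j => h j.succ).bind' fun b =>
      Prog.bounded_call (.add a b)).le (le_of_eq ?_)
    change c + (m * (c + 1) + 1) = _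
    push_cast
    ring

lemma Prog.bounded_power (x : ℝ) (m : ℕ) :
    (power x m).Bounded ω m (fun _ => True) := by
  induction m with
  | zero => exact (Prog.bounded_ret trivial).le (zero_le)
  | succ m ih =>
    refine (ih.bind' fun a => Prog.bounded_call (.mul a x)).le (le_of_eq ?_)
    change (m : ℝ≥0∞) + 1 = _
    push_cast
    ring

/-! ### Running time of the components -/

lemma bounded_dpTable {d : ℕ} (p : Fin d → ℝ) (k : ℕ) (l : List (Fin d)) :
    (dpTable p k l).Bounded ω ((l.length + 1) * (5 * (k + 1))) (fun _ => True) := by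
  induction l with
  | nil =>
    refine ((bounded_tabulateNat fun j => bounded_ret trivial).bind' fun F =>
      bounded_ret trivial).le ?_
    simp only [zero_add, mul_one, List.length_nil, Nat.cast_zero, one_mul, add_zero]
    push_cast
    exact le_mul_of_one_le_left (zero_le) (by norm_num)
  | cons i l ih =>
    refine (ih.bind' fun t => (bounded_tabulateNat (c := 4) fun j => ?_).bind' fun F =>
      bounded_ret trivial).le (le_of_eq ?_)
    · match j with
      | 0 =>
        refine ((bounded_call (.sub 1 (p i))).bind' fun b =>
          bounded_call (.mul b (t.1 0))).le ?_
        change (1 : ℝ≥0∞) + 1 ≤ 4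
        norm_num
      | j + 1 =>
        refine ((bounded_call (.sub 1 (p i))).bind' fun b =>
          (bounded_call (.mul b (t.1 (j + 1)))).bind' fun x =>
          (bounded_call (.mul (p i) (t.1 j))).bind' fun y => bounded_call (.add x y)).le ?_
        change (1 : ℝ≥0∞) + (1 + (1 + 1)) ≤ 4
        norm_num
    · push_cast [List.length_cons]
      ring

lemma bounded_pickFrom (w : ℕ → ℝ) (j m : ℕ) (r : ℝ) :
    (pickFrom w j m r).Bounded ω (3 * m) (fun i => i ≤ j + m) := by
  induction m generalizing j r with
  | zero => exact (bounded_ret (by simp)).le (zero_le)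
  | succ m ih =>
    refine ((bounded_call (.div (w j) r)).bind' fun a => (bounded_call (.coin a)).bind'
      (c' := 1 + 3 * m) fun c => ?_).le ?_
    · split_ifs
      · exact (bounded_ret (by omega)).le (zero_le)
      · exact (bounded_call (.sub r (w j))).bind' fun r' =>
          (ih (j + 1) r').mono le_rfl fun i hi => by omega
    · change (1 : ℝ≥0∞) + (1 + (1 + 3 * m)) ≤ _
      push_cast
      exact le_of_eq (by ring)

lemma bounded_selectIndices {d : ℕ} (p : Fin d → ℝ) (l : List (Fin d)) (F : ℕ → ℝ)
    (Fs : List (ℕ → ℝ)) (r : ℕ) :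
    (selectIndices p l F Fs r).Bounded ω (4 * l.length)
      (fun W => W.Sublist l ∧ W.length ≤ r) := by
  induction l generalizing F Fs r with
  | nil => exact (bounded_ret (by simp)).le (zero_le)
  | cons i l ih =>
    match Fs, r with
    | [], r => exact (bounded_ret (by simp)).le (zero_le)
    | F' :: Fs, 0 => exact (bounded_ret (by simp)).le (zero_le)
    | F' :: Fs, r + 1 =>
      refine ((bounded_call (.mul (p i) (F' r))).bind' fun a =>
        (bounded_call (.div a (F (r + 1)))).bind' fun b => (bounded_call (.coin b)).bind'
        (c' := 1 + 4 * l.length) fun c => ?_).le ?_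
      · split_ifs
        · refine ((ih F' Fs r).bind fun S hS => (bounded_call .tick).bind' fun _ =>
            bounded_ret ?_).le ?_
          · exact ⟨hS.1.cons_cons i, by simpa using hS.2⟩
          · change (4 * (l.length : ℝ≥0∞)) + (1 + 0) ≤ _
            exact le_of_eq (by ring)
        · exact (ih F' Fs (r + 1)).mono le_add_self fun W hW => ⟨hW.1.cons i, hW.2⟩
      · change (1 : ℝ≥0∞) + (1 + (1 + (1 + 4 * l.length))) ≤ _
        push_cast [List.length_cons]
        exact le_of_eq (by ring)

lemma bounded_conditionalPoisson {d : ℕ} (p : Fin d → ℝ) (l : List (Fin d)) (k : ℕ) :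
    (conditionalPoisson p l k).Bounded ω (13 * ((l.length + 1) * (k + 1)))
      (fun W => W.Sublist l ∧ W.length ≤ k) := by
  refine ((bounded_dpTable p k l).bind' fun t => (bounded_sum fun j => bounded_ret trivial).bind'
    fun tot => (bounded_pickFrom t.1 0 k tot).bind fun r hr =>
    (bounded_selectIndices p l t.1 t.2 r).mono le_rfl fun W hW =>
      ⟨hW.1, hW.2.trans (by omega)⟩).le ?_
  push_cast
  norm_cast
  nlinarith [Nat.zero_le (l.length * k)]

lemma bounded_draw {d : ℕ} (p : Fin d → ℝ) (T U : List (Fin d)) (k : ℕ) (hT : T.length ≤ k) :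
    (draw p T U k).Bounded ω (13 * ((T.length + U.length + 1) * (k + 1)))
      (fun S => S.Sublist (T ++ U) ∧ S.length ≤ k) := by
  refine ((bounded_conditionalPoisson p U (k - T.length)).bind fun W hW =>
    (bounded_tabulate fun _ => bounded_ret trivial).bind' fun _ => bounded_ret
      ⟨(List.Sublist.refl T).append hW.1, by rw [List.length_append]; omega⟩).le ?_
  push_cast
  norm_cast
  have : k - T.length + 1 ≤ k + 1 := by omega
  nlinarith [Nat.zero_le (T.length * k), Nat.mul_le_mul_left (U.length + 1) this]

lemma bounded_computeZ {n d : ℕ} (X : Matrix (Fin n) (Fin d) ℝ) (y : Fin n → ℝ)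
    (θ : Fin d → ℝ) (σ : ℝ) :
    (computeZ X y θ σ).Bounded ω (4 * (n * d) + 2 * n + 3 * d + 1) (fun _ => True) := by
  refine ((bounded_tabulate fun i => (bounded_sum fun j =>
    bounded_call (.mul (X i j) (θ j))).bind' fun s => bounded_call (.sub (y i) s)).bind' fun u =>
    (bounded_call (.mul σ σ)).bind' fun v => bounded_tabulate fun j => (bounded_sum fun i =>
      bounded_call (.mul (X i j) (u i))).bind' fun s => (bounded_call (.div s v)).bind' fun a =>
        bounded_call (.sub a (θ j))).le (le_of_eq ?_)
  change (n : ℝ≥0∞) * (d * (1 + 1) + 1 + 1) + (1 + d * (n * (1 + 1) + (1 + 1) + 1)) = _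
  ring

lemma bounded_splitSupport {d : ℕ} (θ : Fin d → ℝ) (l : List (Fin d)) :
    (splitSupport θ l).Bounded ω (2 * l.length)
      (fun t => t = (l.filter (fun i => decide (θ i ≠ 0)), l.filter (fun i => decide (θ i = 0)))) := by
  induction l with
  | nil => exact (bounded_ret (by simp)).le (zero_le)
  | cons i l ih =>
    have hz : (call (.isZero (θ i))).Bounded ω 1 (fun b => b = decide (θ i = 0)) := by
      refine ⟨(bounded_call (ω := ω) (.isZero (θ i))).1, fun b hb => ?_⟩
      simpa [call, law, Instr.law] using hb
    refine (ih.bind (c' := 2) fun t ht => (hz.bind (c' := 1) fun b hb =>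
      ((bounded_call .tick).bind' (c' := 0) fun _ => ?_).le ?_).le ?_).le ?_
    · subst ht hb
      by_cases h : θ i = 0
      · simpa [h] using bounded_ret (by simp)
      · simpa [h] using bounded_ret (by simp)
    · change (1 : ℝ≥0∞) + 0 ≤ 1
      simp
    · norm_num
    · push_cast [List.length_cons]
      exact le_of_eq (by ring)

lemma bounded_inclusionProbs {d : ℕ} (σ : ℝ) (q z : Fin d → ℝ) :
    (inclusionProbs σ q z).Bounded ω (9 * d + 5) (fun _ => True) := by
  refine ((bounded_call (.mul σ σ)).bind' fun v => (bounded_call (.add 1 v)).bind' fun v1 =>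
    (bounded_call (.div v v1)).bind' fun c => (bounded_call (.sqrt c)).bind' fun s =>
    (bounded_call (.div c 2)).bind' fun h => bounded_tabulate fun i =>
    (bounded_call (.mul (z i) (z i))).bind' fun z2 => (bounded_call (.mul h z2)).bind' fun e =>
    (bounded_call (.exp e)).bind' fun x => (bounded_call (.mul (q i) s)).bind' fun a =>
    (bounded_call (.mul a x)).bind' fun r => (bounded_call (.sub 1 (q i))).bind' fun b =>
    (bounded_call (.add b r)).bind' fun t => bounded_call (.div r t)).le (le_of_eq ?_)
  change (1 : ℝ≥0∞) + (1 + (1 + (1 + (1 + d * (1 + (1 + (1 + (1 + (1 + (1 + (1 + 1)))))) + 1))))) = _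
  ring

lemma bounded_gramBlock {n d : ℕ} (X : Matrix (Fin n) (Fin d) ℝ) (S : List (Fin d)) (b : ℕ) :
    (gramBlock X S b).Bounded ω
      (2 * (S.length * (S.length + 1)) + ENNReal.ofReal ((S.length : ℝ) ^ ω)) (fun _ => True) := by
  refine ((bounded_tabulate fun i => bounded_tabulate fun j => bounded_ret trivial).bind' fun M =>
    (bounded_tabulate fun j => bounded_tabulate fun i => bounded_ret trivial).bind' fun Mt =>
    bounded_call (.matMul (Matrix.of Mt) (Matrix.of M))).le (le_of_eq ?_)
  change (S.length : ℝ≥0∞) * (S.length * (0 + 1) + 1) + (S.length * (S.length * (0 + 1) + 1) +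
    ENNReal.ofReal ((S.length : ℝ) ^ ω)) = _
  ring

lemma bounded_gram {n d : ℕ} (X : Matrix (Fin n) (Fin d) ℝ) (S : List (Fin d)) (B : ℕ) :
    (gram X S B).Bounded ω (S.length * (S.length + 1) +
      B * (4 * (S.length * (S.length + 1)) + ENNReal.ofReal ((S.length : ℝ) ^ ω)))
      (fun _ => True) := by
  induction B with
  | zero =>
    refine ((bounded_tabulate fun i => bounded_tabulate fun j => bounded_ret trivial).bind'
      fun M => bounded_ret trivial).le (le_of_eq ?_)
    push_cast
    ring
  | succ B ih =>
    refine (ih.bind' fun G => (bounded_gramBlock X S B).bind' fun H =>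
      (bounded_tabulate fun i => bounded_tabulate fun j =>
        bounded_call (.add (G i j) (H i j))).bind' fun M => bounded_ret trivial).le ?_
    generalize ENNReal.ofReal ((S.length : ℝ) ^ ω) = M
    change (S.length : ℝ≥0∞) * (S.length + 1) + B * (4 * (S.length * (S.length + 1)) + M) +
      (2 * (S.length * (S.length + 1)) + M + (S.length * (S.length * (1 + 1) + 1) + 0)) ≤ _
    calc _ = (S.length : ℝ≥0∞) * (S.length + 1) + B * (4 * (S.length * (S.length + 1)) + M)
          + (2 * (S.length * (S.length + 1)) + M + S.length * (2 * S.length + 1)) := by ring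
      _ ≤ (S.length : ℝ≥0∞) * (S.length + 1) + B * (4 * (S.length * (S.length + 1)) + M)
          + (2 * (S.length * (S.length + 1)) + M + S.length * (2 * S.length + 2)) := by
        gcongr; norm_num
      _ = _ := by push_cast; ring

lemma bounded_call_one {β : Type} (i : Instr β) (h : i.cost ω = 1) :
    (call i).Bounded ω 1 (fun _ => True) := h ▸ bounded_call i

lemma bounded_call_mat {β : Type} {s : ℕ} (i : Instr β)
    (h : i.cost ω = ENNReal.ofReal ((s : ℝ) ^ ω)) :
    (call i).Bounded ω (ENNReal.ofReal ((s : ℝ) ^ ω)) (fun _ => True) := h ▸ bounded_call i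

lemma bounded_likelihoodRatio {n d : ℕ} (X : Matrix (Fin n) (Fin d) ℝ) (σ : ℝ) (z : Fin d → ℝ)
    (S : List (Fin d)) :
    (likelihoodRatio X σ z S).Bounded ω
      (11 + ((n / S.length + 1 : ℕ) : ℝ≥0∞) *
        (21 * S.length ^ 2 + 3 * ENNReal.ofReal ((S.length : ℝ) ^ ω)))
      (fun _ => True) := by
  refine ((bounded_call_one (.mul σ σ) rfl).bind' fun v => (bounded_gram X S _).bind' fun G =>
    (bounded_tabulate fun i => bounded_tabulate fun j => (bounded_call_one (.div (G i j) v) rfl).bind'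
      fun g => bounded_call_one (.add g (if i = j then 1 else 0)) rfl).bind' fun A =>
    (bounded_call_mat (.matInv (Matrix.of A)) rfl).bind' fun Ainv =>
    (bounded_call_mat (.matDet (Matrix.of A)) rfl).bind' fun det =>
    (bounded_sum fun i => (bounded_sum fun j =>
      bounded_call_one (.mul (Ainv i j) (z (S.get j))) rfl).bind' fun s =>
        bounded_call_one (.mul (z (S.get i)) s) rfl).bind' fun quad =>
    (bounded_sum fun i => bounded_call_one (.mul (z (S.get i)) (z (S.get i))) rfl).bind' fun nrm =>
    (bounded_call_one (.add 1 v) rfl).bind' fun v1 => (bounded_call_one (.div v1 v) rfl).bind' fun a =>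
    (bounded_power a S.length).bind' fun pw => (bounded_call_one (.div pw det) rfl).bind' fun x =>
    (bounded_call_one (.sqrt x) rfl).bind' fun pre => (bounded_call_one (.div v v1) rfl).bind' fun c =>
    (bounded_call_one (.mul c nrm) rfl).bind' fun cn => (bounded_call_one (.sub quad cn) rfl).bind' fun e =>
    (bounded_call_one (.div e 2) rfl).bind' fun e2 => (bounded_call_one (.exp e2) rfl).bind' fun ex =>
    bounded_call_one (.mul pre ex) rfl).le ?_
  generalize hM : ENNReal.ofReal ((S.length : ℝ) ^ ω) = M
  generalize S.length = s
  generalize n / s = B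
  have hs : (s : ℝ≥0∞) ≤ s ^ 2 := by
    norm_cast
    exact Nat.le_self_pow (by norm_num) s
  change 1 + (s * (s + 1) + ((B + 1 : ℕ) : ℝ≥0∞) * (4 * (s * (s + 1)) + M) +
    (s * (s * (1 + 1 + 1) + 1) + (M + (M + (s * (s * (1 + 1) + 1 + 1) + (s * (1 + 1) +
      (1 + (1 + (s + (1 + (1 + (1 + (1 + (1 + (1 + (1 + 1)))))))))))))))) ≤ _
  have hB : (1 : ℝ≥0∞) ≤ ((B + 1 : ℕ) : ℝ≥0∞) := by norm_cast; omega
  generalize ((B + 1 : ℕ) : ℝ≥0∞) = b at *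
  calc _ = 11 + (1 * (6 * s ^ 2 + 7 * s + 2 * M) + b * (4 * s ^ 2 + 4 * s + M)) := by
        ring
    _ ≤ 11 + (b * (6 * s ^ 2 + 7 * s ^ 2 + 2 * M) + b * (4 * s ^ 2 + 4 * s ^ 2 + M)) := by
        gcongr
    _ = _ := by ring

/-! ### Vectors padded by zeroes and the restricted isometry property -/

lemma sum_mul_pad {d : ℕ} (S : Finset (Fin d)) (t : S → ℝ) (f : Fin d → ℝ) :
    ∑ j, f j * pad S t j = ∑ j : S, f j * t j := by
  rw [← Finset.sum_subset (Finset.subset_univ S)]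
  · rw [← Finset.sum_attach]
    exact Finset.sum_congr rfl fun j _ => by simp [pad]
  · intro j _ hj
    simp [pad, hj]

lemma mulVec_pad {n d : ℕ} (X : Matrix (Fin n) (Fin d) ℝ) (S : Finset (Fin d)) (t : S → ℝ)
    (i : Fin n) : X.mulVec (pad S t) i = ∑ j : S, X i j * t j :=
  sum_mul_pad S t (X i)

lemma sum_pad_sq {d : ℕ} (S : Finset (Fin d)) (t : S → ℝ) :
    ∑ j, pad S t j ^ 2 = ∑ j, t j ^ 2 := by
  simp only [pow_two]
  rw [sum_mul_pad]
  exact Finset.sum_congr rfl fun j _ => by simp [pad]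

lemma nnz_le_card {d : ℕ} {S : Finset (Fin d)} {θ : Fin d → ℝ} (h : ∀ i ∉ S, θ i = 0) :
    nnz θ ≤ S.card := by
  refine Finset.card_le_card fun i hi => ?_
  by_contra hS
  exact (Finset.mem_filter.1 hi).2 (h i hS)

lemma nnz_pad_le {d : ℕ} (S : Finset (Fin d)) (t : S → ℝ) : nnz (pad S t) ≤ S.card :=
  nnz_le_card fun i hi => by simp [pad, hi]

/-- A restricted isometry is injective on vectors supported on few coordinates, so it has at least
as many rows as the sparsity level allows columns. -/
lemma IsRIP.card_le {n d : ℕ} {X : Matrix (Fin n) (Fin d) ℝ} {ε s : ℝ} (hX : IsRIP X ε s)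
    (hε : ε < 1) (S : Finset (Fin d)) (hS : (S.card : ℝ) ≤ s) : S.card ≤ n := by
  by_contra! h
  let M : Matrix (Fin n) S ℝ := fun i j => X i j
  have hker := LinearMap.ker_ne_bot_of_finrank_lt (f := M.mulVecLin) (by simpa using h)
  obtain ⟨t, ht, ht0⟩ := (Submodule.ne_bot_iff _).1 hker
  have h1 := (hX (pad S t) ((Nat.cast_le.2 (nnz_pad_le S t)).trans hS)).1
  have h2 : ∀ i, X.mulVec (pad S t) i = 0 := fun i => by
    rw [mulVec_pad]
    exact congrFun ht i
  simp only [h2, sum_pad_sq] at h1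
  have h3 : 0 < ∑ j, t j ^ 2 := by
    obtain ⟨j, hj⟩ := Function.ne_iff.1 ht0
    exact Finset.sum_pos' (fun j _ => sq_nonneg _) ⟨j, Finset.mem_univ _, by
      have : t j ≠ 0 := hj
      positivity⟩
  have h4 : 0 < (1 - ε) * ∑ j, t j ^ 2 := mul_pos (by linarith) h3
  exact absurd h1 (not_le.2 (by simpa using h4))

/-! ### Running time of the sampler -/

lemma bounded_rejectLoop {α : Type} {prop : Prog α} {ratio : α → Prog ℝ} {C : ℝ} {a b : ℝ≥0∞}
    {P : α → Prop} (h : prop.Bounded ω a P)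
    (h' : ∀ S, P S → (ratio S).Bounded ω b (fun _ => True)) (N : ℕ) :
    (rejectLoop prop ratio C N).Bounded ω (N * (a + b + 3) + a) P := by
  induction N with
  | zero => exact h.le (by simp)
  | succ N ih =>
    refine ((bounded_call_one .tick rfl).bind' fun _ => h.bind fun S hS => (h' S hS).bind'
      (c' := 1 + (1 + (N * (a + b + 3) + a))) fun w =>
      (bounded_call_one (.div w C) rfl).bind' fun x =>
      (bounded_call_one (.coin x) rfl).bind' fun c => ?_).le (le_of_eq ?_)
    · split_ifs
      · exact (bounded_ret hS).le (zero_le)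
      · exact ih
    · push_cast
      ring

/-- The cost of one likelihood ratio: `n / s + 1 ≤ 2 n / s` blocks of size `s ≤ n`. -/
lemma likelihoodRatio_cost_le (hω : 2 ≤ ω) {n k s : ℕ} (hn : 1 ≤ n) (hk : 1 ≤ k) (hsn : s ≤ n)
    (hsk : s ≤ k) :
    11 + ((n / s + 1 : ℕ) : ℝ≥0∞) * (21 * s ^ 2 + 3 * ENNReal.ofReal ((s : ℝ) ^ ω)) ≤
      ENNReal.ofReal (59 * (n * (k : ℝ) ^ (ω - 1))) := by
  have h0 : (0 : ℝ) ≤ (s : ℝ) ^ ω := Real.rpow_nonneg (Nat.cast_nonneg _) _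
  have e : 11 + ((n / s + 1 : ℕ) : ℝ≥0∞) * (21 * s ^ 2 + 3 * ENNReal.ofReal ((s : ℝ) ^ ω)) =
      ENNReal.ofReal (11 + ((n / s + 1 : ℕ) : ℝ) * (21 * s ^ 2 + 3 * (s : ℝ) ^ ω)) := by
    rw [ENNReal.ofReal_add (by norm_num) (by positivity), ENNReal.ofReal_mul (by positivity),
      ENNReal.ofReal_add (by positivity) (by positivity), ENNReal.ofReal_mul (by norm_num),
      ENNReal.ofReal_mul (by norm_num), ENNReal.ofReal_pow (by positivity), ENNReal.ofReal_natCast,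
      ENNReal.ofReal_natCast]
    simp
  rw [e]
  apply ENNReal.ofReal_le_ofReal
  have hn' : (1 : ℝ) ≤ n := by exact_mod_cast hn
  have hk' : (1 : ℝ) ≤ k := by exact_mod_cast hk
  have h1 : (1 : ℝ) ≤ (k : ℝ) ^ (ω - 1) := Real.one_le_rpow hk' (by linarith)
  have h2 : (1 : ℝ) ≤ n * (k : ℝ) ^ (ω - 1) := by nlinarith
  rcases Nat.eq_zero_or_pos s with rfl | hs
  · rw [Nat.cast_zero, Real.zero_rpow (by linarith)]
    nlinarith
  have hs' : (0 : ℝ) < s := by exact_mod_cast hs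
  have hs1 : (1 : ℝ) ≤ s := by exact_mod_cast hs
  have hB : ((n / s + 1 : ℕ) : ℝ) * s ≤ 2 * n := by
    have : (n / s + 1) * s ≤ 2 * n := by
      have := Nat.div_mul_le_self n s
      nlinarith
    exact_mod_cast this
  have hp : (s : ℝ) ^ ω = s * (s : ℝ) ^ (ω - 1) := by
    rw [Real.rpow_sub_one hs'.ne']
    field_simp
  have hle : (s : ℝ) ^ (ω - 1) ≤ (k : ℝ) ^ (ω - 1) :=
    Real.rpow_le_rpow hs'.le (by exact_mod_cast hsk) (by linarith)
  have hle' : (s : ℝ) ≤ (k : ℝ) ^ (ω - 1) := by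
    refine le_trans ?_ hle
    calc (s : ℝ) = (s : ℝ) ^ (1 : ℝ) := (Real.rpow_one _).symm
      _ ≤ _ := Real.rpow_le_rpow_of_exponent_le hs1 (by linarith)
  calc 11 + ((n / s + 1 : ℕ) : ℝ) * (21 * s ^ 2 + 3 * (s : ℝ) ^ ω)
      = 11 + ((n / s + 1 : ℕ) : ℝ) * s * (21 * s + 3 * (s : ℝ) ^ (ω - 1)) := by rw [hp]; ring
    _ ≤ 11 * (n * (k : ℝ) ^ (ω - 1)) +
        2 * n * (21 * (k : ℝ) ^ (ω - 1) + 3 * (k : ℝ) ^ (ω - 1)) := by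
        gcongr
        linarith
    _ = _ := by ring

/-- The restricted isometry property enters through `|S| ≤ n`: forming the Gram matrix of a larger set
would cost more than `n |S| ^ (ω - 1)`. -/
lemma worstTime_posteriorSampleGaussian_le (hω : 2 ≤ ω) {n d : ℕ} (hd : 0 < d)
    (X : Matrix (Fin n) (Fin d) ℝ) (y : Fin n → ℝ) (θhat : Fin d → ℝ) (σ : ℝ) (q : Fin d → ℝ)
    {k : ℕ} (hk : 1 ≤ k) {δ ε : ℝ} (hδ : 0 < δ) (hδ1 : δ < 1) (hε : ε < 1) (hX : IsRIP X ε k) :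
    (posteriorSampleGaussian X y θhat σ q k δ).worstTime ω ≤
      ENNReal.ofReal (2000 * (n * d + (d * k + n * (k : ℝ) ^ (ω - 1)) * Real.log (2 / δ))) := by
  have hn : 1 ≤ n := by
    simpa using hX.card_le hε {(⟨0, hd⟩ : Fin d)} (by simpa using hk)
  set m := 3 * k / 4 with hm
  have hmk : m ≤ k := by omega
  set c : ℝ≥0∞ := ENNReal.ofReal (59 * (n * (k : ℝ) ^ (ω - 1)))
  set N : ℕ := ⌈(3 : ℝ) ^ 2 * Real.log (1 / (δ / 2))⌉₊ with hN
  have hall : (posteriorSampleGaussian X y θhat σ q k δ).Bounded ω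
      ((4 * (n * d) + 2 * n + 3 * d + 1) + (2 * d + ((9 * d + 5) +
        (N * (13 * ((d + 1) * (m + 1)) + c + 3) + 13 * ((d + 1) * (m + 1)))))) (fun _ => True) := by
    refine (bounded_computeZ X y θhat σ).bind' fun z => ?_
    have hs := bounded_splitSupport (ω := ω) θhat (List.finRange d)
    rw [List.length_finRange] at hs
    refine hs.bind fun TU hTU => ?_
    split_ifs with h
    · exact (bounded_ret trivial).le (zero_le)
    refine (bounded_inclusionProbs σ q z).bind' fun p => ?_
    have hperm : (TU.1 ++ TU.2).Perm (List.finRange d) := by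
      rw [hTU]
      have := List.filter_append_perm (fun i => decide (θhat i ≠ 0)) (List.finRange d)
      simpa using this
    have hlen : TU.1.length + TU.2.length = d := by
      simpa using hperm.length_eq
    have hnd : (TU.1 ++ TU.2).Nodup := hperm.nodup_iff.2 (List.nodup_finRange d)
    have hdraw := bounded_draw (ω := ω) p TU.1 TU.2 m (not_lt.1 h)
    have hc : (13 * (((TU.1.length : ℝ≥0∞) + TU.2.length + 1) * (m + 1))) =
        13 * (((d : ℝ≥0∞) + 1) * (m + 1)) := by
      rw [show (d : ℝ≥0∞) = ((TU.1.length + TU.2.length : ℕ) : ℝ≥0∞) by rw [hlen]]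
      push_cast; ring
    rw [hc] at hdraw
    refine ((bounded_rejectLoop (b := c) hdraw (fun S hS => ?_) N).bind fun S _ =>
      bounded_ret trivial).le (by simp)
    refine (bounded_likelihoodRatio X σ z S).le ?_
    refine likelihoodRatio_cost_le hω hn hk ?_ (hS.2.trans hmk)
    rw [← List.toFinset_card_of_nodup (hS.1.nodup hnd)]
    refine hX.card_le hε _ ?_
    rw [List.toFinset_card_of_nodup (hS.1.nodup hnd)]
    exact_mod_cast hS.2.trans hmk
  refine hall.1.trans ?_
  have h0 : (0 : ℝ) ≤ (k : ℝ) ^ (ω - 1) := Real.rpow_nonneg (Nat.cast_nonneg _) _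
  have e : ((4 * (n * d) + 2 * n + 3 * d + 1) + (2 * d + ((9 * d + 5) +
        (N * (13 * ((d + 1) * (m + 1)) + c + 3) + 13 * ((d + 1) * (m + 1)))))) =
      ENNReal.ofReal ((4 * (n * d) + 2 * n + 3 * d + 1) + (2 * d + ((9 * d + 5) +
        (N * (13 * ((d + 1) * (m + 1)) + 59 * (n * (k : ℝ) ^ (ω - 1)) + 3)
          + 13 * ((d + 1) * (m + 1)))))) := by
    have hc : (c).toReal = 59 * (n * (k : ℝ) ^ (ω - 1)) := ENNReal.toReal_ofReal (by positivity)
    have hct : c ≠ ∞ := ENNReal.ofReal_ne_top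
    rw [← hc]
    clear hc
    clear_value c
    lift c to ℝ≥0 using hct
    rw [ENNReal.coe_toReal]
    refine Eq.trans ?_ (ENNReal.ofReal_coe_nnreal (p := (4 * (n * d) + 2 * n + 3 * d + 1) +
      (2 * d + ((9 * d + 5) + (N * (13 * ((d + 1) * (m + 1)) + c + 3) +
      13 * ((d + 1) * (m + 1))))))).symm
    push_cast
    rfl
  rw [e]
  apply ENNReal.ofReal_le_ofReal
  have hn' : (1 : ℝ) ≤ n := by exact_mod_cast hn
  have hk' : (1 : ℝ) ≤ k := by exact_mod_cast hk
  have hd' : (1 : ℝ) ≤ d := by exact_mod_cast hd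
  have hm' : (m : ℝ) ≤ k := by exact_mod_cast hmk
  have hlog : Real.log 2 ≤ Real.log (2 / δ) :=
    Real.log_le_log (by norm_num) (by rw [le_div_iff₀ hδ]; linarith)
  have hl2 := Real.log_two_gt_d9
  have hNle : (N : ℝ) ≤ 9 * Real.log (2 / δ) + 1 := by
    have : (1 : ℝ) / (δ / 2) = 2 / δ := by field_simp
    rw [hN, this]
    have h1 : 0 ≤ Real.log (2 / δ) := by linarith
    refine (Nat.ceil_lt_add_one (by positivity)).le.trans (le_of_eq (by ring))
  clear_value N
  set l := Real.log (2 / δ)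
  set M := (k : ℝ) ^ (ω - 1)
  have hN' : (N : ℝ) + 1 ≤ 12 * l := by linarith
  have hnd : (1 : ℝ) ≤ n * d := by nlinarith
  have hdm : ((d : ℝ) + 1) * (m + 1) ≤ 4 * (d * k) := by
    calc ((d : ℝ) + 1) * (m + 1) ≤ (d + d) * (k + k) := by gcongr
      _ = _ := by ring
  have hdk : (1 : ℝ) ≤ d * k := by nlinarith
  have hA : (4 * ((n : ℝ) * d) + 2 * n + 3 * d + 1) + 2 * d + (9 * d + 5) ≤ 26 * (n * d) := by
    nlinarith
  have hB : 13 * (((d : ℝ) + 1) * (m + 1)) + 59 * (n * M) + 3 ≤ 60 * (d * k + n * M) := by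
    nlinarith [mul_nonneg (Nat.cast_nonneg (α := ℝ) n) h0]
  have hnM : 0 ≤ (n : ℝ) * M := by positivity
  calc _ ≤ 26 * ((n : ℝ) * d) + ((N : ℝ) + 1) * (60 * (d * k + n * M)) := by
        have : (N : ℝ) * (13 * (((d : ℝ) + 1) * (m + 1)) + 59 * (n * M) + 3) ≤
          N * (60 * (d * k + n * M)) := by gcongr
        linarith
    _ ≤ 26 * ((n : ℝ) * d) + 12 * l * (60 * (d * k + n * M)) := by gcongr
    _ ≤ _ := by
        have : 0 ≤ l * (d * k + n * M) := by
          have : 0 ≤ l := by linarith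
          positivity
        nlinarith

/-! ### The numbers computed by the sampler -/

/-- The recentered linear statistic `z = σ⁻² Xᵀ (y - X θhat) - θhat`. -/
noncomputable def linStat {n d : ℕ} (X : Matrix (Fin n) (Fin d) ℝ) (y : Fin n → ℝ)
    (θhat : Fin d → ℝ) (σ : ℝ) (j : Fin d) : ℝ :=
  (∑ i, X i j * (y i - X.mulVec θhat i)) / σ ^ 2 - θhat j

lemma returns_computeZ {n d : ℕ} (X : Matrix (Fin n) (Fin d) ℝ) (y : Fin n → ℝ)
    (θhat : Fin d → ℝ) (σ : ℝ) : (computeZ X y θhat σ).Returns (linStat X y θhat σ) := by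
  refine (returns_tabulate (v := fun i => y i - X.mulVec θhat i) fun i =>
    (returns_sum (v := fun j => X i j * θhat j) fun j _ => rfl).bind fun _ => rfl).bind ?_
  refine Returns.bind (a := σ * σ) (fun _ => rfl) ?_
  refine returns_tabulate fun j => (returns_sum
    (v := fun i => X i j * (y i - X.mulVec θhat i)) fun i _ => rfl).bind ?_
  refine Returns.bind (a := (∑ i, X i j * (y i - X.mulVec θhat i)) / (σ * σ)) (fun _ => rfl) ?_
  intro f
  rw [linStat, pow_two]
  rfl

lemma returns_splitSupport {d : ℕ} (θ : Fin d → ℝ) (l : List (Fin d)) :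
    (splitSupport θ l).Returns
      (l.filter (fun i => decide (θ i ≠ 0)), l.filter (fun i => decide (θ i = 0))) := by
  induction l with
  | nil => exact fun _ => rfl
  | cons i l ih =>
    refine ih.bind (Returns.bind (a := decide (θ i = 0)) (fun _ => rfl)
      (Returns.bind (a := ()) (fun _ => rfl) ?_))
    by_cases h : θ i = 0
    · simpa [h] using returns_ret _
    · simpa [h] using returns_ret _

/-- The inclusion odds `r i = q i √(σ² / (1 + σ²)) exp (σ² / (2 (1 + σ²)) z i ²)`, to be compared
with `1 - q i`. -/
noncomputable def inclWeight {d : ℕ} (σ : ℝ) (q z : Fin d → ℝ) (i : Fin d) : ℝ :=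
  q i * √(σ ^ 2 / (1 + σ ^ 2)) * Real.exp (σ ^ 2 / (1 + σ ^ 2) / 2 * z i ^ 2)

/-- The inclusion probabilities of the proposal. -/
noncomputable def inclProb {d : ℕ} (σ : ℝ) (q z : Fin d → ℝ) (i : Fin d) : ℝ :=
  inclWeight σ q z i / (1 - q i + inclWeight σ q z i)

lemma returns_inclusionProbs {d : ℕ} (σ : ℝ) (q z : Fin d → ℝ) :
    (inclusionProbs σ q z).Returns (inclProb σ q z) := by
  have h : inclProb σ q z = fun i => (q i * √(σ * σ / (1 + σ * σ)) *
      Real.exp (σ * σ / (1 + σ * σ) / 2 * (z i * z i))) / (1 - q i +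
      (q i * √(σ * σ / (1 + σ * σ)) * Real.exp (σ * σ / (1 + σ * σ) / 2 * (z i * z i)))) := by
    funext i
    simp only [inclProb, inclWeight, pow_two]
  rw [h]
  refine Returns.bind (a := σ * σ) (fun _ => rfl) <|
    Returns.bind (a := 1 + σ * σ) (fun _ => rfl) <|
    Returns.bind (a := σ * σ / (1 + σ * σ)) (fun _ => rfl) <|
    Returns.bind (a := √(σ * σ / (1 + σ * σ))) (fun _ => rfl) <|
    Returns.bind (a := σ * σ / (1 + σ * σ) / 2) (fun _ => rfl) <|
    returns_tabulate fun i _ => rfl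

/-- The posterior precision matrix `A = σ⁻² Xᵀ X + I` restricted to the columns `e i`. -/
noncomputable def precMat {n d : ℕ} {ι : Type*} [DecidableEq ι] (X : Matrix (Fin n) (Fin d) ℝ)
    (σ : ℝ) (e : ι → Fin d) : Matrix ι ι ℝ :=
  Matrix.of fun i j => (∑ r, X r (e i) * X r (e j)) / σ ^ 2 + if i = j then 1 else 0

/-- The likelihood ratio of target and proposal on the columns `e i`. -/
noncomputable def ratioVal {n d : ℕ} {ι : Type*} [DecidableEq ι] [Fintype ι]
    (X : Matrix (Fin n) (Fin d) ℝ) (σ : ℝ) (z : Fin d → ℝ) (e : ι → Fin d) : ℝ :=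
  √(((1 + σ ^ 2) / σ ^ 2) ^ Fintype.card ι / (precMat X σ e).det) *
    Real.exp ((∑ i, z (e i) * ∑ j, (precMat X σ e)⁻¹ i j * z (e j)
      - σ ^ 2 / (1 + σ ^ 2) * ∑ i, z (e i) * z (e i)) / 2)

lemma ratioVal_comp_equiv {n d : ℕ} {ι κ : Type*} [DecidableEq ι] [Fintype ι] [DecidableEq κ]
    [Fintype κ] (X : Matrix (Fin n) (Fin d) ℝ) (σ : ℝ) (z : Fin d → ℝ) (e : ι → Fin d)
    (f : κ ≃ ι) : ratioVal X σ z (e ∘ f) = ratioVal X σ z e := by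
  have hA : precMat X σ (e ∘ f) = (precMat X σ e).submatrix f f := by
    ext i j
    simp [precMat, f.injective.eq_iff]
  have h1 : ∀ g : ι → ℝ, ∑ i, g (f i) = ∑ i, g i := fun g => f.sum_comp g
  simp only [ratioVal, hA, Matrix.det_submatrix_equiv_self, Matrix.inv_submatrix_equiv,
    Fintype.card_congr f, Matrix.submatrix_apply, Function.comp_apply]
  rw [h1 fun i => z (e i) * z (e i)]
  simp_rw [fun i => h1 fun j => (precMat X σ e)⁻¹ i j * z (e j)]
  rw [h1 fun i => z (e i) * ∑ j, (precMat X σ e)⁻¹ i j * z (e j)]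

lemma returns_gramBlock {n d : ℕ} (X : Matrix (Fin n) (Fin d) ℝ) (S : List (Fin d)) (b : ℕ)
    (g : ℕ → Fin S.length → ℝ)
    (hg : ∀ r i, g r i = if h : r < n then X ⟨r, h⟩ (S.get i) else 0) :
    (gramBlock X S b).Returns
      (Matrix.of fun i j => ∑ r : Fin S.length, g (b * S.length + r) i * g (b * S.length + r) j) := by
  refine (returns_tabulate (v := fun (r i : Fin S.length) => g (b * S.length + r) i) fun r =>
    returns_tabulate fun j => ?_).bind ((returns_tabulate
      (v := fun (i r : Fin S.length) => g (b * S.length + r) i) fun i =>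
        returns_tabulate fun r _ => rfl).bind ?_)
  · rw [hg]
    exact returns_ret _
  · intro f
    rfl

lemma returns_gram_aux {n d : ℕ} (X : Matrix (Fin n) (Fin d) ℝ) (S : List (Fin d)) (B : ℕ)
    (g : ℕ → Fin S.length → ℝ)
    (hg : ∀ r i, g r i = if h : r < n then X ⟨r, h⟩ (S.get i) else 0) :
    (gram X S B).Returns
      (Matrix.of fun i j => ∑ r ∈ Finset.range (B * S.length), g r i * g r j) := by
  induction B with
  | zero =>
    refine (returns_tabulate (v := fun _ _ => 0) fun i => returns_tabulate fun j _ => rfl).bind ?_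
    intro f
    simp only [expect_ret, zero_mul, Finset.range_zero, Finset.sum_empty]
  | succ B ih =>
    refine ih.bind ((returns_gramBlock X S B g hg).bind ((returns_tabulate fun i =>
      returns_tabulate fun j _ => rfl).bind ?_))
    intro f
    simp only [expect_ret, Matrix.of_apply, add_mul, one_mul]
    congr 2
    funext i j
    rw [Finset.sum_range_add, Finset.sum_range (n := S.length)]

/-- The blocks of `|S|` rows exhaust all `n` rows, so their products add up to the Gram matrix. -/
lemma returns_gram {n d : ℕ} (X : Matrix (Fin n) (Fin d) ℝ) (S : List (Fin d)) :
    (gram X S (n / S.length + 1)).Returns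
      (Matrix.of fun i j => ∑ r, X r (S.get i) * X r (S.get j)) := by
  have h := returns_gram_aux X S (n / S.length + 1) _ fun _ _ => rfl
  convert h using 4 with i j
  have hS : 0 < S.length := i.pos
  have hle : n ≤ (n / S.length + 1) * S.length := by
    have := Nat.lt_div_mul_add (a := n) hS
    rw [add_mul, one_mul]
    exact this.le
  rw [← Finset.sum_range_add_sum_Ico _ hle, Finset.sum_range, Finset.sum_eq_zero (s := Finset.Ico _ _),
    add_zero]
  · exact Finset.sum_congr rfl fun r _ => by simp
  · intro r hr
    simp [not_lt.2 (Finset.mem_Ico.1 hr).1]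

lemma returns_likelihoodRatio {n d : ℕ} (X : Matrix (Fin n) (Fin d) ℝ) (σ : ℝ) (z : Fin d → ℝ)
    (S : List (Fin d)) : (likelihoodRatio X σ z S).Returns (ratioVal X σ z S.get) := by
  refine Returns.bind (a := σ * σ) (fun _ => rfl) <| (returns_gram X S).bind <|
    (returns_tabulate fun i => returns_tabulate fun j => Returns.bind
      (a := (∑ r, X r (S.get i) * X r (S.get j)) / (σ * σ)) (fun _ => rfl) fun _ => rfl).bind <|
    Returns.bind (fun _ => rfl) <| Returns.bind (fun _ => rfl) <|
    (returns_sum fun i => (returns_sum fun j _ => rfl).bind fun _ => rfl).bind <|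
    (returns_sum fun i _ => rfl).bind <| Returns.bind (fun _ => rfl) <|
    Returns.bind (fun _ => rfl) <| (returns_power _ _).bind <| Returns.bind (fun _ => rfl) <|
    Returns.bind (fun _ => rfl) <| Returns.bind (fun _ => rfl) <| Returns.bind (fun _ => rfl) <|
    Returns.bind (fun _ => rfl) <| Returns.bind (fun _ => rfl) <| Returns.bind (fun _ => rfl) ?_
  intro f
  simp only [ratioVal, precMat, pow_two, Fintype.card_fin]
  rfl

/-! ### Conditional Poisson sampling -/

/-- The probability that independent coins with biases `p i`, `i ∈ s`, select exactly the subset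
`W` of `s`. -/
noncomputable def coinWeight {ι : Type*} [DecidableEq ι] (p : ι → ℝ) (s W : Finset ι) : ℝ :=
  (∏ i ∈ W, p i) * ∏ i ∈ s \ W, (1 - p i)

/-- The sum of `g W` over the subsets `W` of `s` of cardinality `r`, weighted by `coinWeight`. -/
noncomputable def coinSum {ι : Type*} [DecidableEq ι] (p : ι → ℝ) (s : Finset ι) (r : ℕ)
    (g : Finset ι → ℝ) : ℝ :=
  ∑ W ∈ s.powersetCard r, coinWeight p s W * g W

section

variable {ι : Type*} [DecidableEq ι] {p : ι → ℝ} {s : Finset ι} {i : ι}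

lemma coinWeight_nonneg (hp0 : ∀ i, 0 ≤ p i) (hp1 : ∀ i, p i ≤ 1) (W : Finset ι) :
    0 ≤ coinWeight p s W :=
  mul_nonneg (Finset.prod_nonneg fun i _ => hp0 i)
    (Finset.prod_nonneg fun i _ => sub_nonneg.2 (hp1 i))

lemma coinWeight_insert_of_subset (hi : i ∉ s) {W : Finset ι} (hW : W ⊆ s) :
    coinWeight p (insert i s) W = (1 - p i) * coinWeight p s W := by
  have hiW : i ∉ W := fun h => hi (hW h)
  have h : insert i s \ W = insert i (s \ W) := Finset.insert_sdiff_of_notMem _ hiW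
  rw [coinWeight, coinWeight, h, Finset.prod_insert (by simp [hi])]
  ring

lemma coinWeight_insert_insert (hi : i ∉ s) {W : Finset ι} (hW : W ⊆ s) :
    coinWeight p (insert i s) (insert i W) = p i * coinWeight p s W := by
  have hiW : i ∉ W := fun h => hi (hW h)
  have h : insert i s \ insert i W = s \ W := by
    rw [Finset.insert_sdiff_insert, Finset.sdiff_insert_of_notMem hi]
  rw [coinWeight, coinWeight, h, Finset.prod_insert hiW]
  ring

lemma coinSum_insert_zero (hi : i ∉ s) (g : Finset ι → ℝ) :
    coinSum p (insert i s) 0 g = (1 - p i) * coinSum p s 0 g := by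
  simp [coinSum, coinWeight_insert_of_subset hi, mul_assoc]

lemma coinSum_insert_succ (hi : i ∉ s) (r : ℕ) (g : Finset ι → ℝ) :
    coinSum p (insert i s) (r + 1) g =
      p i * coinSum p s r (fun W => g (insert i W)) + (1 - p i) * coinSum p s (r + 1) g := by
  rw [coinSum, Finset.powersetCard_succ_insert hi, Finset.sum_union, Finset.sum_image, coinSum,
    coinSum, Finset.mul_sum, Finset.mul_sum, add_comm]
  · congr 1 <;> refine Finset.sum_congr rfl fun W hW => ?_
    · rw [coinWeight_insert_insert hi (Finset.mem_powersetCard.1 hW).1, mul_assoc]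
    · rw [coinWeight_insert_of_subset hi (Finset.mem_powersetCard.1 hW).1, mul_assoc]
  · intro W hW W' hW' h
    have h1 : i ∉ W := fun h => hi ((Finset.mem_powersetCard.1 hW).1 h)
    have h2 : i ∉ W' := fun h => hi ((Finset.mem_powersetCard.1 hW').1 h)
    rw [← Finset.erase_insert h1, ← Finset.erase_insert h2]
    exact congrArg (fun s => s.erase i) h
  · rw [Finset.disjoint_left]
    intro W hW hW'
    obtain ⟨W', _, rfl⟩ := Finset.mem_image.1 hW'
    exact hi ((Finset.mem_powersetCard.1 hW).1 (Finset.mem_insert_self _ _))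

lemma coinSum_nonneg (hp0 : ∀ i, 0 ≤ p i) (hp1 : ∀ i, p i ≤ 1) (r : ℕ) :
    0 ≤ coinSum p s r 1 :=
  Finset.sum_nonneg fun W _ => by simpa using coinWeight_nonneg hp0 hp1 W

lemma coinSum_eq_zero (hp0 : ∀ i, 0 ≤ p i) (hp1 : ∀ i, p i ≤ 1) {r : ℕ}
    (h : coinSum p s r 1 = 0) (g : Finset ι → ℝ) : coinSum p s r g = 0 := by
  rw [coinSum, Finset.sum_eq_zero_iff_of_nonneg fun W _ => by
    simpa using coinWeight_nonneg hp0 hp1 W] at h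
  refine Finset.sum_eq_zero fun W hW => ?_
  rw [show coinWeight p s W = 0 by simpa using h W hW, zero_mul]

end

variable {d : ℕ}

/-- The row of the dynamic programming table for the index list `l`. -/
noncomputable def dpRow (p : Fin d → ℝ) (k : ℕ) (l : List (Fin d)) (j : ℕ) : ℝ :=
  if j < k + 1 then coinSum p l.toFinset j 1 else 0

/-- The rows of the dynamic programming table for the proper tails of `l`. -/
noncomputable def dpRows (p : Fin d → ℝ) (k : ℕ) : List (Fin d) → List (ℕ → ℝ)
  | [] => []
  | _ :: l => dpRow p k l :: dpRows p k l

lemma returns_dpTable (p : Fin d → ℝ) (k : ℕ) {l : List (Fin d)} (hl : l.Nodup) :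
    (dpTable p k l).Returns (dpRow p k l, dpRows p k l) := by
  induction l with
  | nil =>
    refine (returns_tabulateNat (v := fun j => coinSum p ∅ j 1) fun j _ => ?_).bind
      (returns_ret _)
    cases j with
    | zero => simpa [coinSum, coinWeight] using returns_ret (1 : ℝ)
    | succ j =>
      have h : coinSum p ∅ (j + 1) 1 = 0 := by
        rw [coinSum, Finset.powersetCard_eq_empty.2 (by simp), Finset.sum_empty]
      simpa [h] using returns_ret (0 : ℝ)
  | cons i l ih =>
    rw [List.nodup_cons] at hl
    have hi : i ∉ l.toFinset := by simpa using hl.1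
    refine (ih hl.2).bind <| (returns_tabulateNat
      (v := fun j => coinSum p (i :: l).toFinset j 1) fun j hj => ?_).bind (returns_ret _)
    rw [List.toFinset_cons]
    match j, hj with
    | 0, hj =>
      rw [coinSum_insert_zero hi]
      refine Returns.bind (a := 1 - p i) (fun _ => rfl) fun f => ?_
      simp only [expect_call, Instr.expect, dpRow, if_pos hj]
    | j + 1, hj =>
      rw [coinSum_insert_succ hi]
      refine Returns.bind (a := 1 - p i) (fun _ => rfl) <|
        Returns.bind (fun _ => rfl) <| Returns.bind (fun _ => rfl) fun f => ?_
      have hj' : j < k + 1 := by omega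
      simp only [expect_call, Instr.expect, dpRow, if_pos hj, if_pos hj']
      rw [add_comm]
      rfl

/-- `pickFrom` draws an index with probability proportional to its weight. Once the remaining
weight is exhausted the program divides by zero, but then it is reached with probability zero. -/
lemma expect_pickFrom (w : ℕ → ℝ) (hw : ∀ j, 0 ≤ w j) (m j : ℕ) (h : ℕ → ℝ)
    (hpos : 0 < ∑ i ∈ Finset.range (m + 1), w (j + i)) :
    (pickFrom w j m (∑ i ∈ Finset.range (m + 1), w (j + i))).expect h =
      (∑ i ∈ Finset.range (m + 1), w (j + i) * h (j + i)) /
        ∑ i ∈ Finset.range (m + 1), w (j + i) := by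
  induction m generalizing j with
  | zero =>
    simp only [zero_add, Finset.range_one, Finset.sum_singleton, add_zero] at hpos ⊢
    rw [mul_comm, mul_div_assoc, div_self hpos.ne', mul_one]
    rfl
  | succ m ih =>
    have hsplit : ∀ g : ℕ → ℝ, ∑ i ∈ Finset.range (m + 1 + 1), g (j + i) =
        g j + ∑ i ∈ Finset.range (m + 1), g (j + 1 + i) := fun g => by
      rw [Finset.sum_range_succ', add_comm]
      simp only [add_zero, add_assoc, add_comm 1]
    have hs1 := hsplit w
    have hs2 := hsplit fun i => w i * h i
    set R := ∑ i ∈ Finset.range (m + 1 + 1), w (j + i)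
    set R' := ∑ i ∈ Finset.range (m + 1), w (j + 1 + i) with hR'
    have hR'0 : 0 ≤ R' := Finset.sum_nonneg fun i _ => hw _
    have hb : coinBias (w j / R) = w j / R :=
      coinBias_eq (div_nonneg (hw j) hpos.le) ((div_le_one hpos).2 (by linarith))
    have e : (pickFrom w j (m + 1) R).expect h =
        w j / R * h j + (1 - w j / R) * (pickFrom w (j + 1) m (R - w j)).expect h := by
      rw [← hb]
      rfl
    rw [e, hs2, show R - w j = R' by linarith]
    rcases hR'0.eq_or_lt with h0 | h0
    · have hz : ∀ i ∈ Finset.range (m + 1), w (j + 1 + i) = 0 :=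
        (Finset.sum_eq_zero_iff_of_nonneg fun i _ => hw _).1 h0.symm
      rw [Finset.sum_eq_zero fun i hi => by rw [hz i hi, zero_mul]]
      have : w j = R := by linarith
      rw [this, div_self hpos.ne']
      field_simp
      ring
    · rw [ih (j + 1) h0, ← hR']
      have : w j = R - R' := by linarith
      rw [this]
      field_simp
      ring

/-- The selection pass draws each `r`-subset with probability proportional to `coinWeight`. A table
entry may vanish, and the branch that divides by it is then reached with probability zero. -/
lemma expect_selectIndices {p : Fin d → ℝ} (hp0 : ∀ i, 0 ≤ p i) (hp1 : ∀ i, p i ≤ 1) {k : ℕ}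
    {l : List (Fin d)} (hl : l.Nodup) {r : ℕ} (hr : r ≤ k) (hpos : 0 < coinSum p l.toFinset r 1)
    {f : List (Fin d) → ℝ} {g : Finset (Fin d) → ℝ}
    (hfg : ∀ W : List (Fin d), W.Sublist l → f W = g W.toFinset) :
    (selectIndices p l (dpRow p k l) (dpRows p k l) r).expect f =
      coinSum p l.toFinset r g / coinSum p l.toFinset r 1 := by
  induction l generalizing r f g with
  | nil =>
    cases r with
    | zero =>
      change f [] = _
      simp [coinSum, coinWeight, hfg]
    | succ r =>
      rw [coinSum, Finset.powersetCard_eq_empty.2 (by simp), Finset.sum_empty] at hpos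
      exact absurd hpos (lt_irrefl _)
  | cons i l ih =>
    cases r with
    | zero =>
      change f [] = _
      rw [hfg [] (List.nil_sublist _)]
      simp only [coinSum, Finset.powersetCard_zero, Finset.sum_singleton, Pi.one_apply,
        mul_one] at hpos ⊢
      rw [mul_comm, mul_div_assoc, div_self hpos.ne', mul_one]
      rfl
    | succ r =>
      have hl' := List.nodup_cons.1 hl
      have hi : i ∉ l.toFinset := by simpa using hl'.1
      have hF : coinSum p (i :: l).toFinset (r + 1) 1 =
          p i * coinSum p l.toFinset r 1 + (1 - p i) * coinSum p l.toFinset (r + 1) 1 := by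
        rw [List.toFinset_cons, coinSum_insert_succ hi]
        rfl
      have hG : coinSum p (i :: l).toFinset (r + 1) g = p i * coinSum p l.toFinset r
          (fun W => g (insert i W)) + (1 - p i) * coinSum p l.toFinset (r + 1) g := by
        rw [List.toFinset_cons, coinSum_insert_succ hi]
      set F := coinSum p (i :: l).toFinset (r + 1) 1
      set F0 := coinSum p l.toFinset r 1 with hF0
      set F1 := coinSum p l.toFinset (r + 1) 1 with hF1
      have hF0n : 0 ≤ F0 := coinSum_nonneg hp0 hp1 _
      have hF1n : 0 ≤ F1 := coinSum_nonneg hp0 hp1 _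
      have h1 : 0 ≤ p i * F0 := mul_nonneg (hp0 i) hF0n
      have h2 : 0 ≤ (1 - p i) * F1 := mul_nonneg (sub_nonneg.2 (hp1 i)) hF1n
      have hb : coinBias (p i * F0 / F) = p i * F0 / F :=
        coinBias_eq (div_nonneg h1 hpos.le) ((div_le_one hpos).2 (by linarith))
      have e : (selectIndices p (i :: l) (dpRow p k (i :: l)) (dpRows p k (i :: l))
          (r + 1)).expect f = p i * F0 / F * (selectIndices p l (dpRow p k l)
            (dpRows p k l) r).expect (fun W => f (i :: W)) + (1 - p i * F0 / F) *
            (selectIndices p l (dpRow p k l) (dpRows p k l) (r + 1)).expect f := by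
        have hF' : dpRow p k (i :: l) (r + 1) = F := by simp only [dpRow]; rw [if_pos (by omega)]
        have hF0' : dpRow p k l r = F0 := by simp only [dpRow]; rw [if_pos (by omega)]
        simp only [dpRows, selectIndices, expect_bind, expect_call, Instr.expect, if_true,
          Bool.false_eq_true, if_false, expect_ret, hF', hF0', hb]
      have ha : p i * F0 * (selectIndices p l (dpRow p k l)
            (dpRows p k l) r).expect (fun W => f (i :: W)) =
          p i * coinSum p l.toFinset r (fun W => g (insert i W)) := by
        rcases hF0n.eq_or_lt with h0 | h0
        · rw [← h0, coinSum_eq_zero hp0 hp1 h0.symm]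
          ring
        · rw [ih hl'.2 (by omega) h0 (g := fun W => g (insert i W)) fun W hW => by
            rw [hfg _ (hW.cons_cons i), List.toFinset_cons], ← hF0]
          field_simp
      have hb' : (1 - p i) * F1 * (selectIndices p l (dpRow p k l)
            (dpRows p k l) (r + 1)).expect f = (1 - p i) * coinSum p l.toFinset (r + 1) g := by
        rcases hF1n.eq_or_lt with h0 | h0
        · rw [← h0, coinSum_eq_zero hp0 hp1 h0.symm]
          ring
        · rw [ih hl'.2 hr h0 fun W hW => hfg W (hW.cons i), ← hF1]
          field_simp
      rw [e, hG, ← ha, ← hb', show (1 - p i * F0 / F) = (1 - p i) * F1 / F by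
        field_simp; linarith]
      ring

/-- Conditional Poisson sampling draws each set of at most `k` indices with probability
proportional to `coinWeight`. -/
lemma expect_conditionalPoisson {p : Fin d → ℝ} (hp0 : ∀ i, 0 ≤ p i) (hp1 : ∀ i, p i ≤ 1) {k : ℕ}
    {l : List (Fin d)} (hl : l.Nodup)
    (hpos : 0 < ∑ W ∈ l.toFinset.powerset with W.card ≤ k, coinWeight p l.toFinset W)
    {f : List (Fin d) → ℝ} {g : Finset (Fin d) → ℝ}
    (hfg : ∀ W : List (Fin d), W.Sublist l → f W = g W.toFinset) :
    (conditionalPoisson p l k).expect f =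
      (∑ W ∈ l.toFinset.powerset with W.card ≤ k, coinWeight p l.toFinset W * g W) /
        ∑ W ∈ l.toFinset.powerset with W.card ≤ k, coinWeight p l.toFinset W := by
  have hsum : ∀ h : Finset (Fin d) → ℝ,
      ∑ W ∈ l.toFinset.powerset with W.card ≤ k, coinWeight p l.toFinset W * h W =
        ∑ r ∈ Finset.range (k + 1), coinSum p l.toFinset r h := by
    intro h
    rw [← Finset.sum_fiberwise_of_maps_to (t := Finset.range (k + 1)) (g := Finset.card)]
    · refine Finset.sum_congr rfl fun r hr => ?_
      rw [coinSum]
      refine Finset.sum_congr ?_ fun _ _ => rfl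
      ext W
      simp only [Finset.mem_filter, Finset.mem_powerset, Finset.mem_powersetCard]
      have := Finset.mem_range.1 hr
      constructor
      · rintro ⟨⟨h1, h2⟩, h3⟩
        exact ⟨h1, h3⟩
      · rintro ⟨h1, h3⟩
        exact ⟨⟨h1, by omega⟩, h3⟩
    · intro W hW
      have := (Finset.mem_filter.1 hW).2
      exact Finset.mem_range.2 (by omega)
  have hsum1 := hsum 1
  simp only [Pi.one_apply, mul_one] at hsum1
  rw [hsum g, hsum1]
  rw [hsum1] at hpos
  have hrow : ∀ r ∈ Finset.range (k + 1), dpRow p k l (0 + r) = coinSum p l.toFinset r 1 := by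
    intro r hr
    rw [zero_add, dpRow, if_pos (Finset.mem_range.1 hr)]
  have htot : ∑ r : Fin (k + 1), dpRow p k l r =
      ∑ r ∈ Finset.range (k + 1), dpRow p k l (0 + r) := by
    simp only [zero_add, Finset.sum_range]
  have hw : ∀ j, 0 ≤ dpRow p k l j := fun j => by
    rw [dpRow]
    split_ifs
    exacts [coinSum_nonneg hp0 hp1 _, le_rfl]
  rw [conditionalPoisson, (returns_dpTable p k hl).expect_bind,
    (returns_sum (v := fun r : Fin (k + 1) => dpRow p k l r) fun r _ => rfl).expect_bind,
    expect_bind, htot, expect_pickFrom _ hw, Finset.sum_congr rfl hrow]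
  · congr 1
    refine Finset.sum_congr rfl fun r hr => ?_
    have hrk : r ≤ k := by have := Finset.mem_range.1 hr; omega
    rw [hrow r hr, zero_add]
    rcases (coinSum_nonneg hp0 hp1 r).eq_or_lt with h0 | h0
    · rw [← h0, coinSum_eq_zero hp0 hp1 h0.symm, zero_mul]
    · rw [expect_selectIndices hp0 hp1 hl hrk h0 hfg]
      field_simp
  · rw [Finset.sum_congr rfl hrow]
    exact hpos

lemma expect_draw {p : Fin d → ℝ} (hp0 : ∀ i, 0 ≤ p i) (hp1 : ∀ i, p i ≤ 1) {m : ℕ}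
    {T U : List (Fin d)} (hU : U.Nodup)
    (hpos : 0 < ∑ W ∈ U.toFinset.powerset with W.card ≤ m - T.length, coinWeight p U.toFinset W)
    {f : List (Fin d) → ℝ} {g : Finset (Fin d) → ℝ}
    (hfg : ∀ W : List (Fin d), W.Sublist U → f (T ++ W) = g W.toFinset) :
    (draw p T U m).expect f =
      (∑ W ∈ U.toFinset.powerset with W.card ≤ m - T.length, coinWeight p U.toFinset W * g W) /
        ∑ W ∈ U.toFinset.powerset with W.card ≤ m - T.length, coinWeight p U.toFinset W := by
  rw [← expect_conditionalPoisson hp0 hp1 hU hpos (f := fun W => f (T ++ W)) hfg, draw, expect_bind]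
  congr 1
  funext W
  rw [(returns_tabulate (v := fun _ => ()) fun _ _ => rfl).expect_bind]
  rfl

/-! ### Rejection sampling -/

/-- Every round accepts with probability `c / C` and then returns a draw from the target `τ`, so
`N` rounds leave the mixture of `τ` and the proposal law `u` with weight `(1 - c / C) ^ N` on the
latter. The map `key` forgets the part of a draw on which its law and the ratio do not depend. -/
lemma expect_rejectLoop {α κ : Type} {prop : Prog α} {ratio : α → Prog ℝ} {ρ : κ → ℝ}
    {key : α → κ} {Good : α → Prop} {Ω : Finset κ} {u τ : κ → ℝ} {c C : ℝ} (hC : 0 < C)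
    (hprop : ∀ (f : α → ℝ) (g : κ → ℝ), (∀ a, Good a → f a = g (key a)) →
      prop.expect f = ∑ s ∈ Ω, u s * g s)
    (hratio : ∀ a, Good a → (ratio a).Returns (ρ (key a))) (hu : ∑ s ∈ Ω, u s = 1)
    (hτ : ∑ s ∈ Ω, τ s = 1) (hρ0 : ∀ s ∈ Ω, 0 ≤ ρ s) (hρC : ∀ s ∈ Ω, ρ s ≤ C)
    (huρ : ∀ s ∈ Ω, u s * ρ s = c * τ s) (N : ℕ) (f : α → ℝ) (g : κ → ℝ)
    (hfg : ∀ a, Good a → f a = g (key a)) :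
    (rejectLoop prop ratio C N).expect f =
      (1 - (1 - c / C) ^ N) * ∑ s ∈ Ω, τ s * g s + (1 - c / C) ^ N * ∑ s ∈ Ω, u s * g s := by
  induction N with
  | zero => simpa [rejectLoop] using hprop f g hfg
  | succ N ih =>
    set E := (rejectLoop prop ratio C N).expect f
    have h1 : (rejectLoop prop ratio C (N + 1)).expect f =
        ∑ s ∈ Ω, u s * (coinBias (ρ s / C) * g s + (1 - coinBias (ρ s / C)) * E) := by
      rw [rejectLoop, Returns.expect_bind (a := ()) (fun _ => rfl), expect_bind]
      refine hprop _ (fun s => coinBias (ρ s / C) * g s + (1 - coinBias (ρ s / C)) * E) ?_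
      intro a ha
      rw [(hratio a ha).expect_bind]
      simp only [expect_bind, expect_call, Instr.expect, if_true, Bool.false_eq_true, if_false,
        expect_ret, hfg a ha, E]
    have h2 : ∀ s ∈ Ω, u s * (coinBias (ρ s / C) * g s + (1 - coinBias (ρ s / C)) * E) =
        c / C * (τ s * g s) + (u s - c / C * τ s) * E := fun s hs => by
      rw [coinBias_eq (div_nonneg (hρ0 s hs) hC.le) ((div_le_one hC).2 (hρC s hs))]
      have := huρ s hs
      field_simp
      linear_combination (g s - E) * this
    rw [h1, Finset.sum_congr rfl h2, Finset.sum_add_distrib, ← Finset.mul_sum, ← Finset.sum_mul,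
      Finset.sum_sub_distrib, ← Finset.mul_sum, hu, hτ, ih]
    ring

/-- A mixture of the normalized restriction of `π` to `Ω` with weight `1 - β`, and of any law on
`Ω` with weight `β`, is within `β + π(Ωᶜ)` of `π`. -/
lemma sum_abs_mixture_sub_le {κ : Type} [Fintype κ] [DecidableEq κ] {Ω : Finset κ}
    {π u ν : κ → ℝ} {β M : ℝ} (hβ0 : 0 ≤ β) (hM : 0 < M) (hM' : ∑ s ∈ Ω, π s = M)
    (hπ0 : ∀ s, 0 ≤ π s) (hπ1 : ∑ s, π s = 1) (hu0 : ∀ s ∈ Ω, 0 ≤ u s) (hu : ∑ s ∈ Ω, u s = 1)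
    (hν : ∀ s, ν s = (1 - β) * (if s ∈ Ω then π s / M else 0) + β * (if s ∈ Ω then u s else 0)) :
    (1 / 2) * ∑ s, |ν s - π s| ≤ β + ∑ s ∈ Ωᶜ, π s := by
  have hsplit := Finset.sum_add_sum_compl Ω π
  have hM1 : M ≤ 1 := by
    have : 0 ≤ ∑ s ∈ Ωᶜ, π s := Finset.sum_nonneg fun s _ => hπ0 s
    linarith
  have h1 : ∀ s ∈ Ω, |ν s - π s| ≤ β * (π s / M + u s) + (1 / M - 1) * π s := fun s hs => by
    have e : ν s - π s = β * (u s - π s / M) + (1 / M - 1) * π s := by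
      rw [hν, if_pos hs, if_pos hs]
      ring
    have h0 : 0 ≤ π s / M := div_nonneg (hπ0 s) hM.le
    have hM2 : 0 ≤ 1 / M - 1 := by rw [sub_nonneg, one_le_div hM]; exact hM1
    rw [e]
    refine (abs_add_le _ _).trans ?_
    rw [abs_mul, abs_of_nonneg hβ0, abs_of_nonneg (mul_nonneg hM2 (hπ0 s))]
    gcongr
    rw [abs_le]
    constructor <;> linarith [hu0 s hs]
  have h2 : ∀ s ∈ Ωᶜ, |ν s - π s| = π s := fun s hs => by
    have hs' := Finset.mem_compl.1 hs
    rw [hν, if_neg hs', if_neg hs']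
    simp [abs_of_nonneg (hπ0 s)]
  rw [← Finset.sum_add_sum_compl Ω, Finset.sum_congr rfl h2]
  have h3 := Finset.sum_le_sum h1
  rw [Finset.sum_add_distrib, ← Finset.mul_sum, ← Finset.mul_sum, Finset.sum_add_distrib, hu,
    ← Finset.sum_div, hM', div_self hM.ne'] at h3
  have h4 : (1 / M - 1) * M = 1 - M := by field_simp
  rw [h4] at h3
  linarith

/-! ### The output law of the sampler -/

/-- The support of a vector. -/
noncomputable def suppSet {d : ℕ} (θ : Fin d → ℝ) : Finset (Fin d) :=
  Finset.univ.filter fun i => θ i ≠ 0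

lemma mem_suppSet {d : ℕ} {θ : Fin d → ℝ} {i : Fin d} : i ∈ suppSet θ ↔ θ i ≠ 0 := by
  simp [suppSet]

/-- The supports that contain `T` and have at most `m` elements. -/
noncomputable def candidates {d : ℕ} (T : Finset (Fin d)) (m : ℕ) : Finset (Finset (Fin d)) :=
  Finset.univ.filter fun S => T ⊆ S ∧ S.card ≤ m

lemma mem_candidates {d : ℕ} {T S : Finset (Fin d)} {m : ℕ} :
    S ∈ candidates T m ↔ T ⊆ S ∧ S.card ≤ m := by
  simp [candidates]

lemma ratioVal_get {n d : ℕ} (X : Matrix (Fin n) (Fin d) ℝ) (σ : ℝ) (z : Fin d → ℝ)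
    {L : List (Fin d)} (hL : L.Nodup) :
    ratioVal X σ z L.get = ratioVal X σ z (fun i : L.toFinset => (i : Fin d)) := by
  rw [← ratioVal_comp_equiv X σ z (fun i : L.toFinset => (i : Fin d))
    ((List.Nodup.getEquiv L hL).trans (Equiv.subtypeEquivRight fun i => List.mem_toFinset.symm))]
  rfl

lemma sum_candidates {d : ℕ} {T : Finset (Fin d)} {m : ℕ} (hT : T.card ≤ m)
    (h : Finset (Fin d) → ℝ) :
    ∑ S ∈ candidates T m, h S = ∑ W ∈ Tᶜ.powerset with W.card ≤ m - T.card, h (T ∪ W) := by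
  symm
  refine Finset.sum_bij' (fun W _ => T ∪ W) (fun S _ => S \ T) ?_ ?_ ?_ ?_ fun _ _ => rfl
  · intro W hW
    simp only [Finset.mem_filter, Finset.mem_powerset] at hW
    refine mem_candidates.2 ⟨Finset.subset_union_left, ?_⟩
    have := Finset.card_union_le T W
    omega
  · intro S hS
    rw [mem_candidates] at hS
    simp only [Finset.mem_filter, Finset.mem_powerset]
    refine ⟨fun i hi => by simpa using (Finset.mem_sdiff.1 hi).2, ?_⟩
    rw [Finset.card_sdiff_of_subset hS.1]
    omega
  · intro W hW
    simp only [Finset.mem_filter, Finset.mem_powerset] at hW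
    ext i
    have := @hW.1 i
    simp only [Finset.mem_compl] at this
    simp only [Finset.mem_sdiff, Finset.mem_union]
    tauto
  · intro S hS
    exact Finset.union_sdiff_of_subset (mem_candidates.1 hS).1

lemma inclWeight_nonneg {d : ℕ} {σ : ℝ} {q z : Fin d → ℝ} (hq : ∀ i, 0 ≤ q i ∧ q i ≤ 1)
    (i : Fin d) : 0 ≤ inclWeight σ q z i :=
  mul_nonneg (mul_nonneg (hq i).1 (Real.sqrt_nonneg _)) (Real.exp_pos _).le

/-- The normalizer `1 - q i + r i` does not vanish, not even for `q i = 1`. -/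
lemma inclWeight_add_pos {d : ℕ} {σ : ℝ} (hσ : 0 < σ) {q z : Fin d → ℝ}
    (hq : ∀ i, 0 ≤ q i ∧ q i ≤ 1) (i : Fin d) : 0 < 1 - q i + inclWeight σ q z i := by
  have h : 0 ≤ inclWeight σ q z i := inclWeight_nonneg hq i
  rcases (hq i).2.lt_or_eq with h1 | h1
  · linarith
  · have : 0 < inclWeight σ q z i := by
      rw [inclWeight, h1]
      positivity
    linarith

lemma inclProb_nonneg {d : ℕ} {σ : ℝ} (hσ : 0 < σ) {q z : Fin d → ℝ}
    (hq : ∀ i, 0 ≤ q i ∧ q i ≤ 1) (i : Fin d) : 0 ≤ inclProb σ q z i :=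
  div_nonneg (inclWeight_nonneg hq i) (inclWeight_add_pos hσ hq i).le

lemma inclProb_le_one {d : ℕ} {σ : ℝ} (hσ : 0 < σ) {q z : Fin d → ℝ}
    (hq : ∀ i, 0 ≤ q i ∧ q i ≤ 1) (i : Fin d) : inclProb σ q z i ≤ 1 :=
  (div_le_one (inclWeight_add_pos hσ hq i)).2 (by linarith [(hq i).2])

/-- If the target `π` has density ratio `ρ ∈ [1/3, 3]` with respect to the unnormalized proposal on
the candidate supports, and gives mass at most `δ / 2` to the others, then the output law of the
sampler is `δ`-close to `π`. -/
theorem tvDist_sampler_le {n d : ℕ} (X : Matrix (Fin n) (Fin d) ℝ) (y : Fin n → ℝ)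
    (θhat : Fin d → ℝ) {σ : ℝ} (hσ : 0 < σ) {q : Fin d → ℝ} (hq : ∀ i, 0 ≤ q i ∧ q i ≤ 1)
    {k : ℕ} {δ : ℝ} (hδ : 0 < δ) (hδ1 : δ < 1) {π : Finset (Fin d) → ℝ} (hπ0 : ∀ S, 0 ≤ π S)
    (hπ1 : ∑ S, π S = 1) (hout : ∑ S ∈ (candidates (suppSet θhat) (3 * k / 4))ᶜ, π S ≤ δ / 2)
    {D : ℝ} (hπ : ∀ S ∈ candidates (suppSet θhat) (3 * k / 4), π S =
      D * (coinWeight (inclProb σ q (linStat X y θhat σ)) (suppSet θhat)ᶜ (S \ suppSet θhat) *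
        ratioVal X σ (linStat X y θhat σ) (fun i : S => (i : Fin d))))
    (hlow : ∀ S ∈ candidates (suppSet θhat) (3 * k / 4),
      1 / 3 ≤ ratioVal X σ (linStat X y θhat σ) (fun i : S => (i : Fin d)))
    (hup : ∀ S ∈ candidates (suppSet θhat) (3 * k / 4),
      ratioVal X σ (linStat X y θhat σ) (fun i : S => (i : Fin d)) ≤ 3) :
    tvDist (posteriorSampleGaussian X y θhat σ q k δ).law π ≤ δ := by
  classical
  set T := suppSet θhat with hT
  set m := 3 * k / 4 with hm
  set Ω := candidates T m with hΩ
  set z := linStat X y θhat σ with hz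
  set p := inclProb σ q z with hp
  set ρ : Finset (Fin d) → ℝ := fun S => ratioVal X σ z (fun i : S => (i : Fin d)) with hρ
  have hp0 : ∀ i, 0 ≤ p i := inclProb_nonneg hσ hq
  have hp1 : ∀ i, p i ≤ 1 := inclProb_le_one hσ hq
  set cw : Finset (Fin d) → ℝ := fun S => coinWeight p Tᶜ (S \ T) with hcw
  have hcw0 : ∀ S, 0 ≤ cw S := fun S => coinWeight_nonneg hp0 hp1 _
  set M := ∑ S ∈ Ω, π S with hM
  have hMpos : 0 < M := by
    have := Finset.sum_add_sum_compl Ω π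
    linarith
  obtain ⟨S₀, hS₀, hπS₀⟩ : ∃ S ∈ Ω, π S ≠ 0 := Finset.exists_ne_zero_of_sum_ne_zero hMpos.ne'
  have hTm : T.card ≤ m :=
    (Finset.card_le_card (mem_candidates.1 hS₀).1).trans (mem_candidates.1 hS₀).2
  have hne : D * (cw S₀ * ρ S₀) ≠ 0 := by rw [← hπ S₀ hS₀]; exact hπS₀
  have hD : D ≠ 0 := left_ne_zero_of_mul hne
  set tot := ∑ S ∈ Ω, cw S with htot
  have htotpos : 0 < tot := by
    refine Finset.sum_pos' (fun S _ => hcw0 S) ⟨S₀, hS₀, ?_⟩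
    exact (hcw0 S₀).lt_of_ne' (left_ne_zero_of_mul (right_ne_zero_of_mul hne))
  set TL := (List.finRange d).filter (fun i => decide (θhat i ≠ 0)) with hTL
  set UL := (List.finRange d).filter (fun i => decide (θhat i = 0)) with hUL
  have hTLn : TL.Nodup := (List.nodup_finRange d).filter _
  have hULn : UL.Nodup := (List.nodup_finRange d).filter _
  have hTLT : TL.toFinset = T := by ext i; simp [hTL, hT, mem_suppSet]
  have hULT : UL.toFinset = Tᶜ := by ext i; simp [hUL, hT, mem_suppSet]
  have hTLlen : TL.length = T.card := by rw [← hTLT, List.toFinset_card_of_nodup hTLn]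
  have hreindex : ∀ g : Finset (Fin d) → ℝ, ∑ S ∈ Ω, cw S * g S =
      ∑ W ∈ Tᶜ.powerset with W.card ≤ m - T.card, coinWeight p Tᶜ W * g (T ∪ W) := fun g => by
    rw [hΩ, sum_candidates hTm]
    refine Finset.sum_congr rfl fun W hW => ?_
    simp only [Finset.mem_filter, Finset.mem_powerset] at hW
    have : (T ∪ W) \ T = W := by
      ext i
      have := @hW.1 i
      simp only [Finset.mem_compl] at this
      simp only [Finset.mem_sdiff, Finset.mem_union]
      tauto
    rw [hcw]
    simp only [this]
  have htot' : tot = ∑ W ∈ Tᶜ.powerset with W.card ≤ m - T.card, coinWeight p Tᶜ W := by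
    have := hreindex 1
    simpa using this
  have hdraw : ∀ (f : List (Fin d) → ℝ) (g : Finset (Fin d) → ℝ),
      (∀ L : List (Fin d), L.Nodup → f L = g L.toFinset) →
      (draw p TL UL m).expect f = ∑ S ∈ Ω, cw S / tot * g S := by
    intro f g hfg
    rw [expect_draw hp0 hp1 hULn (g := fun W => g (T ∪ W))]
    · rw [hULT, hTLlen, ← hreindex, ← htot', Finset.sum_div]
      exact Finset.sum_congr rfl fun S _ => by ring
    · rw [hULT, hTLlen, ← htot']
      exact htotpos
    · intro W hW
      rw [hfg, List.toFinset_append, hTLT]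
      refine List.Nodup.append hTLn (hW.nodup hULn) ?_
      intro i hi hi'
      have h1 : θhat i ≠ 0 := by simpa [hTL] using hi
      have h2 : θhat i = 0 := by simpa [hUL] using hW.subset hi'
      exact h1 h2
  have hu : ∑ S ∈ Ω, cw S / tot = 1 := by rw [← Finset.sum_div, div_self htotpos.ne']
  have hτ : ∑ S ∈ Ω, π S / M = 1 := by rw [← Finset.sum_div, div_self hMpos.ne']
  set c := M / (D * tot) with hc
  have huρ : ∀ S ∈ Ω, cw S / tot * ρ S = c * (π S / M) := fun S hS => by
    rw [show π S = D * (cw S * ρ S) from hπ S hS, hc]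
    field_simp
  -- `c` is the mean of the ratio under the proposal, so it inherits the bounds on the ratio.
  have hc3 : 1 / 3 ≤ c := by
    have h1 : c = ∑ S ∈ Ω, cw S / tot * ρ S := by
      rw [Finset.sum_congr rfl huρ, ← Finset.mul_sum, hτ, mul_one]
    calc (1 : ℝ) / 3 = ∑ S ∈ Ω, cw S / tot * (1 / 3) := by rw [← Finset.sum_mul, hu, one_mul]
      _ ≤ c := by
        rw [h1]
        exact Finset.sum_le_sum fun S hS => mul_le_mul_of_nonneg_left (hlow S hS)
          (div_nonneg (hcw0 S) htotpos.le)
  have hcle : c ≤ 3 := by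
    have h1 : c = ∑ S ∈ Ω, cw S / tot * ρ S := by
      rw [Finset.sum_congr rfl huρ, ← Finset.mul_sum, hτ, mul_one]
    calc c ≤ ∑ S ∈ Ω, cw S / tot * 3 := by
          rw [h1]
          exact Finset.sum_le_sum fun S hS => mul_le_mul_of_nonneg_left (hup S hS)
            (div_nonneg (hcw0 S) htotpos.le)
      _ = 3 := by rw [← Finset.sum_mul, hu, one_mul]
  set N := ⌈(3 : ℝ) ^ 2 * Real.log (1 / (δ / 2))⌉₊ with hN
  set β := (1 - c / 3) ^ N with hβ
  have hβ0 : 0 ≤ β := pow_nonneg (by linarith) _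
  have hβδ : β ≤ δ / 2 := by
    calc β ≤ Real.exp (-(1 / 9)) ^ N := by
          refine pow_le_pow_left₀ (by linarith) ?_ _
          linarith [Real.add_one_le_exp (-(1 / 9 : ℝ))]
      _ = Real.exp (-(N / 9)) := by rw [← Real.exp_nat_mul]; ring_nf
      _ ≤ Real.exp (-Real.log (1 / (δ / 2))) := by
          apply Real.exp_le_exp.2
          have := Nat.le_ceil ((3 : ℝ) ^ 2 * Real.log (1 / (δ / 2)))
          rw [← hN] at this
          linarith
      _ = δ / 2 := by
          rw [Real.exp_neg, Real.exp_log (by positivity)]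
          field_simp
  have hlaw : ∀ S, ((posteriorSampleGaussian X y θhat σ q k δ).law S).toReal =
      (1 - β) * (if S ∈ Ω then π S / M else 0) + β * (if S ∈ Ω then cw S / tot else 0) := by
    intro S
    have hif : ∀ h : Finset (Fin d) → ℝ, ∑ S' ∈ Ω, h S' * (if S' = S then (1 : ℝ) else 0) =
        if S ∈ Ω then h S else 0 := fun h => by
      simp
    rw [law_apply_toReal, posteriorSampleGaussian, (returns_computeZ X y θhat σ).expect_bind,
      (returns_splitSupport θhat _).expect_bind]
    change (if m < TL.length then _ else _ : Prog _).expect _ = _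
    rw [if_neg (by omega), (returns_inclusionProbs σ q _).expect_bind, expect_bind]
    change (rejectLoop (draw p TL UL m) (likelihoodRatio X σ z) 3 N).expect _ = _
    have := expect_rejectLoop (C := 3) (by norm_num) hdraw (ratio := likelihoodRatio X σ z)
      (ρ := ρ) (fun L hL => by
        have := returns_likelihoodRatio X σ z L
        rwa [ratioVal_get X σ z hL] at this) hu hτ
      (fun S hS => by linarith [hlow S hS]) hup huρ N
      (fun L => if L.toFinset = S then 1 else 0) (fun S' => if S' = S then 1 else 0)
      (fun _ _ => rfl)
    rw [hif, hif] at this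
    exact this
  have := sum_abs_mixture_sub_le hβ0 hMpos rfl hπ0 hπ1
    (fun S _ => div_nonneg (hcw0 S) htotpos.le) hu hlaw
  exact this.trans (by linarith)

end SpikeSlab

namespace SpikeSlab

open Matrix

/-! ### Quadratic forms close to a multiple of the identity -/

section

variable {ι : Type*} [Fintype ι] {A : Matrix ι ι ℝ} {lo hi : ℝ}

lemma posDef_of_le_form (hA : A.IsHermitian) (hlo : 0 < lo)
    (h1 : ∀ u : ι → ℝ, lo * (u ⬝ᵥ u) ≤ u ⬝ᵥ A *ᵥ u) : A.PosDef := by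
  refine PosDef.of_dotProduct_mulVec_pos hA fun x hx => ?_
  have : 0 < x ⬝ᵥ x := (dotProduct_self_star_pos_iff (v := x)).2 hx
  exact lt_of_lt_of_le (mul_pos hlo this) (h1 x)

lemma dotProduct_mulVec_comm (hA : A.IsHermitian) (u v : ι → ℝ) :
    u ⬝ᵥ A *ᵥ v = v ⬝ᵥ A *ᵥ u := by
  have hAT : Aᵀ = A := hA
  rw [dotProduct_mulVec, ← mulVec_transpose, hAT, dotProduct_comm]

variable [DecidableEq ι]

/-- All eigenvalues lie in `[lo, hi]`. -/
lemma pow_le_det_of_form (hA : A.IsHermitian) (hlo : 0 < lo)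
    (h1 : ∀ u : ι → ℝ, lo * (u ⬝ᵥ u) ≤ u ⬝ᵥ A *ᵥ u)
    (h2 : ∀ u : ι → ℝ, u ⬝ᵥ A *ᵥ u ≤ hi * (u ⬝ᵥ u)) :
    lo ^ Fintype.card ι ≤ A.det ∧ A.det ≤ hi ^ Fintype.card ι := by
  have hv : ∀ i, (⇑(hA.eigenvectorBasis i) : ι → ℝ) ⬝ᵥ ⇑(hA.eigenvectorBasis i) = 1 := fun i => by
    have := hA.eigenvectorBasis.orthonormal.1 i
    have h3 := EuclideanSpace.real_norm_sq_eq (hA.eigenvectorBasis i)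
    rw [this] at h3
    simp only [dotProduct, ← pow_two]
    linarith
  have he : ∀ i, hA.eigenvalues i = (⇑(hA.eigenvectorBasis i) : ι → ℝ) ⬝ᵥ
      A *ᵥ ⇑(hA.eigenvectorBasis i) := fun i => by
    rw [hA.eigenvalues_eq]
    rfl
  have hl : ∀ i, lo ≤ hA.eigenvalues i := fun i => by
    have := h1 (hA.eigenvectorBasis i)
    rwa [hv, mul_one, ← he] at this
  have hh : ∀ i, hA.eigenvalues i ≤ hi := fun i => by
    have := h2 (hA.eigenvectorBasis i)
    rwa [hv, mul_one, ← he] at this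
  rw [hA.det_eq_prod_eigenvalues]
  constructor
  · rw [← Finset.card_univ, ← Finset.prod_const]
    exact Finset.prod_le_prod (fun i _ => hlo.le) fun i _ => hl i
  · rw [← Finset.card_univ, ← Finset.prod_const]
    exact Finset.prod_le_prod (fun i _ => hlo.le.trans (hl i)) fun i _ => hh i

lemma mulVec_inv_mulVec (hA : A.PosDef) (z : ι → ℝ) : A *ᵥ (A⁻¹ *ᵥ z) = z := by
  rw [mulVec_mulVec, mul_nonsing_inv _ hA.det_pos.ne'.isUnit, one_mulVec]

/-- For the upper bound, `u = A⁻¹ z` satisfies `z ⬝ u = u ⬝ A u`. For the lower bound,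
`2 z ⬝ v - v ⬝ A v ≤ z ⬝ A⁻¹ z` at `v = hi⁻¹ z`. -/
lemma inv_form_bounds (hA : A.IsHermitian) (hlo : 0 < lo) (hhi : 0 < hi)
    (h1 : ∀ u : ι → ℝ, lo * (u ⬝ᵥ u) ≤ u ⬝ᵥ A *ᵥ u)
    (h2 : ∀ u : ι → ℝ, u ⬝ᵥ A *ᵥ u ≤ hi * (u ⬝ᵥ u)) (z : ι → ℝ) :
    (z ⬝ᵥ z) / hi ≤ z ⬝ᵥ A⁻¹ *ᵥ z ∧ z ⬝ᵥ A⁻¹ *ᵥ z ≤ (z ⬝ᵥ z) / lo := by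
  have hP := posDef_of_le_form hA hlo h1
  set u := A⁻¹ *ᵥ z with hu
  have hAu : A *ᵥ u = z := mulVec_inv_mulVec hP z
  have hzu : u ⬝ᵥ A *ᵥ u = z ⬝ᵥ u := by rw [hAu, dotProduct_comm]
  have hnn : ∀ v : ι → ℝ, 0 ≤ v ⬝ᵥ v := fun v => Finset.sum_nonneg fun i _ => mul_self_nonneg _
  constructor
  · have h3 := (mul_nonneg hlo.le (hnn (u - hi⁻¹ • z))).trans (h1 (u - hi⁻¹ • z))
    have h4 := h2 (hi⁻¹ • z)
    rw [mulVec_sub, sub_dotProduct, dotProduct_sub, dotProduct_sub, hzu,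
      dotProduct_mulVec_comm hA u, hAu, smul_dotProduct] at h3
    rw [smul_dotProduct, smul_eq_mul, dotProduct_smul] at h4
    simp only [smul_dotProduct, smul_eq_mul] at h3 h4
    have h5 : hi * (hi⁻¹ * (hi⁻¹ * (z ⬝ᵥ z))) = (z ⬝ᵥ z) / hi := by field_simp
    have h6 : hi⁻¹ * (z ⬝ᵥ z) = (z ⬝ᵥ z) / hi := by field_simp
    rw [h5] at h4
    rw [h6] at h3
    linarith
  · have h3 := h1 u
    rw [hzu] at h3
    have h4 : 0 ≤ (z - lo • u) ⬝ᵥ (z - lo • u) := hnn _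
    rw [sub_dotProduct, dotProduct_sub, dotProduct_sub, dotProduct_smul, smul_dotProduct,
      smul_dotProduct, dotProduct_smul, dotProduct_comm u z] at h4
    simp only [smul_eq_mul] at h4
    rw [le_div_iff₀ hlo]
    nlinarith

/-! ### Gaussian integrals -/

lemma integral_exp_linear_sub_sq (v : ℝ) :
    ∫ x : ℝ, Real.exp (v * x - (1 / 2) * x ^ 2) = √(2 * Real.pi) * Real.exp (v ^ 2 / 2) := by
  have h : ∀ x : ℝ, Real.exp (v * x - (1 / 2) * x ^ 2) =
      Real.exp (-(1 / 2) * (x - v) ^ 2) * Real.exp (v ^ 2 / 2) := fun x => by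
    rw [← Real.exp_add]
    ring_nf
  simp_rw [h]
  rw [integral_mul_const, integral_sub_right_eq_self (fun x => Real.exp (-(1 / 2) * x ^ 2)),
    integral_gaussian]
  congr 2
  field_simp

open scoped MatrixOrder Matrix.Norms.L2Operator in
lemma exists_transpose_mul_self (hA : A.PosDef) : ∃ B : Matrix ι ι ℝ, A = Bᵀ * B := by
  obtain ⟨B, hB⟩ := CStarAlgebra.nonneg_iff_eq_star_mul_self.mp hA.posSemidef.nonneg
  exact ⟨B, hB⟩

/-- The Gaussian integral with precision matrix `A` and linear term `z`, by the linear change of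
variables that turns `A = Bᵀ B` into the identity. -/
lemma integral_exp_quadratic (hA : A.PosDef) (z : ι → ℝ) :
    ∫ t : ι → ℝ, Real.exp (z ⬝ᵥ t - (1 / 2) * (t ⬝ᵥ A *ᵥ t)) =
      √(2 * Real.pi) ^ Fintype.card ι * ((√A.det)⁻¹ * Real.exp ((z ⬝ᵥ A⁻¹ *ᵥ z) / 2)) := by
  obtain ⟨B, hB⟩ := exists_transpose_mul_self hA
  have hdet : A.det = B.det ^ 2 := by rw [hB, det_mul, det_transpose, pow_two]
  have hBdet : B.det ≠ 0 := fun h => by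
    have := hA.det_pos
    rw [hdet, h] at this
    simp at this
  set v := B *ᵥ (A⁻¹ *ᵥ z) with hv
  have hform : ∀ s t : ι → ℝ, s ⬝ᵥ A *ᵥ t = (B *ᵥ s) ⬝ᵥ (B *ᵥ t) := fun s t => by
    rw [hB, ← mulVec_mulVec, dotProduct_mulVec, vecMul_transpose]
  have hzt : ∀ t : ι → ℝ, z ⬝ᵥ t = v ⬝ᵥ (B *ᵥ t) := fun t => by
    rw [hv, ← hform, dotProduct_mulVec_comm hA.isHermitian, mulVec_inv_mulVec hA, dotProduct_comm]
  have hvv : v ⬝ᵥ v = z ⬝ᵥ A⁻¹ *ᵥ z := by rw [hzt]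
  let F : (ι → ℝ) → ℝ := fun s => Real.exp (v ⬝ᵥ s - (1 / 2) * (s ⬝ᵥ s))
  have hF : Continuous F := by
    simp only [F, dotProduct]
    fun_prop
  have hlin : Continuous (toLin' B) := LinearMap.continuous_of_finiteDimensional _
  have h1 : ∫ t : ι → ℝ, Real.exp (z ⬝ᵥ t - (1 / 2) * (t ⬝ᵥ A *ᵥ t)) =
      ∫ s, F s ∂(Measure.map (toLin' B) volume) := by
    rw [integral_map hlin.measurable.aemeasurable hF.aestronglyMeasurable]
    congr 1
    funext t
    rw [hzt, hform]
    rfl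
  have h2 : ∀ s : ι → ℝ, F s = ∏ i, Real.exp (v i * s i - (1 / 2) * s i ^ 2) := fun s => by
    rw [← Real.exp_sum]
    simp only [F, dotProduct, Finset.sum_sub_distrib, Finset.mul_sum, pow_two]
  have h3 : ∫ s, F s = √(2 * Real.pi) ^ Fintype.card ι * Real.exp ((v ⬝ᵥ v) / 2) := by
    simp_rw [h2]
    rw [integral_fintype_prod_volume_eq_prod
      (f := fun i (x : ℝ) => Real.exp (v i * x - (1 / 2) * x ^ 2))]
    simp_rw [integral_exp_linear_sub_sq]
    rw [Finset.prod_mul_distrib, Finset.prod_const, Finset.card_univ, ← Real.exp_sum]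
    simp only [dotProduct, Finset.sum_div, pow_two]
  rw [h1, Real.map_matrix_volume_pi_eq_smul_volume_pi hBdet, integral_smul_measure, h3, hvv,
    hdet, Real.sqrt_sq_eq_abs, abs_inv, ENNReal.toReal_ofReal (by positivity), smul_eq_mul]
  ring

end

/-! ### The posterior weights in closed form -/

section

variable {n d : ℕ}

/-- The quadratic form of `precMat` on the support `S`. -/
lemma dotProduct_precMat (X : Matrix (Fin n) (Fin d) ℝ) (σ : ℝ) (S : Finset (Fin d))
    (t : S → ℝ) :
    t ⬝ᵥ precMat X σ (fun i : S => (i : Fin d)) *ᵥ t =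
      (∑ r, X.mulVec (pad S t) r ^ 2) / σ ^ 2 + t ⬝ᵥ t := by
  have h1 : ∀ r, X.mulVec (pad S t) r ^ 2 =
      ∑ i : S, ∑ j : S, t i * (X r i * X r j) * t j := fun r => by
    rw [mulVec_pad, pow_two, Finset.sum_mul_sum]
    exact Finset.sum_congr rfl fun i _ => Finset.sum_congr rfl fun j _ => by ring
  have h2 : t ⬝ᵥ precMat X σ (fun i : S => (i : Fin d)) *ᵥ t = ∑ i : S, ∑ j : S,
      ((∑ r, t i * (X r i * X r j) * t j) / σ ^ 2 + if i = j then t i * t j else 0) := by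
    simp only [dotProduct, mulVec, precMat, of_apply, Finset.mul_sum]
    refine Finset.sum_congr rfl fun i _ => Finset.sum_congr rfl fun j _ => ?_
    rw [← Finset.sum_mul, ← Finset.mul_sum]
    split_ifs <;> ring
  rw [h2]
  simp_rw [Finset.sum_add_distrib]
  congr 1
  · simp_rw [h1, ← Finset.sum_div]
    congr 1
    rw [Finset.sum_comm]
    conv_rhs => rw [Finset.sum_comm]; enter [2, i]; rw [Finset.sum_comm]
    rw [Finset.sum_comm]
  · simp [dotProduct]

lemma isHermitian_precMat {ι : Type*} [DecidableEq ι] (X : Matrix (Fin n) (Fin d) ℝ) (σ : ℝ)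
    (e : ι → Fin d) : (precMat X σ e).IsHermitian := by
  ext i j
  simp only [precMat, conjTranspose_apply, of_apply, star_trivial, eq_comm, mul_comm]

lemma posDef_precMat (X : Matrix (Fin n) (Fin d) ℝ) (σ : ℝ) (S : Finset (Fin d)) :
    (precMat X σ (fun i : S => (i : Fin d))).PosDef := by
  refine posDef_of_le_form (isHermitian_precMat X σ _) one_pos fun u => ?_
  rw [dotProduct_precMat, one_mul]
  have : 0 ≤ (∑ r, X.mulVec (pad S u) r ^ 2) / σ ^ 2 := by positivity
  linarith

/-- Recentering at `θhat`: on supports containing that of `θhat`, the posterior weight is a factor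
independent of the support times a Gaussian integral with linear term `linStat`. -/
lemma suppWeight_eq (X : Matrix (Fin n) (Fin d) ℝ) {σ : ℝ} (hσ : 0 < σ) (q : Fin d → ℝ)
    (y : Fin n → ℝ) (θhat : Fin d → ℝ) {S : Finset (Fin d)} (hS : suppSet θhat ⊆ S) :
    suppWeight X σ q y S =
      Real.exp (-(1 / (2 * σ ^ 2)) * ∑ i, (y i - X.mulVec θhat i) ^ 2
        - (1 / 2) * ∑ j, θhat j ^ 2) * ((∏ i ∈ S, q i) * (∏ i ∈ Sᶜ, (1 - q i)) *
      ((√(precMat X σ (fun i : S => (i : Fin d))).det)⁻¹ * Real.exp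
        (((fun i : S => linStat X y θhat σ i) ⬝ᵥ (precMat X σ (fun i : S => (i : Fin d)))⁻¹ *ᵥ
          (fun i : S => linStat X y θhat σ i)) / 2))) := by
  set A := precMat X σ (fun i : S => (i : Fin d)) with hA
  set z : S → ℝ := fun i => linStat X y θhat σ i with hz
  set t₀ : S → ℝ := fun i => θhat i with ht₀
  have hpad : pad S t₀ = θhat := by
    funext i
    by_cases hi : i ∈ S
    · simp [pad, hi, ht₀]
    · have : θhat i = 0 := by
        by_contra h
        exact hi (hS (mem_suppSet.2 h))
      simp [pad, hi, this]
  have hadd : ∀ t : S → ℝ, pad S (t + t₀) = pad S t + θhat := fun t => by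
    rw [← hpad]
    funext i
    by_cases hi : i ∈ S <;> simp [pad, hi]
  have hexp : ∀ t : S → ℝ, -(1 / (2 * σ ^ 2)) * ∑ i, (y i - (X.mulVec (pad S (t + t₀))) i) ^ 2
      - (1 / 2) * ∑ j, (t + t₀) j ^ 2 = (-(1 / (2 * σ ^ 2)) * ∑ i, (y i - X.mulVec θhat i) ^ 2
        - (1 / 2) * ∑ j, θhat j ^ 2) + (z ⬝ᵥ t - (1 / 2) * (t ⬝ᵥ A *ᵥ t)) := fun t => by
    have e1 : ∑ i, (y i - (X.mulVec (pad S (t + t₀))) i) ^ 2 =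
        ∑ i, (y i - X.mulVec θhat i) ^ 2 - 2 * (∑ i, (y i - X.mulVec θhat i) *
          X.mulVec (pad S t) i) + ∑ i, X.mulVec (pad S t) i ^ 2 := by
      rw [hadd, mulVec_add, Finset.mul_sum, ← Finset.sum_sub_distrib, ← Finset.sum_add_distrib]
      exact Finset.sum_congr rfl fun i _ => by rw [Pi.add_apply]; ring
    have e2 : ∑ i, (y i - X.mulVec θhat i) * X.mulVec (pad S t) i =
        ∑ j : S, (∑ i, X i j * (y i - X.mulVec θhat i)) * t j := by
      simp_rw [mulVec_pad, Finset.mul_sum, Finset.sum_mul]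
      rw [Finset.sum_comm]
      exact Finset.sum_congr rfl fun j _ => Finset.sum_congr rfl fun i _ => by ring
    have e3 : ∑ j, (t + t₀) j ^ 2 = ∑ j, t j ^ 2 + 2 * ∑ j, t₀ j * t j + ∑ j, θhat j ^ 2 := by
      rw [← hpad, sum_pad_sq, Finset.mul_sum, ← Finset.sum_add_distrib, ← Finset.sum_add_distrib]
      exact Finset.sum_congr rfl fun i _ => by rw [Pi.add_apply]; ring
    have e4 : z ⬝ᵥ t = (∑ j : S, (∑ i, X i j * (y i - X.mulVec θhat i)) * t j) / σ ^ 2 -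
        ∑ j, t₀ j * t j := by
      rw [Finset.sum_div, ← Finset.sum_sub_distrib]
      exact Finset.sum_congr rfl fun i _ => by simp only [hz, linStat, ht₀]; ring
    have e5 : t ⬝ᵥ t = ∑ j, t j ^ 2 := Finset.sum_congr rfl fun i _ => by ring
    rw [e1, e2, e3, e4, hA, dotProduct_precMat, e5]
    field_simp
    ring
  rw [suppWeight, ← integral_add_right_eq_self _ t₀]
  simp_rw [hexp, Real.exp_add (_ - _) (_ - _)]
  rw [integral_const_mul, integral_exp_quadratic (posDef_precMat X σ S), Fintype.card_coe]
  have hpi : (2 * Real.pi) ^ ((S.card : ℝ) / 2) = √(2 * Real.pi) ^ S.card := by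
    rw [Real.sqrt_eq_rpow, ← Real.rpow_natCast, ← Real.rpow_mul (by positivity)]
    ring_nf
  rw [hpi, ← hA]
  have : √(2 * Real.pi) ^ S.card ≠ 0 := by positivity
  field_simp

/-- On the candidate supports, the posterior weight is a constant times the weight of the proposal
times the likelihood ratio. -/
lemma suppWeight_eq_mul_ratioVal (X : Matrix (Fin n) (Fin d) ℝ) {σ : ℝ} (hσ : 0 < σ)
    {q : Fin d → ℝ} (hq : ∀ i, 0 ≤ q i ∧ q i ≤ 1) (y : Fin n → ℝ) (θhat : Fin d → ℝ) :
    ∃ D : ℝ, ∀ S, suppSet θhat ⊆ S → suppWeight X σ q y S =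
      D * (coinWeight (inclProb σ q (linStat X y θhat σ)) (suppSet θhat)ᶜ (S \ suppSet θhat) *
        ratioVal X σ (linStat X y θhat σ) (fun i : S => (i : Fin d))) := by
  set z := linStat X y θhat σ with hz
  set T := suppSet θhat with hT
  set r := inclWeight σ q z with hr
  set E := Real.exp (-(1 / (2 * σ ^ 2)) * ∑ i, (y i - X.mulVec θhat i) ^ 2
        - (1 / 2) * ∑ j, θhat j ^ 2) with hE
  refine ⟨E * ((∏ i ∈ T, r i) * ∏ i ∈ Tᶜ, (1 - q i + r i)), fun S hS => ?_⟩
  rw [suppWeight_eq X hσ q y θhat hS]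
  have hpos : ∀ i, 0 < 1 - q i + r i := inclWeight_add_pos hσ hq
  have hcompl : Tᶜ \ (S \ T) = Sᶜ := by
    ext i
    have := @hS i
    simp only [Finset.mem_sdiff, Finset.mem_compl]
    tauto
  have hcw : (∏ i ∈ Tᶜ, (1 - q i + r i)) * coinWeight (inclProb σ q z) Tᶜ (S \ T) =
      (∏ i ∈ S \ T, r i) * ∏ i ∈ Sᶜ, (1 - q i) := by
    have hsub : S \ T ⊆ Tᶜ := fun i hi => by simpa using (Finset.mem_sdiff.1 hi).2
    have h1 : ∀ i, (1 - q i + r i) * inclProb σ q z i = r i := fun i =>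
      mul_div_cancel₀ _ (hpos i).ne'
    have h2 : ∀ i, (1 - q i + r i) * (1 - inclProb σ q z i) = 1 - q i := fun i => by
      rw [mul_sub, h1]
      ring
    rw [coinWeight, hcompl, ← Finset.prod_sdiff hsub, hcompl, mul_comm (∏ i ∈ Sᶜ, _),
      mul_mul_mul_comm, ← Finset.prod_mul_distrib, ← Finset.prod_mul_distrib]
    simp_rw [h1, h2]
  have hrprod : ∏ i ∈ S, r i = (∏ i ∈ S, q i) * (√(σ ^ 2 / (1 + σ ^ 2)) ^ S.card *
      Real.exp (σ ^ 2 / (1 + σ ^ 2) / 2 * ∑ i : S, z i * z i)) := by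
    simp only [hr, inclWeight]
    rw [Finset.prod_mul_distrib, Finset.prod_mul_distrib, Finset.prod_const, ← Real.exp_sum,
      mul_assoc, ← Finset.mul_sum, ← Finset.sum_coe_sort]
    simp only [pow_two]
  have hsplit : (∏ i ∈ T, r i) * ∏ i ∈ S \ T, r i = ∏ i ∈ S, r i := by
    rw [mul_comm, Finset.prod_sdiff hS]
  have hmain : (∏ i ∈ S, q i) * ((√(precMat X σ (fun i : S => (i : Fin d))).det)⁻¹ * Real.exp
        (((fun i : S => z i) ⬝ᵥ (precMat X σ (fun i : S => (i : Fin d)))⁻¹ *ᵥ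
          (fun i : S => z i)) / 2)) =
      (∏ i ∈ S, r i) * ratioVal X σ z (fun i : S => (i : Fin d)) := by
    rw [hrprod, ratioVal, Fintype.card_coe]
    set A := precMat X σ (fun i : S => (i : Fin d))
    have hs : √(((1 + σ ^ 2) / σ ^ 2) ^ S.card / A.det) =
        (√(σ ^ 2 / (1 + σ ^ 2)) ^ S.card)⁻¹ * (√A.det)⁻¹ := by
      have h1 : √(((1 + σ ^ 2) / σ ^ 2) ^ S.card) = √((1 + σ ^ 2) / σ ^ 2) ^ S.card := by
        rw [← Real.sqrt_sq (by positivity : 0 ≤ √((1 + σ ^ 2) / σ ^ 2) ^ S.card), ← pow_mul,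
          mul_comm S.card, pow_mul, Real.sq_sqrt (by positivity)]
      rw [Real.sqrt_div (by positivity), div_eq_mul_inv, h1, ← inv_div (σ ^ 2), Real.sqrt_inv,
        inv_pow]
    have he : Real.exp (((fun i : S => z i) ⬝ᵥ A⁻¹ *ᵥ (fun i : S => z i)) / 2) =
        Real.exp (σ ^ 2 / (1 + σ ^ 2) / 2 * ∑ i : S, z i * z i) *
        Real.exp ((∑ i : S, z i * ∑ j : S, A⁻¹ i j * z j
          - σ ^ 2 / (1 + σ ^ 2) * ∑ i : S, z i * z i) / 2) := by
      rw [← Real.exp_add]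
      congr 1
      simp only [dotProduct, mulVec]
      ring
    have hne : √(σ ^ 2 / (1 + σ ^ 2)) ^ S.card ≠ 0 := by positivity
    rw [hs, he]
    field_simp
  calc _ = E * (∏ i ∈ Sᶜ, (1 - q i)) * ((∏ i ∈ S, q i) *
        ((√(precMat X σ (fun i : S => (i : Fin d))).det)⁻¹ * Real.exp
        (((fun i : S => z i) ⬝ᵥ (precMat X σ (fun i : S => (i : Fin d)))⁻¹ *ᵥ
          (fun i : S => z i)) / 2))) := by ring
    _ = E * ((∏ i ∈ T, r i) * ((∏ i ∈ S \ T, r i) * ∏ i ∈ Sᶜ, (1 - q i))) *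
        ratioVal X σ z (fun i : S => (i : Fin d)) := by rw [hmain, ← hsplit]; ring
    _ = _ := by rw [← hcw]; ring

end

/-! ### The likelihood ratio of a well recentered proposal -/

section

variable {n d : ℕ}

lemma precMat_form_bounds {X : Matrix (Fin n) (Fin d) ℝ} {ε s σ : ℝ} (hX : IsRIP X ε s)
    {S : Finset (Fin d)} (hS : (S.card : ℝ) ≤ s) (u : S → ℝ) :
    (1 + (1 - ε) / σ ^ 2) * (u ⬝ᵥ u) ≤ u ⬝ᵥ precMat X σ (fun i : S => (i : Fin d)) *ᵥ u ∧
      u ⬝ᵥ precMat X σ (fun i : S => (i : Fin d)) *ᵥ u ≤ (1 + (1 + ε) / σ ^ 2) * (u ⬝ᵥ u) := by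
  have h := hX (pad S u) ((Nat.cast_le.2 (nnz_pad_le S u)).trans hS)
  have e : u ⬝ᵥ u = ∑ j, u j ^ 2 := Finset.sum_congr rfl fun i _ => (pow_two _).symm
  rw [sum_pad_sq, ← e] at h
  rw [dotProduct_precMat]
  constructor
  · have := div_le_div_of_nonneg_right h.1 (sq_nonneg σ)
    calc _ = (1 - ε) * (u ⬝ᵥ u) / σ ^ 2 + u ⬝ᵥ u := by ring
      _ ≤ _ := by linarith
  · have := div_le_div_of_nonneg_right h.2 (sq_nonneg σ)
    calc _ ≤ (1 + ε) * (u ⬝ᵥ u) / σ ^ 2 + u ⬝ᵥ u := by linarith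
      _ = _ := by ring

/-- If `X` is nearly isometric on the columns in `S` and `z` is not too long there, then both factors of
the likelihood ratio are close to `1`. -/
lemma ratioVal_mem_Icc {X : Matrix (Fin n) (Fin d) ℝ} {ε s σ : ℝ} (hX : IsRIP X ε s)
    (hσ : 0 < σ) (hε0 : 0 ≤ ε) (hε : ε ≤ 1 / 100) {S : Finset (Fin d)} (hS : (S.card : ℝ) ≤ s)
    (hεS : ε * S.card ≤ 1 / 50) (z : Fin d → ℝ)
    (hz : ε * (σ ^ 2 / (1 + σ ^ 2) ^ 2 * ∑ i : S, z i ^ 2) ≤ 3 / 2) :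
    1 / 3 ≤ ratioVal X σ z (fun i : S => (i : Fin d)) ∧
      ratioVal X σ z (fun i : S => (i : Fin d)) ≤ 3 := by
  set A := precMat X σ (fun i : S => (i : Fin d)) with hA
  set a := (1 + σ ^ 2) / σ ^ 2 with ha
  set lo := 1 + (1 - ε) / σ ^ 2 with hlo
  set hi := 1 + (1 + ε) / σ ^ 2 with hhi
  have hσ2 : 0 < σ ^ 2 := by positivity
  have hapos : 0 < a := by positivity
  have hae : a = 1 + 1 / σ ^ 2 := by rw [ha]; field_simp; ring
  have hlopos : 0 < lo := by
    have : 0 ≤ (1 - ε) / σ ^ 2 := div_nonneg (by linarith) hσ2.le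
    linarith
  have hhipos : 0 < hi := by positivity
  have hloa : (1 - ε) * a ≤ lo := by
    rw [hae, hlo]
    have : (1 - ε) * (1 + 1 / σ ^ 2) = (1 - ε) + (1 - ε) / σ ^ 2 := by ring
    linarith
  have hhia : hi ≤ (1 + ε) * a := by
    rw [hae, hhi]
    have : (1 + ε) * (1 + 1 / σ ^ 2) = (1 + ε) + (1 + ε) / σ ^ 2 := by ring
    linarith
  have hAH := isHermitian_precMat X σ (fun i : S => (i : Fin d))
  have h1 := fun u => (precMat_form_bounds (σ := σ) hX hS u).1
  have h2 := fun u => (precMat_form_bounds (σ := σ) hX hS u).2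
  have hdet := pow_le_det_of_form hAH hlopos h1 h2
  have hquad := inv_form_bounds hAH hlopos hhipos h1 h2 (fun i : S => z i)
  rw [Fintype.card_coe] at hdet
  set Z := (fun i : S => z i) ⬝ᵥ (fun i : S => z i) with hZ
  have hZe : Z = ∑ i : S, z i ^ 2 := Finset.sum_congr rfl fun i _ => (pow_two _).symm
  have hZ0 : 0 ≤ Z := by rw [hZe]; positivity
  have hdetpos : 0 < A.det := lt_of_lt_of_le (pow_pos hlopos _) hdet.1
  -- the determinant factor
  have hd1 : Real.exp (-(ε * S.card)) ≤ a ^ S.card / A.det := by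
    rw [le_div_iff₀ hdetpos]
    calc Real.exp (-(ε * S.card)) * A.det
        ≤ Real.exp (-(ε * S.card)) * ((1 + ε) * a) ^ S.card := by
          gcongr
          exact hdet.2.trans (pow_le_pow_left₀ hhipos.le hhia _)
      _ ≤ Real.exp (-(ε * S.card)) * (Real.exp ε * a) ^ S.card := by
          gcongr
          linarith [Real.add_one_le_exp ε]
      _ = a ^ S.card := by
          rw [mul_pow, ← Real.exp_nat_mul, ← mul_assoc, ← Real.exp_add]
          rw [show -(ε * S.card) + S.card * ε = 0 by ring, Real.exp_zero, one_mul]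
  have hd2 : a ^ S.card / A.det ≤ Real.exp (2 * (ε * S.card)) := by
    rw [div_le_iff₀ hdetpos]
    calc a ^ S.card = Real.exp (2 * (ε * S.card)) * (Real.exp (-(2 * ε)) * a) ^ S.card := by
          rw [mul_pow, ← Real.exp_nat_mul, ← mul_assoc, ← Real.exp_add]
          rw [show 2 * (ε * S.card) + S.card * -(2 * ε) = 0 by ring, Real.exp_zero, one_mul]
      _ ≤ Real.exp (2 * (ε * S.card)) * ((1 - ε) * a) ^ S.card := by
          gcongr
          rw [Real.exp_neg]
          refine inv_le_of_inv_le₀ (by linarith) ?_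
          refine le_trans ?_ (Real.add_one_le_exp (2 * ε))
          rw [inv_le_iff_one_le_mul₀ (by linarith)]
          nlinarith
      _ ≤ Real.exp (2 * (ε * S.card)) * A.det := by
          gcongr
          exact (pow_le_pow_left₀ (mul_nonneg (by linarith) hapos.le) hloa _).trans hdet.1
  -- the exponent
  set Qd := (fun i : S => z i) ⬝ᵥ A⁻¹ *ᵥ (fun i : S => z i) with hQd
  have hF : σ ^ 2 / (1 + σ ^ 2) ^ 2 = 1 / (σ ^ 2 * a ^ 2) := by
    rw [ha]; field_simp
  have hzZ : ε * (Z / (σ ^ 2 * a ^ 2)) ≤ 3 / 2 := by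
    rw [← hZe, hF] at hz
    calc _ = ε * (1 / (σ ^ 2 * a ^ 2) * Z) := by ring
      _ ≤ _ := hz
  have hup : Qd - Z / a ≤ 8 / 5 := by
    have h3 : Z / lo - Z / a ≤ (1 - ε)⁻¹ * (ε * (Z / (σ ^ 2 * a ^ 2))) := by
      have e1 : Z / lo - Z / a = ε * Z / (σ ^ 2 * a * lo) := by
        have : a - lo = ε / σ ^ 2 := by rw [hae, hlo]; ring
        field_simp
        field_simp at this
        linear_combination Z * this
      have e2 : (1 - ε)⁻¹ * (ε * (Z / (σ ^ 2 * a ^ 2))) =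
          ε * Z / (σ ^ 2 * a * ((1 - ε) * a)) := by
        field_simp
      rw [e1, e2]
      have : 0 < (1 - ε) * a := mul_pos (by linarith) hapos
      gcongr
    have h4 : (1 - ε)⁻¹ ≤ 100 / 99 := by
      rw [inv_le_comm₀ (by linarith) (by norm_num)]
      linarith
    have h5 : 0 ≤ ε * (Z / (σ ^ 2 * a ^ 2)) := by positivity
    have h6 := mul_le_mul h4 hzZ h5 (by norm_num)
    linarith [hquad.2]
  have hdown : -(8 / 5) ≤ Qd - Z / a := by
    have h3 : Z / a - Z / hi ≤ ε * (Z / (σ ^ 2 * a ^ 2)) := by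
      have e1 : Z / a - Z / hi = ε * Z / (σ ^ 2 * a * hi) := by
        have : hi - a = ε / σ ^ 2 := by rw [hae, hhi]; ring
        field_simp
        field_simp at this
        linear_combination Z * this
      have e2 : ε * (Z / (σ ^ 2 * a ^ 2)) = ε * Z / (σ ^ 2 * a * a) := by
        field_simp
      have e3 : a ≤ hi := by
        rw [hae, hhi]
        gcongr
        linarith
      rw [e1, e2]
      gcongr
    linarith [hquad.1]
  have hval : ratioVal X σ z (fun i : S => (i : Fin d)) =
      √(a ^ S.card / A.det) * Real.exp ((Qd - Z / a) / 2) := by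
    have e1 : σ ^ 2 / (1 + σ ^ 2) * ∑ i : S, z i * z i = Z / a := by
      rw [ha, hZ, dotProduct]
      field_simp
    rw [ratioVal, Fintype.card_coe, e1]
    rfl
  have hsq1 : Real.exp (-(ε * S.card) / 2) ≤ √(a ^ S.card / A.det) := by
    apply Real.le_sqrt_of_sq_le
    rw [← Real.exp_nat_mul]
    refine le_trans (le_of_eq ?_) hd1
    congr 1
    push_cast
    ring
  have hsq2 : √(a ^ S.card / A.det) ≤ Real.exp (ε * S.card) := by
    rw [Real.sqrt_le_left (Real.exp_pos _).le, ← Real.exp_nat_mul]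
    exact_mod_cast hd2
  have he1 : Real.exp 1 ≤ 3 := by linarith [Real.exp_one_lt_d9]
  rw [hval]
  have hεS0 : 0 ≤ ε * S.card := by positivity
  constructor
  · calc (1 : ℝ) / 3 ≤ Real.exp (-1) := by
          rw [Real.exp_neg, one_div]
          exact inv_anti₀ (Real.exp_pos _) he1
      _ ≤ Real.exp (-(ε * S.card) / 2) * Real.exp ((Qd - Z / a) / 2) := by
          rw [← Real.exp_add]
          exact Real.exp_le_exp.2 (by linarith)
      _ ≤ _ := by gcongr
  · calc √(a ^ S.card / A.det) * Real.exp ((Qd - Z / a) / 2)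
        ≤ Real.exp (ε * S.card) * Real.exp ((Qd - Z / a) / 2) := by gcongr
      _ ≤ Real.exp 1 := by
          rw [← Real.exp_add]
          exact Real.exp_le_exp.2 (by linarith)
      _ ≤ 3 := he1

/-- By duality: the restriction `g` of `Xᵀ X Δ` to `S` satisfies `‖g‖² = ⟨X g, X Δ⟩`. -/
lemma sum_sq_transpose_mulVec_le {X : Matrix (Fin n) (Fin d) ℝ} {ε s : ℝ} (hX : IsRIP X ε s)
    (hε0 : 0 ≤ ε) {S : Finset (Fin d)} (hS : (S.card : ℝ) ≤ s) {Δ : Fin d → ℝ}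
    (hΔ : (nnz Δ : ℝ) ≤ s) :
    ∑ j : S, (∑ i, X i j * X.mulVec Δ i) ^ 2 ≤ (1 + ε) ^ 2 * ∑ j, Δ j ^ 2 := by
  set g : S → ℝ := fun j => ∑ i, X i j * X.mulVec Δ i with hg
  set G := ∑ j, g j ^ 2 with hG
  have h1 := (hX (pad S g) ((Nat.cast_le.2 (nnz_pad_le S g)).trans hS)).2
  rw [sum_pad_sq] at h1
  have h2 := (hX Δ hΔ).2
  have h3 : G = ∑ i, X.mulVec (pad S g) i * X.mulVec Δ i := by
    simp_rw [mulVec_pad, Finset.sum_mul]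
    rw [Finset.sum_comm]
    refine Finset.sum_congr rfl fun j _ => ?_
    rw [pow_two]
    nth_rw 2 [hg]
    rw [Finset.mul_sum]
    exact Finset.sum_congr rfl fun i _ => by ring
  have h4 := Finset.sum_mul_sq_le_sq_mul_sq Finset.univ (X.mulVec (pad S g)) (X.mulVec Δ)
  rw [← h3] at h4
  have hG0 : 0 ≤ G := Finset.sum_nonneg fun j _ => sq_nonneg _
  have hD0 : 0 ≤ ∑ j, Δ j ^ 2 := Finset.sum_nonneg fun j _ => sq_nonneg _
  rcases hG0.eq_or_lt with h0 | h0
  · rw [← h0]; positivity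
  · have h5 : G ^ 2 ≤ (1 + ε) * G * ((1 + ε) * ∑ j, Δ j ^ 2) :=
      h4.trans (mul_le_mul h1 h2 (Finset.sum_nonneg fun j _ => sq_nonneg _) (by positivity))
    have h6 : G * G ≤ G * ((1 + ε) ^ 2 * ∑ j, Δ j ^ 2) := by nlinarith
    exact le_of_mul_le_mul_left h6 h0

/-- The length of `z` on `S`, when `θhat` recovers the support and, up to `4 σ R`, the entries of
the signal: with `Δ = θ - θhat`, `z = σ⁻² Xᵀ X Δ + σ⁻² Xᵀ ξ + Δ - θ`. -/
lemma linStat_sq_le {X : Matrix (Fin n) (Fin d) ℝ} {ε σ R τ : ℝ} {k : ℕ} (hX : IsRIP X ε k)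
    (hσ : 0 < σ) (hε0 : 0 ≤ ε) (hε : ε ≤ 1 / 100) {θ θhat : Fin d → ℝ} {ξ : Fin n → ℝ}
    (hnnz : (nnz θ : ℝ) ≤ k / 4) (hsupp : suppSet θhat ⊆ suppSet θ)
    (herr : ∀ j, |θ j - θhat j| ≤ 4 * σ * R) (hnorm : ∑ j, θ j ^ 2 ≤ k / 2)
    (hτ : 0 ≤ τ) (hξ : ∀ j, (∑ i, X i j * ξ i) ^ 2 ≤ σ ^ 2 * τ) {S : Finset (Fin d)}
    (hS : (S.card : ℝ) ≤ 3 / 4 * k) :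
    σ ^ 2 / (1 + σ ^ 2) ^ 2 * ∑ j : S, linStat X (X.mulVec θ + ξ) θhat σ j ^ 2 ≤
      k * (17 * R ^ 2 + 3 * τ + 1 / 2) := by
  set Δ : Fin d → ℝ := θ - θhat with hΔ
  have hk0 : (0 : ℝ) ≤ k := Nat.cast_nonneg k
  have hΔ0 : ∀ j ∉ suppSet θ, Δ j = 0 := fun j hj => by
    have h1 : θ j = 0 := by_contra fun h => hj (mem_suppSet.2 h)
    have h2 : θhat j = 0 := by_contra fun h => hj (hsupp (mem_suppSet.2 h))
    rw [hΔ, Pi.sub_apply, h1, h2, sub_zero]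
  have hΔnnz : (nnz Δ : ℝ) ≤ k := by
    have h1 : nnz Δ ≤ nnz θ := nnz_le_card hΔ0
    have h2 : (nnz Δ : ℝ) ≤ nnz θ := by exact_mod_cast h1
    linarith
  have hΔsq : ∑ j, Δ j ^ 2 ≤ 4 * k * σ ^ 2 * R ^ 2 := by
    rw [← Finset.sum_subset (Finset.subset_univ (suppSet θ)) fun j _ hj => by
      rw [hΔ0 j hj]; ring]
    calc ∑ j ∈ suppSet θ, Δ j ^ 2 ≤ ∑ j ∈ suppSet θ, (4 * σ * R) ^ 2 :=
          Finset.sum_le_sum fun j _ => sq_le_sq' (abs_le.1 (herr j)).1 (abs_le.1 (herr j)).2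
      _ = nnz θ * (4 * σ * R) ^ 2 := by rw [Finset.sum_const, nsmul_eq_mul]; rfl
      _ ≤ k / 4 * (4 * σ * R) ^ 2 := by gcongr
      _ = _ := by ring
  have hdec : ∀ j, linStat X (X.mulVec θ + ξ) θhat σ j =
      (∑ i, X i j * X.mulVec Δ i) / σ ^ 2 + (∑ i, X i j * ξ i) / σ ^ 2 + Δ j - θ j := fun j => by
    rw [linStat, ← add_div, ← Finset.sum_add_distrib, hΔ, mulVec_sub]
    simp only [Pi.add_apply, Pi.sub_apply]
    have : ∀ i, X i j * (X.mulVec θ i + ξ i - X.mulVec θhat i) =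
      X i j * (X.mulVec θ i - X.mulVec θhat i) + X i j * ξ i := fun i => by ring
    simp_rw [this]
    ring
  have h1 := sum_sq_transpose_mulVec_le hX hε0 (S := S) (by linarith) hΔnnz
  have h2 : ∑ j : S, (∑ i, X i j * ξ i) ^ 2 ≤ 3 / 4 * k * (σ ^ 2 * τ) := by
    calc ∑ j : S, (∑ i, X i j * ξ i) ^ 2 ≤ ∑ _j : S, σ ^ 2 * τ :=
          Finset.sum_le_sum fun j _ => hξ j
      _ = S.card * (σ ^ 2 * τ) := by simp
      _ ≤ _ := by gcongr
  have hsub : ∀ f : Fin d → ℝ, ∑ j : S, f j ^ 2 ≤ ∑ j, f j ^ 2 := fun f => by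
    rw [Finset.sum_coe_sort S fun j => f j ^ 2]
    exact Finset.sum_le_sum_of_subset_of_nonneg (Finset.subset_univ S) fun j _ _ => sq_nonneg _
  have h3 := hsub Δ
  have h4 := hsub θ
  have hsum : ∑ j : S, linStat X (X.mulVec θ + ξ) θhat σ j ^ 2 ≤
      4 * ((∑ j : S, (∑ i, X i j * X.mulVec Δ i) ^ 2) / σ ^ 4 +
        (∑ j : S, (∑ i, X i j * ξ i) ^ 2) / σ ^ 4 + ∑ j : S, Δ j ^ 2 + ∑ j : S, θ j ^ 2) := by
    rw [Finset.sum_div, Finset.sum_div, ← Finset.sum_add_distrib, ← Finset.sum_add_distrib,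
      ← Finset.sum_add_distrib, Finset.mul_sum]
    refine Finset.sum_le_sum fun j _ => ?_
    rw [hdec]
    set a := ∑ i, X i j * X.mulVec Δ i
    set b := ∑ i, X i j * ξ i
    have e1 : a ^ 2 / σ ^ 4 = (a / σ ^ 2) ^ 2 := by field_simp
    have e2 : b ^ 2 / σ ^ 4 = (b / σ ^ 2) ^ 2 := by field_simp
    rw [e1, e2]
    linarith [sq_nonneg (a / σ ^ 2 - b / σ ^ 2), sq_nonneg (a / σ ^ 2 - Δ j),
      sq_nonneg (a / σ ^ 2 + θ j), sq_nonneg (b / σ ^ 2 - Δ j), sq_nonneg (b / σ ^ 2 + θ j),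
      sq_nonneg (Δ j + θ j)]
  have hle : ∑ j : S, linStat X (X.mulVec θ + ξ) θhat σ j ^ 2 ≤
      4 * ((1 + ε) ^ 2 * (4 * k * σ ^ 2 * R ^ 2) / σ ^ 4 +
        3 / 4 * k * (σ ^ 2 * τ) / σ ^ 4 + 4 * k * σ ^ 2 * R ^ 2 + k / 2) := by
    refine hsum.trans ?_
    gcongr
    · exact h1.trans (by gcongr)
    · exact h3.trans hΔsq
    · exact h4.trans hnorm
  refine (mul_le_mul_of_nonneg_left hle (by positivity)).trans ?_
  have e : σ ^ 2 / (1 + σ ^ 2) ^ 2 * (4 * ((1 + ε) ^ 2 * (4 * k * σ ^ 2 * R ^ 2) / σ ^ 4 +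
        3 / 4 * k * (σ ^ 2 * τ) / σ ^ 4 + 4 * k * σ ^ 2 * R ^ 2 + k / 2)) =
      k * (16 * R ^ 2 * ((1 + ε) ^ 2 + (σ ^ 2) ^ 2) + 3 * τ + 2 * σ ^ 2) / (1 + σ ^ 2) ^ 2 := by
    field_simp
    ring
  rw [e, div_le_iff₀ (by positivity), mul_assoc (k : ℝ)]
  refine mul_le_mul_of_nonneg_left ?_ hk0
  set x := σ ^ 2
  have hx : 0 ≤ x := by positivity
  have a1 : 16 * R ^ 2 * ((1 + ε) ^ 2 + x ^ 2) ≤ 17 * R ^ 2 * (1 + x) ^ 2 := by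
    have : 16 * ((1 + ε) ^ 2 + x ^ 2) ≤ 17 * (1 + x) ^ 2 := by nlinarith
    nlinarith [sq_nonneg R]
  have a2 : 3 * τ ≤ 3 * τ * (1 + x) ^ 2 := le_mul_of_one_le_right (by linarith) (by nlinarith)
  have a3 : 2 * x ≤ 1 / 2 * (1 + x) ^ 2 := by nlinarith [sq_nonneg (1 - x)]
  linarith

end

end SpikeSlab

namespace SpikeSlab

/-! ### Product measures and Gaussian noise -/

section

variable {ι : Type*} [Fintype ι]

lemma lintegral_fin_prod {n : ℕ} (μ : Fin n → Measure ℝ) [∀ i, SigmaFinite (μ i)]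
    {f : Fin n → ℝ → ℝ≥0∞} (hf : ∀ i, Measurable (f i)) :
    ∫⁻ x : Fin n → ℝ, ∏ i, f i (x i) ∂(Measure.pi μ) = ∏ i, ∫⁻ x, f i x ∂(μ i) := by
  induction n with
  | zero => simp
  | succ n ih =>
    rw [← ((measurePreserving_piFinSuccAbove μ 0).symm).lintegral_comp_emb
      (MeasurableEquiv.measurableEmbedding _)]
    simp_rw [MeasurableEquiv.piFinSuccAbove_symm_apply, Fin.insertNthEquiv,
      Fin.prod_univ_succ, Fin.insertNth_zero, Equiv.coe_fn_mk, Fin.cons_succ,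
      Fin.zero_succAbove, Fin.cons_zero]
    rw [← ih (fun i : Fin n => μ i.succ) (f := fun i : Fin n => f i.succ) fun i : Fin n => hf i.succ]
    exact lintegral_prod_mul (hf 0).aemeasurable
      (Finset.measurable_prod _ fun (i : Fin n) _ => (hf i.succ).comp (measurable_pi_apply i)).aemeasurable

lemma lintegral_pi_prod (μ : ι → Measure ℝ) [∀ i, SigmaFinite (μ i)]
    {f : ι → ℝ → ℝ≥0∞} (hf : ∀ i, Measurable (f i)) :
    ∫⁻ x : ι → ℝ, ∏ i, f i (x i) ∂(Measure.pi μ) = ∏ i, ∫⁻ x, f i x ∂(μ i) := by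
  let e := (Fintype.equivFin ι).symm
  rw [← (measurePreserving_piCongrLeft _ e).lintegral_comp_emb
    (MeasurableEquiv.measurableEmbedding _)]
  simp_rw [← e.prod_comp, MeasurableEquiv.coe_piCongrLeft, Equiv.piCongrLeft_apply_apply]
  exact lintegral_fin_prod (fun i => μ (e i)) fun i => hf (e i)

lemma pi_eq_withDensity {μ ν : ι → Measure ℝ} [∀ i, SigmaFinite (μ i)] [∀ i, SigmaFinite (ν i)]
    {f : ι → ℝ → ℝ≥0∞} (hf : ∀ i, Measurable (f i)) (h : ∀ i, ν i = (μ i).withDensity (f i)) :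
    Measure.pi ν = (Measure.pi μ).withDensity (fun x => ∏ i, f i (x i)) := by
  refine Measure.pi_eq fun s hs => ?_
  rw [withDensity_apply _ (MeasurableSet.univ_pi hs), ← lintegral_indicator (MeasurableSet.univ_pi hs)]
  have : ∀ x : ι → ℝ, (Set.univ.pi s).indicator (fun x => ∏ i, f i (x i)) x =
      ∏ i, (s i).indicator (f i) (x i) := fun x => by
    by_cases hx : x ∈ Set.univ.pi s
    · rw [Set.indicator_of_mem hx]
      exact Finset.prod_congr rfl fun i _ => (Set.indicator_of_mem (hx i trivial) _).symm
    · rw [Set.indicator_of_notMem hx]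
      simp only [Set.mem_pi, Set.mem_univ, true_implies, not_forall] at hx
      obtain ⟨i, hi⟩ := hx
      exact (Finset.prod_eq_zero (Finset.mem_univ i) (Set.indicator_of_notMem hi _)).symm
  simp_rw [this]
  rw [lintegral_pi_prod μ fun i => (hf i).indicator (hs i)]
  refine Finset.prod_congr rfl fun i _ => ?_
  rw [lintegral_indicator (hs i), h, withDensity_apply _ (hs i)]

lemma pi_gaussianReal_eq_withDensity {v : ℝ≥0} (hv : v ≠ 0) :
    Measure.pi (fun _ : ι => gaussianReal 0 v) = (volume : Measure (ι → ℝ)).withDensity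
      (fun x => ENNReal.ofReal ((√(2 * Real.pi * v))⁻¹ ^ Fintype.card ι *
        Real.exp (-(1 / (2 * v)) * ∑ i, x i ^ 2))) := by
  rw [pi_eq_withDensity (μ := fun _ => volume) (f := fun _ => gaussianPDF 0 v)
    (fun _ => measurable_gaussianPDF 0 v) fun _ => gaussianReal_of_var_ne_zero 0 hv]
  congr 1
  funext x
  simp only [gaussianPDF]
  rw [← ENNReal.ofReal_prod_of_nonneg fun i _ => gaussianPDFReal_nonneg _ _ _]
  simp only [gaussianPDFReal]
  rw [Finset.prod_mul_distrib, Finset.prod_const, Finset.card_univ, ← Real.exp_sum, Finset.mul_sum]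
  congr 3
  refine Finset.sum_congr rfl fun i _ => ?_
  ring

lemma lintegral_exp_mul_gaussianReal (v : ℝ≥0) (t : ℝ) :
    ∫⁻ x, ENNReal.ofReal (Real.exp (t * x)) ∂(gaussianReal 0 v) =
      ENNReal.ofReal (Real.exp (v * t ^ 2 / 2)) := by
  rw [← ofReal_integral_eq_lintegral_ofReal (integrable_exp_mul_gaussianReal t)
    (ae_of_all _ fun _ => (Real.exp_pos _).le)]
  have := congrFun (mgf_id_gaussianReal (μ := 0) (v := v)) t
  simp only [mgf, id, zero_mul, zero_add] at this
  rw [this]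

end

section

variable {n d : ℕ} {σ : ℝ}

instance (n : ℕ) (σ : ℝ) : IsProbabilityMeasure (noise n σ) := by
  unfold noise
  infer_instance

/-- The density of the noise law. -/
noncomputable def noiseDensity (n : ℕ) (σ : ℝ) (x : Fin n → ℝ) : ℝ :=
  (√(2 * Real.pi * σ ^ 2))⁻¹ ^ n * Real.exp (-(1 / (2 * σ ^ 2)) * ∑ i, x i ^ 2)

lemma measurable_noiseDensity (n : ℕ) (σ : ℝ) : Measurable (noiseDensity n σ) := by
  unfold noiseDensity
  fun_prop

lemma noiseDensity_nonneg (x : Fin n → ℝ) : 0 ≤ noiseDensity n σ x := by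
  unfold noiseDensity
  positivity

lemma noise_eq_withDensity (n : ℕ) (hσ : 0 < σ) : noise n σ =
    (volume : Measure (Fin n → ℝ)).withDensity (fun x => ENNReal.ofReal (noiseDensity n σ x)) := by
  have hv : Real.toNNReal (σ ^ 2) ≠ 0 := by
    rw [Ne, Real.toNNReal_eq_zero]
    have : 0 < σ ^ 2 := by positivity
    linarith
  rw [noise, pi_gaussianReal_eq_withDensity hv, Real.coe_toNNReal _ (sq_nonneg σ), Fintype.card_fin]
  rfl

lemma lintegral_noise (hσ : 0 < σ) {f : (Fin n → ℝ) → ℝ≥0∞} (hf : Measurable f) :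
    ∫⁻ x, f x ∂(noise n σ) = ∫⁻ x, ENNReal.ofReal (noiseDensity n σ x) * f x := by
  rw [noise_eq_withDensity n hσ, lintegral_withDensity_eq_lintegral_mul _
    (measurable_noiseDensity n σ).ennreal_ofReal hf]
  rfl

lemma lintegral_exp_noise (v : Fin n → ℝ) :
    ∫⁻ x, ENNReal.ofReal (Real.exp (∑ i, v i * x i)) ∂(noise n σ) =
      ENNReal.ofReal (Real.exp (σ ^ 2 * (∑ i, v i ^ 2) / 2)) := by
  simp_rw [Real.exp_sum]
  rw [noise]
  simp_rw [fun x : Fin n → ℝ => ENNReal.ofReal_prod_of_nonneg (s := Finset.univ)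
    (f := fun i => Real.exp (v i * x i)) fun i _ => (Real.exp_pos _).le]
  rw [lintegral_pi_prod _ (f := fun i x => ENNReal.ofReal (Real.exp (v i * x))) fun i => by fun_prop]
  simp_rw [lintegral_exp_mul_gaussianReal]
  rw [← ENNReal.ofReal_prod_of_nonneg fun i _ => (Real.exp_pos _).le, ← Real.exp_sum,
    Real.coe_toNNReal _ (sq_nonneg σ), Finset.mul_sum, Finset.sum_div]

/-- Chernoff bound for a linear statistic of the noise. -/
lemma noise_linear_ge_le (hσ : 0 < σ) {v : Fin n → ℝ} {V τ : ℝ} (hV : 0 < V)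
    (hv : ∑ i, v i ^ 2 ≤ V) (hτ : 0 ≤ τ) :
    noise n σ {ξ | σ * √τ ≤ ∑ i, v i * ξ i} ≤ ENNReal.ofReal (Real.exp (-(τ / (2 * V)))) := by
  -- The minimizer of `σ² l² V / 2 - l σ √τ`.
  set l := √τ / (σ * V) with hl
  have hl0 : 0 ≤ l := by positivity
  have h1 := lintegral_exp_noise (n := n) (σ := σ) (fun i => l * v i)
  have hpos : 0 < Real.exp (l * (σ * √τ)) := Real.exp_pos _
  have h2 : {ξ : Fin n → ℝ | σ * √τ ≤ ∑ i, v i * ξ i} ⊆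
      {ξ | ENNReal.ofReal (Real.exp (l * (σ * √τ))) ≤
        ENNReal.ofReal (Real.exp (∑ i, l * v i * ξ i))} := fun ξ hξ => by
    refine ENNReal.ofReal_le_ofReal (Real.exp_le_exp.2 ?_)
    simp_rw [mul_assoc l]
    rw [← Finset.mul_sum]
    exact mul_le_mul_of_nonneg_left hξ hl0
  have h3 := meas_ge_le_lintegral_div (μ := noise n σ)
    (f := fun ξ => ENNReal.ofReal (Real.exp (∑ i, l * v i * ξ i)))
    (Measurable.aemeasurable (by fun_prop)) (ε := ENNReal.ofReal (Real.exp (l * (σ * √τ))))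
    (by simpa using hpos) ENNReal.ofReal_ne_top
  refine (measure_mono h2).trans (h3.trans ?_)
  rw [h1, ← ENNReal.ofReal_div_of_pos hpos, ← Real.exp_sub]
  refine ENNReal.ofReal_le_ofReal (Real.exp_le_exp.2 ?_)
  have h4 : ∑ i, (l * v i) ^ 2 ≤ l ^ 2 * V := by
    simp_rw [mul_pow]
    rw [← Finset.mul_sum]
    gcongr
  have h5 : σ ^ 2 * (l ^ 2 * V) / 2 - l * (σ * √τ) = -(τ / (2 * V)) := by
    rw [hl]
    field_simp
    rw [Real.sq_sqrt hτ]
    ring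
  have h6 : σ ^ 2 * (∑ i, (l * v i) ^ 2) ≤ σ ^ 2 * (l ^ 2 * V) := by gcongr
  linarith

lemma sum_col_sq_le {X : Matrix (Fin n) (Fin d) ℝ} {ε s : ℝ} (hX : IsRIP X ε s) (hs : 1 ≤ s)
    (j : Fin d) : ∑ i, X i j ^ 2 ≤ 1 + ε := by
  have h := (hX (Pi.single j 1) ?_).2
  · simpa [Pi.single_apply] using h
  · have : nnz (Pi.single j (1 : ℝ)) ≤ ({j} : Finset (Fin d)).card :=
      nnz_le_card fun i hi => by simp [Finset.mem_singleton.not.1 hi]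
    calc ((nnz (Pi.single j (1 : ℝ)) : ℕ) : ℝ) ≤ 1 := by exact_mod_cast this
      _ ≤ s := hs

/-- Union bound over the columns of `X`, in both directions. -/
lemma noise_exists_col_le (hσ : 0 < σ) {X : Matrix (Fin n) (Fin d) ℝ} {ε s τ : ℝ}
    (hX : IsRIP X ε s) (hs : 1 ≤ s) (hε : 0 ≤ ε) (hτ : 0 ≤ τ) :
    noise n σ {ξ | ¬ ∀ j, (∑ i, X i j * ξ i) ^ 2 ≤ σ ^ 2 * τ} ≤
      ENNReal.ofReal (d * (2 * Real.exp (-(τ / (2 * (1 + ε)))))) := by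
  have hsub : {ξ : Fin n → ℝ | ¬ ∀ j, (∑ i, X i j * ξ i) ^ 2 ≤ σ ^ 2 * τ} ⊆
      ⋃ j : Fin d, ({ξ | σ * √τ ≤ ∑ i, X i j * ξ i} ∪ {ξ | σ * √τ ≤ ∑ i, -X i j * ξ i}) := by
    intro ξ hξ
    obtain ⟨j, hj⟩ := not_forall.1 hξ
    rw [not_le] at hj
    refine Set.mem_iUnion.2 ⟨j, ?_⟩
    have h1 : (σ * √τ) ^ 2 < (∑ i, X i j * ξ i) ^ 2 := by
      rw [mul_pow, Real.sq_sqrt hτ]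
      exact hj
    have h2 := sq_lt_sq.1 h1
    rw [abs_of_nonneg (by positivity : 0 ≤ σ * √τ)] at h2
    rcases le_total 0 (∑ i, X i j * ξ i) with h0 | h0
    · rw [abs_of_nonneg h0] at h2
      exact Or.inl h2.le
    · rw [abs_of_nonpos h0] at h2
      refine Or.inr ?_
      change σ * √τ ≤ ∑ i, -X i j * ξ i
      simp_rw [neg_mul]
      rw [Finset.sum_neg_distrib]
      exact h2.le
  refine (measure_mono hsub).trans ((measure_iUnion_fintype_le _ _).trans ?_)
  have hb : ∀ j : Fin d, noise n σ ({ξ | σ * √τ ≤ ∑ i, X i j * ξ i} ∪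
      {ξ | σ * √τ ≤ ∑ i, -X i j * ξ i}) ≤
      ENNReal.ofReal (2 * Real.exp (-(τ / (2 * (1 + ε))))) := fun j => by
    refine (measure_union_le _ _).trans ?_
    rw [two_mul, ENNReal.ofReal_add (Real.exp_pos _).le (Real.exp_pos _).le]
    have hc := sum_col_sq_le hX hs j
    exact add_le_add (noise_linear_ge_le hσ (by linarith) hc hτ)
      (noise_linear_ge_le hσ (by linarith) (by simpa using hc) hτ)
  refine (Finset.sum_le_sum fun j _ => hb j).trans (le_of_eq ?_)
  rw [Finset.sum_const, Finset.card_univ, Fintype.card_fin, nsmul_eq_mul,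
    ENNReal.ofReal_mul (Nat.cast_nonneg d), ENNReal.ofReal_natCast]

/-! ### Sparse recovery forces `R` to be large -/

/-- Cameron–Martin: the shifted noise law has density `exp (v ⬝ y / σ² - |v|² / (2 σ²))`. -/
lemma noise_shift (hσ : 0 < σ) (v : Fin n → ℝ) {E : Set (Fin n → ℝ)} (hE : MeasurableSet E) :
    noise n σ {ξ | v + ξ ∈ E} = ∫⁻ y in E, ENNReal.ofReal
      (Real.exp ((∑ i, v i * y i) / σ ^ 2 - (∑ i, v i ^ 2) / (2 * σ ^ 2))) ∂(noise n σ) := by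
  have hm : Measurable fun y : Fin n → ℝ => ENNReal.ofReal
      (Real.exp ((∑ i, v i * y i) / σ ^ 2 - (∑ i, v i ^ 2) / (2 * σ ^ 2))) := by fun_prop
  have hE' : MeasurableSet {ξ | v + ξ ∈ E} := hE.preimage (by fun_prop)
  rw [← lintegral_indicator hE, lintegral_noise hσ (hm.indicator hE), ← lintegral_indicator_one hE',
    lintegral_noise hσ (measurable_one.indicator hE'),
    ← lintegral_add_left_eq_self (fun ξ => _ * E.indicator _ ξ) v]
  refine lintegral_congr fun ξ => ?_
  by_cases h : v + ξ ∈ E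
  · rw [Set.indicator_of_mem (show ξ ∈ {ξ | v + ξ ∈ E} from h), Set.indicator_of_mem h,
      Pi.one_apply, mul_one, ← ENNReal.ofReal_mul (noiseDensity_nonneg _)]
    congr 1
    rw [noiseDensity, noiseDensity, mul_assoc (_ ^ n), ← Real.exp_add]
    congr 2
    have : ∑ i, (v + ξ) i ^ 2 = ∑ i, v i ^ 2 + 2 * ∑ i, v i * ξ i + ∑ i, ξ i ^ 2 := by
      rw [Finset.mul_sum, ← Finset.sum_add_distrib, ← Finset.sum_add_distrib]
      exact Finset.sum_congr rfl fun i _ => by rw [Pi.add_apply]; ring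
    have h2 : ∑ i, v i * (v + ξ) i = ∑ i, v i ^ 2 + ∑ i, v i * ξ i := by
      rw [← Finset.sum_add_distrib]
      exact Finset.sum_congr rfl fun i _ => by rw [Pi.add_apply]; ring
    rw [this, h2]
    field_simp
    ring
  · rw [Set.indicator_of_notMem (show ξ ∉ {ξ | v + ξ ∈ E} from h), Set.indicator_of_notMem h,
      mul_zero, mul_zero]

/-- The second moment of the density of the shifted noise law, through `ℓ ≤ (c ℓ² + c⁻¹) / 2`. -/
lemma noise_shift_le (hσ : 0 < σ) (v : Fin n → ℝ) {E : Set (Fin n → ℝ)} (hE : MeasurableSet E)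
    {c : ℝ} (hc : 0 < c) :
    noise n σ {ξ | v + ξ ∈ E} ≤ ENNReal.ofReal (c / 2 * Real.exp ((∑ i, v i ^ 2) / σ ^ 2)) +
      ENNReal.ofReal (c⁻¹ / 2) * noise n σ E := by
  rw [noise_shift hσ v hE]
  set V := ∑ i, v i ^ 2 with hV
  have hpt : ∀ y : Fin n → ℝ, ENNReal.ofReal
      (Real.exp ((∑ i, v i * y i) / σ ^ 2 - V / (2 * σ ^ 2))) ≤
      ENNReal.ofReal (c / 2 * Real.exp (-(V / σ ^ 2))) *
        ENNReal.ofReal (Real.exp (∑ i, (2 * v i / σ ^ 2) * y i)) + ENNReal.ofReal (c⁻¹ / 2) := by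
    intro y
    rw [← ENNReal.ofReal_mul (by positivity), ← ENNReal.ofReal_add (by positivity) (by positivity)]
    refine ENNReal.ofReal_le_ofReal ?_
    set ℓ := Real.exp ((∑ i, v i * y i) / σ ^ 2 - V / (2 * σ ^ 2)) with hℓ
    have e : Real.exp (-(V / σ ^ 2)) * Real.exp (∑ i, (2 * v i / σ ^ 2) * y i) = ℓ ^ 2 := by
      rw [hℓ, ← Real.exp_add, ← Real.exp_nat_mul]
      congr 1
      have : ∑ i, (2 * v i / σ ^ 2) * y i = 2 * (∑ i, v i * y i) / σ ^ 2 := by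
        rw [Finset.mul_sum, Finset.sum_div]
        exact Finset.sum_congr rfl fun i _ => by ring
      rw [this]
      push_cast
      field_simp
      ring
    rw [mul_assoc, e]
    have h1 : 0 ≤ (c * ℓ - 1) ^ 2 := sq_nonneg _
    have h2 : c / 2 * ℓ ^ 2 + c⁻¹ / 2 - ℓ = (c * ℓ - 1) ^ 2 / (2 * c) := by
      field_simp
      ring
    have h3 : 0 ≤ (c * ℓ - 1) ^ 2 / (2 * c) := by positivity
    linarith
  refine (lintegral_mono hpt).trans ?_
  rw [lintegral_add_right _ measurable_const, lintegral_const, Measure.restrict_apply_univ]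
  gcongr
  refine (lintegral_mono' Measure.restrict_le_self le_rfl).trans ?_
  rw [lintegral_const_mul _ (by fun_prop), lintegral_exp_noise, ← ENNReal.ofReal_mul (by positivity)]
  refine ENNReal.ofReal_le_ofReal (le_of_eq ?_)
  rw [mul_assoc, ← Real.exp_add]
  congr 2
  have : ∑ i, (2 * v i / σ ^ 2) ^ 2 = 4 * V / σ ^ 4 := by
    rw [hV, Finset.mul_sum, Finset.sum_div]
    exact Finset.sum_congr rfl fun i _ => by field_simp; ring
  rw [this]
  field_simp
  ring

/-- Any estimator with `ℓ∞` error below `σ R` identifies `j` from `X (t e_j) + ξ` for `t > 2 σ R`,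
which is impossible when `exp (t² / σ²)` is much smaller than `d`. -/
lemma log_card_le_of_recovery (hσ : 0 < σ) {X : Matrix (Fin n) (Fin d) ℝ} {ε s : ℝ}
    (hX : IsRIP X ε s) (hs : 1 ≤ s) (hd : 0 < d) {A : (Fin n → ℝ) → (Fin d → ℝ)}
    (hA : Measurable A) {R η t : ℝ} (ht : 2 * (σ * R) < t) (hη0 : 0 < η) (hη1 : η < 1)
    (hrec : ∀ θ : Fin d → ℝ, nnz θ ≤ 1 →
      noise n σ {ξ | ¬ ∀ j, |A (X.mulVec θ + ξ) j - θ j| ≤ σ * R} ≤ ENNReal.ofReal η) :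
    Real.log d + 2 * Real.log (1 - η) ≤ t ^ 2 * (1 + ε) / σ ^ 2 := by
  let E : Fin d → Set (Fin n → ℝ) := fun j =>
    {y | ∀ i, |A y i - (Pi.single j t : Fin d → ℝ) i| ≤ σ * R}
  have hE : ∀ j, MeasurableSet (E j) := fun j => by
    have : E j = ⋂ i, {y | |A y i - (Pi.single j t : Fin d → ℝ) i| ≤ σ * R} := by
      ext y
      simp [E]
    rw [this]
    refine MeasurableSet.iInter fun i => measurableSet_le ?_ measurable_const
    have : Measurable fun y => A y i := (measurable_pi_apply i).comp hA
    exact (this.sub_const _).abs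
  have hdisj : Pairwise (Function.onFun Disjoint E) := by
    intro j l hjl
    rw [Function.onFun, Set.disjoint_left]
    intro y hj hl
    have h1 := abs_le.1 (hj j)
    have h2 := abs_le.1 (hl j)
    rw [Pi.single_eq_same] at h1
    rw [Pi.single_eq_of_ne hjl] at h2
    linarith [h1.1, h2.2]
  have hsum : ∑ j, (noise n σ).real (E j) ≤ 1 := by
    have h1 : ∑ j, noise n σ (E j) ≤ 1 := by
      rw [← tsum_fintype (L := .unconditional _), ← measure_iUnion hdisj hE]
      exact prob_le_one
    have h2 := ENNReal.toReal_mono ENNReal.one_ne_top h1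
    rwa [ENNReal.toReal_sum fun j _ => measure_ne_top _ _, ENNReal.toReal_one] at h2
  set M := Real.exp (t ^ 2 * (1 + ε) / σ ^ 2) with hM
  have hd0 : (0 : ℝ) < d := by exact_mod_cast hd
  have hMpos : 0 < M := Real.exp_pos _
  -- This value balances the two terms of `noise_shift_le` after summation over `j`.
  set c := (√(d * M))⁻¹ with hc
  have hcpos : 0 < c := by positivity
  have hj : ∀ j, 1 - η ≤ c / 2 * M + c⁻¹ / 2 * (noise n σ).real (E j) := fun j => by
    have hshift : Measurable fun ξ : Fin n → ℝ => X.mulVec (Pi.single j t) + ξ := by fun_prop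
    have h1 := noise_shift_le hσ (X.mulVec (Pi.single j t)) (hE j) hcpos
    have h2 := hrec (Pi.single j t) (nnz_le_card (S := {j}) fun i hi => by
      simp [Finset.mem_singleton.not.1 hi])
    have h3 : {ξ : Fin n → ℝ | ¬ ∀ i, |A (X.mulVec (Pi.single j t) + ξ) i -
        (Pi.single j t : Fin d → ℝ) i| ≤ σ * R} =
        {ξ | X.mulVec (Pi.single j t) + ξ ∈ E j}ᶜ := rfl
    have hm : MeasurableSet {ξ | X.mulVec (Pi.single j t) + ξ ∈ E j} := (hE j).preimage hshift
    rw [h3, prob_compl_eq_one_sub hm, tsub_le_iff_left] at h2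
    have h4 : (∑ i, X.mulVec (Pi.single j t) i ^ 2) / σ ^ 2 ≤ t ^ 2 * (1 + ε) / σ ^ 2 := by
      gcongr
      have : ∀ i, X.mulVec (Pi.single j t) i ^ 2 = t ^ 2 * X i j ^ 2 := fun i => by
        simp only [Matrix.mulVec_single, Pi.smul_apply, MulOpposite.smul_eq_mul_unop,
          MulOpposite.unop_op, Matrix.col_apply]
        ring
      simp_rw [this]
      rw [← Finset.mul_sum]
      exact mul_le_mul_of_nonneg_left (sum_col_sq_le hX hs j) (sq_nonneg t)
    have h5 := h2.trans (add_le_add_left h1 _)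
    rw [← ENNReal.ofReal_toReal (measure_ne_top (noise n σ) (E j)), ← ENNReal.ofReal_mul
      (by positivity), ← ENNReal.ofReal_add (by positivity) (by positivity),
      ← ENNReal.ofReal_add (by positivity) hη0.le, ENNReal.one_le_ofReal] at h5
    have h6 := Real.exp_le_exp.2 h4
    have h7 := mul_le_mul_of_nonneg_left h6 (by positivity : 0 ≤ c / 2)
    rw [Measure.real]
    linarith
  have htot : d * (1 - η) ≤ √(d * M) := by
    have h1 := Finset.sum_le_sum fun j (_ : j ∈ Finset.univ) => hj j
    rw [Finset.sum_add_distrib, Finset.sum_const, Finset.sum_const,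
      Finset.card_univ, Fintype.card_fin, nsmul_eq_mul, nsmul_eq_mul, ← Finset.mul_sum] at h1
    have h2 : c⁻¹ / 2 * ∑ j, (noise n σ).real (E j) ≤ c⁻¹ / 2 * 1 :=
      mul_le_mul_of_nonneg_left hsum (by positivity)
    have h3 : d * (c / 2 * M) = √(d * M) / 2 := by
      have h4 : √(d * M) * √(d * M) = d * M := Real.mul_self_sqrt (by positivity)
      rw [hc]
      field_simp
      linarith
    have h4 : c⁻¹ = √(d * M) := by rw [hc, inv_inv]
    rw [h4] at h1 h2
    linarith
  have h8 : (d : ℝ) * (1 - η) ^ 2 ≤ M := by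
    have h1 := Real.sqrt_le_sqrt (le_refl (d * M))
    have h2 : (d * (1 - η)) ^ 2 ≤ d * M := by
      rw [← Real.sq_sqrt (by positivity : 0 ≤ d * M)]
      exact pow_le_pow_left₀ (mul_nonneg hd0.le (by linarith)) htot 2
    refine le_of_mul_le_mul_left ?_ hd0
    linarith
  have h9 := Real.log_le_log (by have : 0 < 1 - η := by linarith
                                 positivity) h8
  rw [hM, Real.log_exp, Real.log_mul hd0.ne' (by have : 0 < 1 - η := by linarith
                                                 positivity), Real.log_pow] at h9
  exact_mod_cast h9

end

/-! ### The prior as a mixture over supports -/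

section

variable {d : ℕ} {q : Fin d → ℝ}

/-- The prior probability that the slab is used exactly at the coordinates in `S`. -/
noncomputable def suppPrior (q : Fin d → ℝ) (S : Finset (Fin d)) : ℝ :=
  (∏ i ∈ S, q i) * ∏ i ∈ Sᶜ, (1 - q i)

lemma suppPrior_nonneg (hq : ∀ i, 0 ≤ q i ∧ q i ≤ 1) (S : Finset (Fin d)) : 0 ≤ suppPrior q S :=
  mul_nonneg (Finset.prod_nonneg fun i _ => (hq i).1)
    (Finset.prod_nonneg fun i _ => sub_nonneg.2 (hq i).2)

/-- The standard Gaussian law on `ℝ^S`. -/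
noncomputable def slab (S : Finset (Fin d)) : Measure (S → ℝ) :=
  Measure.pi fun _ => gaussianReal 0 1

instance (S : Finset (Fin d)) : IsProbabilityMeasure (slab S) := by
  unfold slab
  infer_instance

lemma measurable_pad (S : Finset (Fin d)) : Measurable (pad S) := by
  refine measurable_pi_lambda _ fun i => ?_
  by_cases h : i ∈ S
  · simpa only [pad, h, dif_pos] using measurable_pi_apply (⟨i, h⟩ : S)
  · simp only [pad, h, dif_neg, not_false_eq_true, measurable_const]

lemma prior_eq_sum (hq : ∀ i, 0 ≤ q i ∧ q i ≤ 1) :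
    prior q = ∑ S : Finset (Fin d), ENNReal.ofReal (suppPrior q S) • (slab S).map (pad S) := by
  have inst : ∀ i, IsFiniteMeasure (ENNReal.ofReal (1 - q i) • Measure.dirac (0 : ℝ)
      + ENNReal.ofReal (q i) • gaussianReal 0 1) := fun i => by
    have := Measure.smul_finite (Measure.dirac (0 : ℝ)) (c := ENNReal.ofReal (1 - q i))
      ENNReal.ofReal_ne_top
    have := Measure.smul_finite (gaussianReal 0 1) (c := ENNReal.ofReal (q i)) ENNReal.ofReal_ne_top
    infer_instance
  refine Measure.pi_eq fun s hs => ?_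
  simp only [Measure.coe_add, Pi.add_apply, Measure.smul_apply, smul_eq_mul, Measure.finsetSum_apply]
  simp_rw [add_comm (ENNReal.ofReal (1 - q _) * _)]
  rw [Fintype.prod_add]
  refine Finset.sum_congr rfl fun S _ => ?_
  rw [Measure.map_apply (measurable_pad S) (MeasurableSet.univ_pi hs), Finset.prod_mul_distrib,
    Finset.prod_mul_distrib, suppPrior, ENNReal.ofReal_mul (Finset.prod_nonneg fun i _ => (hq i).1),
    ENNReal.ofReal_prod_of_nonneg fun i _ => (hq i).1,
    ENNReal.ofReal_prod_of_nonneg fun i _ => sub_nonneg.2 (hq i).2, mul_mul_mul_comm]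
  congr 1
  by_cases h : ∀ i ∈ Sᶜ, (0 : ℝ) ∈ s i
  · have h1 : pad S ⁻¹' Set.univ.pi s = Set.univ.pi fun i : S => s i := by
      ext t
      simp only [Set.mem_preimage, Set.mem_pi, Set.mem_univ, true_implies, Subtype.forall]
      refine forall_congr' fun i => ?_
      by_cases hi : i ∈ S
      · simp [pad, hi]
      · simp [pad, hi, h i (Finset.mem_compl.2 hi)]
    have h2 : ∏ i ∈ Sᶜ, Measure.dirac (0 : ℝ) (s i) = 1 := Finset.prod_eq_one fun i hi => by
      rw [Measure.dirac_apply' _ (hs i), Set.indicator_of_mem (h i hi), Pi.one_apply]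
    rw [h1, slab, Measure.pi_pi, h2, mul_one, Finset.prod_coe_sort S
      fun i => gaussianReal 0 1 (s i)]
  · have h1 : pad S ⁻¹' Set.univ.pi s = ∅ := by
      refine Set.eq_empty_of_forall_notMem fun t ht => h fun i hi => ?_
      have := ht i trivial
      simpa [pad, Finset.mem_compl.1 hi] using this
    push Not at h
    obtain ⟨i, hi, h0⟩ := h
    rw [h1, measure_empty, Finset.prod_eq_zero hi, mul_zero]
    rw [Measure.dirac_apply' _ (hs i), Set.indicator_of_notMem h0]

lemma lintegral_prior (hq : ∀ i, 0 ≤ q i ∧ q i ≤ 1) {f : (Fin d → ℝ) → ℝ≥0∞} (hf : Measurable f) :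
    ∫⁻ θ, f θ ∂(prior q) =
      ∑ S : Finset (Fin d), ENNReal.ofReal (suppPrior q S) * ∫⁻ t, f (pad S t) ∂(slab S) := by
  rw [prior_eq_sum hq, lintegral_finsetSum_measure]
  refine Finset.sum_congr rfl fun S _ => ?_
  rw [lintegral_smul_measure, lintegral_map hf (measurable_pad S), smul_eq_mul]

lemma sum_suppPrior_mul_pow (q : Fin d → ℝ) (x : ℝ) :
    ∑ S, suppPrior q S * x ^ S.card = ∏ i, (q i * x + (1 - q i)) := by
  rw [Fintype.prod_add]
  refine Finset.sum_congr rfl fun S _ => ?_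
  rw [Finset.prod_mul_distrib, Finset.prod_const, suppPrior]
  ring

lemma isProbabilityMeasure_prior (hq : ∀ i, 0 ≤ q i ∧ q i ≤ 1) :
    IsProbabilityMeasure (prior q) := by
  refine ⟨?_⟩
  have h := lintegral_prior hq (f := 1) measurable_one
  simp only [Pi.one_apply, lintegral_one, measure_univ, mul_one] at h
  rw [h, ← ENNReal.ofReal_sum_of_nonneg fun S _ => suppPrior_nonneg hq S]
  have := sum_suppPrior_mul_pow q 1
  simp only [one_pow, mul_one, add_sub_cancel, Finset.prod_const_one] at this
  rw [this, ENNReal.ofReal_one]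

/-- Chernoff bound for the size of the support. -/
lemma sum_suppPrior_card_le (hq : ∀ i, 0 ≤ q i ∧ q i ≤ 1) (r : ℝ) :
    ∑ S with r ≤ (S.card : ℝ), suppPrior q S ≤ Real.exp (2 * ∑ i, q i - r) := by
  have h1 : ∑ S with r ≤ (S.card : ℝ), suppPrior q S ≤
      ∑ S, Real.exp (-r) * (suppPrior q S * Real.exp 1 ^ S.card) := by
    refine (Finset.sum_le_sum fun S hS => ?_).trans (Finset.sum_le_sum_of_subset_of_nonneg
      (Finset.filter_subset _ _) fun S _ _ => by have := suppPrior_nonneg hq S; positivity)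
    have h0 := suppPrior_nonneg hq S
    have : 1 ≤ Real.exp (-r) * Real.exp 1 ^ S.card := by
      rw [← Real.exp_nat_mul, ← Real.exp_add]
      refine Real.one_le_exp ?_
      have := (Finset.mem_filter.1 hS).2
      linarith
    nlinarith
  refine h1.trans ?_
  rw [← Finset.mul_sum, sum_suppPrior_mul_pow, sub_eq_neg_add, Real.exp_add, Finset.mul_sum,
    Real.exp_sum]
  refine mul_le_mul_of_nonneg_left (Finset.prod_le_prod (fun i _ => ?_) fun i _ => ?_)
    (Real.exp_pos _).le
  · have := hq i
    have := Real.exp_pos 1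
    nlinarith
  · have h2 := Real.exp_one_lt_d9
    have h3 := Real.add_one_le_exp (2 * q i)
    have := hq i
    nlinarith

lemma measurable_nnz : Measurable fun θ : Fin d → ℝ => (nnz θ : ℝ) := by
  have : (fun θ : Fin d → ℝ => (nnz θ : ℝ)) = fun θ => ∑ i, if θ i ≠ 0 then (1 : ℝ) else 0 := by
    funext θ
    rw [nnz, Finset.sum_boole]
  rw [this]
  refine Finset.measurable_sum _ fun i _ => Measurable.ite ?_ measurable_const measurable_const
  exact (measurableSet_singleton (0 : ℝ)).compl.preimage (measurable_pi_apply i)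

lemma prior_nnz_le (hq : ∀ i, 0 ≤ q i ∧ q i ≤ 1) (r : ℝ) :
    prior q {θ | r < nnz θ} ≤ ENNReal.ofReal (Real.exp (2 * ∑ i, q i - r)) := by
  have hm : MeasurableSet {θ : Fin d → ℝ | r < nnz θ} := measurableSet_lt measurable_const measurable_nnz
  rw [← lintegral_indicator_one hm, lintegral_prior hq (measurable_one.indicator hm)]
  refine le_trans ?_ (ENNReal.ofReal_le_ofReal (sum_suppPrior_card_le hq r))
  rw [ENNReal.ofReal_sum_of_nonneg fun S _ => suppPrior_nonneg hq S, Finset.sum_filter]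
  refine Finset.sum_le_sum fun S _ => ?_
  split_ifs with h
  · refine mul_le_of_le_one_right' ((lintegral_mono fun t =>
      Set.indicator_le_self' (by simp) _).trans ?_)
    simp
  · have : ∀ t : S → ℝ, Set.indicator {θ : Fin d → ℝ | r < nnz θ} (1 : (Fin d → ℝ) → ℝ≥0∞) (pad S t) = 0 :=
      fun t => by
        refine Set.indicator_of_notMem (fun h1 => h ?_) _
        have h2 : r < nnz (pad S t) := h1
        exact h2.le.trans (by exact_mod_cast nnz_pad_le S t)
    simp [this]

lemma lintegral_exp_sq_gaussianReal :
    ∫⁻ x, ENNReal.ofReal (Real.exp (3 / 8 * x ^ 2)) ∂(gaussianReal 0 1) = 2 := by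
  rw [gaussianReal_of_var_ne_zero 0 one_ne_zero, lintegral_withDensity_eq_lintegral_mul _
    (measurable_gaussianPDF 0 1) (by fun_prop)]
  have h : ∀ x : ℝ, (gaussianPDF 0 1 * fun x => ENNReal.ofReal (Real.exp (3 / 8 * x ^ 2))) x =
      ENNReal.ofReal ((√(2 * Real.pi))⁻¹ * Real.exp (-(1 / 8) * x ^ 2)) := fun x => by
    rw [Pi.mul_apply, gaussianPDF, ← ENNReal.ofReal_mul (gaussianPDFReal_nonneg _ _ _),
      gaussianPDFReal, mul_assoc, ← Real.exp_add]
    simp only [NNReal.coe_one, mul_one, sub_zero]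
    congr 3
    ring
  simp_rw [h]
  rw [← ofReal_integral_eq_lintegral_ofReal
    ((integrable_exp_neg_mul_sq (by norm_num)).const_mul _) (ae_of_all _ fun _ => by positivity),
    integral_const_mul, integral_gaussian]
  have : √(Real.pi / (1 / 8)) = 2 * √(2 * Real.pi) := by
    rw [show Real.pi / (1 / 8) = 2 ^ 2 * (2 * Real.pi) by ring,
      Real.sqrt_mul (by norm_num), Real.sqrt_sq (by norm_num)]
  rw [this]
  have h0 : √(2 * Real.pi) ≠ 0 := by positivity
  rw [show (√(2 * Real.pi))⁻¹ * (2 * √(2 * Real.pi)) = 2 by field_simp]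
  simp

/-- Chernoff bound for the norm of the signal, through `E exp (3/8 x²) = 2` for Gaussian `x`. -/
lemma prior_sum_sq_le (hq : ∀ i, 0 ≤ q i ∧ q i ≤ 1) (r : ℝ) :
    prior q {θ | r < ∑ i, θ i ^ 2} ≤ ENNReal.ofReal (Real.exp (∑ i, q i - 3 / 8 * r)) := by
  have h1 : ∫⁻ θ, ENNReal.ofReal (Real.exp (3 / 8 * ∑ i, θ i ^ 2)) ∂(prior q) ≤
      ENNReal.ofReal (Real.exp (∑ i, q i)) := by
    rw [lintegral_prior hq (by fun_prop)]
    have h2 : ∀ S : Finset (Fin d),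
        ∫⁻ t, ENNReal.ofReal (Real.exp (3 / 8 * ∑ i, pad S t i ^ 2)) ∂(slab S) = 2 ^ S.card := by
      intro S
      have : ∀ t : S → ℝ, ENNReal.ofReal (Real.exp (3 / 8 * ∑ i, pad S t i ^ 2)) =
          ∏ i, ENNReal.ofReal (Real.exp (3 / 8 * t i ^ 2)) := fun t => by
        rw [sum_pad_sq, Finset.mul_sum, Real.exp_sum,
          ENNReal.ofReal_prod_of_nonneg fun i _ => (Real.exp_pos _).le]
      simp_rw [this]
      rw [slab, lintegral_pi_prod _ (f := fun (_ : S) x => ENNReal.ofReal (Real.exp (3 / 8 * x ^ 2)))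
        fun i => by fun_prop]
      simp [lintegral_exp_sq_gaussianReal]
    simp_rw [h2]
    have h3 : ∀ S : Finset (Fin d), ENNReal.ofReal (suppPrior q S) * 2 ^ S.card =
        ENNReal.ofReal (suppPrior q S * 2 ^ S.card) := fun S => by
      rw [ENNReal.ofReal_mul (suppPrior_nonneg hq S), ENNReal.ofReal_pow (by norm_num)]
      simp
    simp_rw [h3]
    rw [← ENNReal.ofReal_sum_of_nonneg fun S _ => mul_nonneg (suppPrior_nonneg hq S) (by positivity),
      sum_suppPrior_mul_pow, Real.exp_sum]
    refine ENNReal.ofReal_le_ofReal (Finset.prod_le_prod (fun i _ => ?_) fun i _ => ?_)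
    · have := hq i
      linarith
    · have := Real.add_one_le_exp (q i)
      linarith
  have h2 : {θ : Fin d → ℝ | r < ∑ i, θ i ^ 2} ⊆ {θ | ENNReal.ofReal (Real.exp (3 / 8 * r)) ≤
      ENNReal.ofReal (Real.exp (3 / 8 * ∑ i, θ i ^ 2))} := fun θ (hθ : r < _) =>
    ENNReal.ofReal_le_ofReal (Real.exp_le_exp.2 (by linarith))
  have hpos := Real.exp_pos (3 / 8 * r)
  have h3 := meas_ge_le_lintegral_div (μ := prior q)
    (f := fun θ => ENNReal.ofReal (Real.exp (3 / 8 * ∑ i, θ i ^ 2)))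
    (Measurable.aemeasurable (by fun_prop)) (ε := ENNReal.ofReal (Real.exp (3 / 8 * r)))
    (by simpa using hpos) ENNReal.ofReal_ne_top
  refine (measure_mono h2).trans (h3.trans ((ENNReal.div_le_div_right h1 _).trans (le_of_eq ?_)))
  rw [← ENNReal.ofReal_div_of_pos hpos, ← Real.exp_sub]

end

/-! ### The joint law of the support and the observation -/

section

variable {n d : ℕ} {q : Fin d → ℝ} {σ : ℝ}

lemma integrable_suppWeight (X : Matrix (Fin n) (Fin d) ℝ) (y : Fin n → ℝ) (S : Finset (Fin d)) :
    Integrable fun t : S → ℝ => Real.exp (-(1 / (2 * σ ^ 2)) *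
      ∑ i, (y i - (X.mulVec (pad S t)) i) ^ 2 - (1 / 2) * ∑ j, t j ^ 2) := by
  have h1 : Integrable fun t : S → ℝ => ∏ j, Real.exp (-(1 / 2) * t j ^ 2) :=
    Integrable.fintype_prod (f := fun (_ : S) x => Real.exp (-(1 / 2) * x ^ 2))
      fun _ => integrable_exp_neg_mul_sq (by norm_num)
  refine h1.mono' ?_ (ae_of_all _ fun t => ?_)
  · have := measurable_pad S
    refine Measurable.aestronglyMeasurable ?_
    fun_prop
  · rw [Real.norm_of_nonneg (Real.exp_pos _).le, ← Real.exp_sum, ← Finset.mul_sum]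
    refine Real.exp_le_exp.2 ?_
    have : 0 ≤ 1 / (2 * σ ^ 2) * ∑ i, (y i - (X.mulVec (pad S t)) i) ^ 2 := by positivity
    linarith

lemma suppWeight_nonneg (hq : ∀ i, 0 ≤ q i ∧ q i ≤ 1) (X : Matrix (Fin n) (Fin d) ℝ)
    (y : Fin n → ℝ) (S : Finset (Fin d)) : 0 ≤ suppWeight X σ q y S := by
  refine mul_nonneg (div_nonneg (suppPrior_nonneg hq S) (by positivity))
    (integral_nonneg fun t => (Real.exp_pos _).le)

lemma measurable_suppWeight (X : Matrix (Fin n) (Fin d) ℝ) (S : Finset (Fin d)) :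
    Measurable fun y => suppWeight X σ q y S := by
  have := measurable_pad S
  refine Measurable.const_mul ?_ _
  refine (StronglyMeasurable.integral_prod_right (ν := (volume : Measure (S → ℝ)))
    (f := fun (y : Fin n → ℝ) (t : S → ℝ) => Real.exp (-(1 / (2 * σ ^ 2)) *
      ∑ i, (y i - (X.mulVec (pad S t)) i) ^ 2 - (1 / 2) * ∑ j, t j ^ 2)) ?_).measurable
  refine Measurable.stronglyMeasurable ?_
  unfold Function.uncurry
  fun_prop

lemma lintegral_slab (S : Finset (Fin d)) {f : (S → ℝ) → ℝ≥0∞} (hf : Measurable f) :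
    ∫⁻ t, f t ∂(slab S) = ∫⁻ t, ENNReal.ofReal ((√(2 * Real.pi))⁻¹ ^ S.card *
      Real.exp (-(1 / 2) * ∑ i, t i ^ 2)) * f t := by
  rw [slab, pi_gaussianReal_eq_withDensity one_ne_zero,
    lintegral_withDensity_eq_lintegral_mul _ (by fun_prop) hf]
  simp

/-- Up to a constant, `suppWeight X σ q y S` is the density at `y` of the joint law of the support
and the observation. -/
lemma lintegral_observation (hσ : 0 < σ) (hq : ∀ i, 0 ≤ q i ∧ q i ≤ 1)
    (X : Matrix (Fin n) (Fin d) ℝ) (S : Finset (Fin d)) {G : (Fin n → ℝ) → ℝ≥0∞}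
    (hG : Measurable G) :
    ENNReal.ofReal (suppPrior q S) *
        ∫⁻ t, ∫⁻ ξ, G (X.mulVec (pad S t) + ξ) ∂(noise n σ) ∂(slab S) =
      ∫⁻ y, ENNReal.ofReal ((√(2 * Real.pi * σ ^ 2))⁻¹ ^ n * suppWeight X σ q y S) * G y := by
  have hpad := measurable_pad S
  have hnd := measurable_noiseDensity n σ
  have h1 : ∀ t : S → ℝ, ∫⁻ ξ, G (X.mulVec (pad S t) + ξ) ∂(noise n σ) =
      ∫⁻ y, ENNReal.ofReal (noiseDensity n σ (y - X.mulVec (pad S t))) * G y := fun t => by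
    rw [lintegral_noise hσ (by fun_prop), ← lintegral_add_left_eq_self
      (fun y => ENNReal.ofReal (noiseDensity n σ (y - X.mulVec (pad S t))) * G y)
      (X.mulVec (pad S t))]
    simp only [add_sub_cancel_left]
  simp_rw [h1]
  have hm : Measurable fun p : (S → ℝ) × (Fin n → ℝ) =>
      ENNReal.ofReal (noiseDensity n σ (p.2 - X.mulVec (pad S p.1))) * G p.2 := by
    refine Measurable.mul (Measurable.ennreal_ofReal (hnd.comp ?_)) (by fun_prop)
    fun_prop
  rw [lintegral_slab S hm.lintegral_prod_right']
  rw [lintegral_congr fun t => (lintegral_const_mul' _ _ ENNReal.ofReal_ne_top).symm,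
    lintegral_lintegral_swap, ← lintegral_const_mul' _ _ ENNReal.ofReal_ne_top]
  swap
  · refine Measurable.aemeasurable ?_
    refine Measurable.mul ?_ hm
    fun_prop
  refine lintegral_congr fun y => ?_
  simp_rw [← mul_assoc]
  rw [lintegral_mul_const _ (by
    refine Measurable.mul (by fun_prop) (Measurable.ennreal_ofReal (hnd.comp (by fun_prop)))),
    ← mul_assoc]
  congr 1
  have h2 : ∀ t : S → ℝ, ENNReal.ofReal ((√(2 * Real.pi))⁻¹ ^ S.card *
      Real.exp (-(1 / 2) * ∑ i, t i ^ 2)) *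
      ENNReal.ofReal (noiseDensity n σ (y - X.mulVec (pad S t))) =
      ENNReal.ofReal ((√(2 * Real.pi))⁻¹ ^ S.card * (√(2 * Real.pi * σ ^ 2))⁻¹ ^ n *
        Real.exp (-(1 / (2 * σ ^ 2)) *
          ∑ i, (y i - (X.mulVec (pad S t)) i) ^ 2 - (1 / 2) * ∑ j, t j ^ 2)) := fun t => by
    rw [← ENNReal.ofReal_mul (by positivity), noiseDensity, mul_mul_mul_comm, ← Real.exp_add]
    congr 3
    simp only [Pi.sub_apply]
    ring
  simp_rw [h2]
  rw [← ofReal_integral_eq_lintegral_ofReal ((integrable_suppWeight X y S).const_mul _)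
    (ae_of_all _ fun _ => by positivity), integral_const_mul,
    ← ENNReal.ofReal_mul (suppPrior_nonneg hq S), suppWeight, suppPrior]
  congr 1
  have h3 : (√(2 * Real.pi))⁻¹ ^ S.card = ((2 * Real.pi) ^ ((S.card : ℝ) / 2))⁻¹ := by
    rw [inv_pow, Real.sqrt_eq_rpow, ← Real.rpow_natCast, ← Real.rpow_mul (by positivity)]
    congr 2
    ring
  rw [h3]
  ring

lemma measure_preimage_eq_lintegral {α β : Type*} [MeasurableSpace α] [MeasurableSpace β]
    (μ : Measure α) {f : α → β} (hf : Measurable f) {B : Set β} (hB : MeasurableSet B) :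
    μ {x | f x ∈ B} = ∫⁻ x, B.indicator 1 (f x) ∂μ := by
  rw [← lintegral_map (measurable_one.indicator hB) hf, lintegral_indicator_one hB,
    Measure.map_apply hf hB]
  rfl

/-- Markov's inequality for the posterior mass outside a set of supports chosen from the
observation: by Bayes' rule its mean is the probability that the true support is left out. -/
lemma posterior_outside_le (hσ : 0 < σ) (hq : ∀ i, 0 ≤ q i ∧ q i ≤ 1)
    (X : Matrix (Fin n) (Fin d) ℝ) {Ω : (Fin n → ℝ) → Finset (Finset (Fin d))}
    (hΩ : ∀ S, MeasurableSet {y | S ∈ Ω y}) {c : ℝ} (hc : 0 < c) :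
    (prior q).prod (noise n σ) {p | c * ∑ S, suppWeight X σ q (X.mulVec p.1 + p.2) S <
        ∑ S ∈ (Ω (X.mulVec p.1 + p.2))ᶜ, suppWeight X σ q (X.mulVec p.1 + p.2) S} ≤
      ENNReal.ofReal c⁻¹ * ∑ S, ENNReal.ofReal (suppPrior q S) *
        ∫⁻ t, noise n σ {ξ | S ∉ Ω (X.mulVec (pad S t) + ξ)} ∂(slab S) := by
  have hw : ∀ S, Measurable fun y => suppWeight X σ q y S := measurable_suppWeight X
  have hΩ' : ∀ S, MeasurableSet {y | S ∉ Ω y} := fun S => (hΩ S).compl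
  have hout : ∀ y, ∑ S ∈ (Ω y)ᶜ, suppWeight X σ q y S =
      ∑ S, {y | S ∉ Ω y}.indicator (fun y => suppWeight X σ q y S) y := fun y => by
    rw [← Finset.sum_filter_add_sum_filter_not Finset.univ (fun S => S ∈ (Ω y)ᶜ)]
    rw [Finset.sum_eq_zero (s := Finset.univ.filter fun S => ¬ S ∈ (Ω y)ᶜ), add_zero]
    · refine Finset.sum_congr (by ext; simp) fun S hS => ?_
      rw [Set.indicator_of_mem]
      exact Finset.mem_compl.1 (by simpa using hS)
    · intro S hS
      refine Set.indicator_of_notMem (fun h => ?_) _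
      simp only [Finset.mem_filter, Finset.mem_compl, not_not] at hS
      exact h hS.2
  set B : Set (Fin n → ℝ) := {y | c * ∑ S, suppWeight X σ q y S <
    ∑ S ∈ (Ω y)ᶜ, suppWeight X σ q y S} with hB
  have hBm : MeasurableSet B := by
    rw [hB]
    simp_rw [hout]
    exact measurableSet_lt (by fun_prop)
      (Finset.measurable_sum _ fun S _ => (hw S).indicator (hΩ' S))
  have := isProbabilityMeasure_prior hq
  have hadd : Measurable fun p : (Fin d → ℝ) × (Fin n → ℝ) => X.mulVec p.1 + p.2 := by fun_prop
  have hset : {p : (Fin d → ℝ) × (Fin n → ℝ) | c * ∑ S, suppWeight X σ q (X.mulVec p.1 + p.2) S <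
      ∑ S ∈ (Ω (X.mulVec p.1 + p.2))ᶜ, suppWeight X σ q (X.mulVec p.1 + p.2) S} =
      {p | X.mulVec p.1 + p.2 ∈ B} := rfl
  rw [hset]
  have hG : Measurable (B.indicator (1 : (Fin n → ℝ) → ℝ≥0∞)) := measurable_one.indicator hBm
  have hGm : Measurable fun p : (Fin d → ℝ) × (Fin n → ℝ) =>
    B.indicator (1 : (Fin n → ℝ) → ℝ≥0∞) (X.mulVec p.1 + p.2) := hG.comp hadd
  have h1 : (prior q).prod (noise n σ) {p | X.mulVec p.1 + p.2 ∈ B} =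
      ∑ S, ∫⁻ y, ENNReal.ofReal ((√(2 * Real.pi * σ ^ 2))⁻¹ ^ n * suppWeight X σ q y S) *
        B.indicator 1 y := by
    rw [measure_preimage_eq_lintegral _ hadd hBm, lintegral_prod _ hGm.aemeasurable, lintegral_prior hq hGm.lintegral_prod_right']
    exact Finset.sum_congr rfl fun S _ => lintegral_observation hσ hq X S hG
  have h2 : ∀ S, ENNReal.ofReal (suppPrior q S) *
        ∫⁻ t, noise n σ {ξ | S ∉ Ω (X.mulVec (pad S t) + ξ)} ∂(slab S) =
      ∫⁻ y, ENNReal.ofReal ((√(2 * Real.pi * σ ^ 2))⁻¹ ^ n * suppWeight X σ q y S) *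
        {y | S ∉ Ω y}.indicator 1 y := fun S => by
    rw [← lintegral_observation hσ hq X S (measurable_one.indicator (hΩ' S))]
    congr 1
    refine lintegral_congr fun t => ?_
    exact measure_preimage_eq_lintegral _ (by fun_prop) (hΩ' S)
  rw [h1]
  simp_rw [h2]
  have hm1 : ∀ S, Measurable fun y =>
      ENNReal.ofReal ((√(2 * Real.pi * σ ^ 2))⁻¹ ^ n * suppWeight X σ q y S) :=
    fun S => ((hw S).const_mul _).ennreal_ofReal
  have hm2 : ∀ S, Measurable fun y => ENNReal.ofReal ((√(2 * Real.pi * σ ^ 2))⁻¹ ^ n *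
      suppWeight X σ q y S) * B.indicator 1 y := fun S => (hm1 S).mul hG
  have hm3 : ∀ S, Measurable fun y => ENNReal.ofReal ((√(2 * Real.pi * σ ^ 2))⁻¹ ^ n *
      suppWeight X σ q y S) * {y | S ∉ Ω y}.indicator 1 y :=
    fun S => (hm1 S).mul (measurable_one.indicator (hΩ' S))
  rw [← lintegral_finsetSum _ fun S _ => hm2 S, ← lintegral_finsetSum _ fun S _ => hm3 S,
    ← lintegral_const_mul' _ _ ENNReal.ofReal_ne_top]
  refine lintegral_mono fun y => ?_
  by_cases hy : y ∈ B
  · simp only [Set.indicator_of_mem hy, Pi.one_apply, mul_one]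
    have h3 : ∀ S, ENNReal.ofReal ((√(2 * Real.pi * σ ^ 2))⁻¹ ^ n * suppWeight X σ q y S) *
        {y | S ∉ Ω y}.indicator 1 y = ENNReal.ofReal ((√(2 * Real.pi * σ ^ 2))⁻¹ ^ n *
          {y | S ∉ Ω y}.indicator (fun y => suppWeight X σ q y S) y) := fun S => by
      by_cases h : y ∈ {y | S ∉ Ω y}
      · simp [Set.indicator_of_mem h]
      · simp [Set.indicator_of_notMem h]
    simp_rw [h3]
    rw [← ENNReal.ofReal_sum_of_nonneg fun S _ =>
        mul_nonneg (by positivity) (suppWeight_nonneg hq X y S),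
      ← ENNReal.ofReal_sum_of_nonneg fun S _ => mul_nonneg (by positivity)
        (Set.indicator_nonneg (fun y _ => suppWeight_nonneg hq X y S) _),
      ← Finset.mul_sum, ← Finset.mul_sum, ← hout, ← ENNReal.ofReal_mul (by positivity)]
    refine ENNReal.ofReal_le_ofReal ?_
    rw [mul_left_comm]
    refine mul_le_mul_of_nonneg_left ?_ (by positivity)
    rw [← div_eq_inv_mul, le_div_iff₀ hc, mul_comm]
    exact le_of_lt hy
  · simp [Set.indicator_of_notMem hy]

end

/-! ### Accuracy of the sampler on a likely event -/

section

variable {n d : ℕ} {q : Fin d → ℝ} {σ : ℝ}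

lemma suppSet_clip_subset {x θ : Fin d → ℝ} {r : ℝ} (h : ∀ j, |x j - θ j| ≤ r) :
    suppSet (clip x (3 * r)) ⊆ suppSet θ := fun j hj => by
  rw [mem_suppSet] at hj ⊢
  intro h0
  have h1 := h j
  rw [h0, sub_zero] at h1
  refine hj (if_neg ?_)
  linarith [abs_nonneg (x j)]

lemma abs_sub_clip_le {x θ : Fin d → ℝ} {r : ℝ} (h : ∀ j, |x j - θ j| ≤ r) (j : Fin d) :
    |θ j - clip x (3 * r) j| ≤ 4 * r := by
  have h1 := abs_le.1 (h j)
  unfold clip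
  split_ifs with hj
  · exact abs_le.2 ⟨by linarith, by linarith⟩
  · have h2 := abs_le.1 (not_lt.1 hj)
    exact abs_le.2 ⟨by linarith, by linarith⟩

lemma measurable_clip {A : (Fin n → ℝ) → (Fin d → ℝ)} (hA : Measurable A) (α : ℝ) (j : Fin d) :
    Measurable fun y => clip (A y) α j := by
  have h : Measurable fun y => A y j := (measurable_pi_apply j).comp hA
  unfold clip
  refine Measurable.ite (measurableSet_lt measurable_const ?_) h measurable_const
  exact continuous_abs.measurable.comp h

lemma measurableSet_mem_candidates {θ : (Fin n → ℝ) → (Fin d → ℝ)}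
    (hθ : ∀ j, Measurable fun y => θ y j) (S : Finset (Fin d)) (m : ℕ) :
    MeasurableSet {y | S ∈ candidates (suppSet (θ y)) m} := by
  have h : {y | S ∈ candidates (suppSet (θ y)) m} =
      (⋂ i ∈ Sᶜ, {y | θ y i = 0}) ∩ {_y | S.card ≤ m} := by
    ext y
    simp only [mem_candidates, Set.mem_ofPred_eq, Set.mem_inter_iff, Set.mem_iInter,
      Finset.mem_compl]
    refine and_congr_left fun _ => ⟨fun h i hi => ?_, fun h i hi => ?_⟩
    · by_contra h0
      exact hi (h (mem_suppSet.2 h0))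
    · by_contra h0
      exact mem_suppSet.1 hi (h i h0)
  rw [h]
  refine MeasurableSet.inter (Finset.measurableSet_biInter _ fun i _ => ?_) (MeasurableSet.const _)
  exact (measurableSet_singleton (0 : ℝ)).preimage (hθ i)

lemma sum_suppWeight_pos (hq : ∀ i, 0 ≤ q i ∧ q i ≤ 1) (X : Matrix (Fin n) (Fin d) ℝ)
    (y : Fin n → ℝ) : 0 < ∑ S, suppWeight X σ q y S := by
  refine Finset.sum_pos' (fun S _ => suppWeight_nonneg hq X y S)
    ⟨Finset.univ.filter fun i => 0 < q i, Finset.mem_univ _, ?_⟩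
  refine mul_pos (div_pos (mul_pos (Finset.prod_pos fun i hi => (Finset.mem_filter.1 hi).2)
    (Finset.prod_pos fun i hi => ?_)) (by positivity)) (integral_exp_pos (integrable_suppWeight X y _))
  simp only [Finset.mem_compl, Finset.mem_filter, Finset.mem_univ, true_and, not_lt] at hi
  linarith

/-- On the good event the rejection sampler is accurate. -/
lemma tvDist_posteriorSupp_le (hσ : 0 < σ) (hq : ∀ i, 0 ≤ q i ∧ q i ≤ 1)
    {X : Matrix (Fin n) (Fin d) ℝ} {ε R τ δ : ℝ} {k : ℕ} (hX : IsRIP X ε k) (hδ : 0 < δ)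
    (hδ1 : δ < 1) (hε0 : 0 ≤ ε) (hε : ε ≤ 1 / 100) (hεk : ε * k ≤ 1 / 50)
    (hεB : ε * (k * (17 * R ^ 2 + 3 * τ + 1 / 2)) ≤ 3 / 2) {θ θhat : Fin d → ℝ} {ξ : Fin n → ℝ}
    (hnnz : (nnz θ : ℝ) ≤ k / 4) (hsupp : suppSet θhat ⊆ suppSet θ)
    (herr : ∀ j, |θ j - θhat j| ≤ 4 * σ * R) (hnorm : ∑ j, θ j ^ 2 ≤ k / 2)
    (hτ : 0 ≤ τ) (hξ : ∀ j, (∑ i, X i j * ξ i) ^ 2 ≤ σ ^ 2 * τ)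
    (hout : ∑ S ∈ (candidates (suppSet θhat) (3 * k / 4))ᶜ,
        suppWeight X σ q (X.mulVec θ + ξ) S ≤
      δ / 2 * ∑ S, suppWeight X σ q (X.mulVec θ + ξ) S) :
    tvDist (posteriorSampleGaussian X (X.mulVec θ + ξ) θhat σ q k δ).law
      (posteriorSupp X σ q (X.mulVec θ + ξ)) ≤ δ := by
  set y := X.mulVec θ + ξ with hy
  have hZ := sum_suppWeight_pos (σ := σ) hq X y
  obtain ⟨D, hD⟩ := suppWeight_eq_mul_ratioVal X hσ hq y θhat
  have hratio : ∀ S ∈ candidates (suppSet θhat) (3 * k / 4),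
      1 / 3 ≤ ratioVal X σ (linStat X y θhat σ) (fun i : S => (i : Fin d)) ∧
        ratioVal X σ (linStat X y θhat σ) (fun i : S => (i : Fin d)) ≤ 3 := fun S hS => by
    have h1 : 4 * S.card ≤ 3 * k := by
      have := (mem_candidates.1 hS).2
      omega
    have h2 : 4 * (S.card : ℝ) ≤ 3 * k := by exact_mod_cast h1
    have h3 : (0 : ℝ) ≤ k := Nat.cast_nonneg k
    refine ratioVal_mem_Icc hX hσ hε0 hε (by linarith)
      ((mul_le_mul_of_nonneg_left (by linarith) hε0).trans hεk) _ (le_trans ?_ hεB)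
    exact mul_le_mul_of_nonneg_left
      (linStat_sq_le hX hσ hε0 hε hnnz hsupp herr hnorm hτ hξ (by linarith)) hε0
  refine tvDist_sampler_le X y θhat hσ hq hδ hδ1
    (fun S => div_nonneg (suppWeight_nonneg hq X y S) hZ.le) ?_ ?_
    (D := D / ∑ S, suppWeight X σ q y S) (fun S hS => ?_)
    (fun S hS => (hratio S hS).1) fun S hS => (hratio S hS).2
  · simp only [posteriorSupp]
    rw [← Finset.sum_div, div_self hZ.ne']
  · simp only [posteriorSupp]
    rw [← Finset.sum_div, div_le_iff₀ hZ]
    exact hout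
  · rw [posteriorSupp, hD S (mem_candidates.1 hS).1]
    ring

/-- The prior probability of a large support, plus the failure probability of the estimator on
sparse signals, bounds the probability that the true support is not a candidate. -/
lemma sum_suppPrior_notMem_candidates_le (hq : ∀ i, 0 ≤ q i ∧ q i ≤ 1)
    {X : Matrix (Fin n) (Fin d) ℝ} {A : (Fin n → ℝ) → (Fin d → ℝ)} {k : ℕ} {r η : ℝ} (hη : 0 ≤ η)
    (hrec : ∀ θ : Fin d → ℝ, nnz θ ≤ k →
      noise n σ {ξ | ¬ ∀ j, |A (X.mulVec θ + ξ) j - θ j| ≤ r} ≤ ENNReal.ofReal η) :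
    ∑ S, ENNReal.ofReal (suppPrior q S) * ∫⁻ t, noise n σ {ξ | S ∉ candidates
        (suppSet (clip (A (X.mulVec (pad S t) + ξ)) (3 * r))) (3 * k / 4)} ∂(slab S) ≤
      ENNReal.ofReal (η + Real.exp (2 * ∑ i, q i - 3 / 4 * k)) := by
  have hc := suppPrior_nonneg hq
  have h1 : ∀ S : Finset (Fin d), ∫⁻ t, noise n σ {ξ | S ∉ candidates
      (suppSet (clip (A (X.mulVec (pad S t) + ξ)) (3 * r))) (3 * k / 4)} ∂(slab S) ≤
      ENNReal.ofReal (η + if 3 / 4 * (k : ℝ) ≤ S.card then 1 else 0) := fun S => by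
    have h2 : ∀ t : S → ℝ, noise n σ {ξ | S ∉ candidates
        (suppSet (clip (A (X.mulVec (pad S t) + ξ)) (3 * r))) (3 * k / 4)} ≤
        ENNReal.ofReal (η + if 3 / 4 * (k : ℝ) ≤ S.card then 1 else 0) := fun t => by
      split_ifs with hS
      · exact prob_le_one.trans (ENNReal.one_le_ofReal.2 (by linarith))
      · have h3 : 4 * S.card < 3 * k := by
          rw [not_le] at hS
          have : 4 * (S.card : ℝ) < 3 * k := by linarith
          exact_mod_cast this
        rw [add_zero]
        refine le_trans (measure_mono fun ξ hξ => ?_)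
          (hrec (pad S t) ((nnz_pad_le S t).trans (by omega)))
        intro h
        refine hξ (mem_candidates.2 ⟨(suppSet_clip_subset h).trans fun i hi => ?_, by omega⟩)
        by_contra h0
        exact mem_suppSet.1 hi (by simp [pad, h0])
    exact (lintegral_mono h2).trans (by simp)
  refine (Finset.sum_le_sum fun S _ => mul_le_mul_right (h1 S) _).trans ?_
  have hnn : ∀ S : Finset (Fin d), 0 ≤ η + if 3 / 4 * (k : ℝ) ≤ S.card then (1 : ℝ) else 0 :=
    fun S => by positivity
  simp_rw [← ENNReal.ofReal_mul (hc _)]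
  rw [← ENNReal.ofReal_sum_of_nonneg fun S _ => mul_nonneg (hc S) (hnn S)]
  refine ENNReal.ofReal_le_ofReal ?_
  simp_rw [mul_add]
  rw [Finset.sum_add_distrib, ← Finset.sum_mul]
  have h4 := sum_suppPrior_mul_pow q 1
  simp only [one_pow, mul_one, add_sub_cancel, Finset.prod_const_one] at h4
  rw [h4, one_mul]
  simp_rw [mul_ite, mul_one, mul_zero]
  rw [← Finset.sum_filter]
  exact add_le_add_right (sum_suppPrior_card_le hq _) _

/-- A guarantee at each sparse signal carries over to a random signal. -/
lemma prior_prod_noise_recovery_le (hq : ∀ i, 0 ≤ q i ∧ q i ≤ 1) {X : Matrix (Fin n) (Fin d) ℝ}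
    {A : (Fin n → ℝ) → (Fin d → ℝ)} (hA : Measurable A) {k r η : ℝ}
    (hrec : ∀ θ : Fin d → ℝ, nnz θ ≤ k →
      noise n σ {ξ | ¬ ∀ j, |A (X.mulVec θ + ξ) j - θ j| ≤ r} ≤ ENNReal.ofReal η) :
    (prior q).prod (noise n σ) {p | (nnz p.1 : ℝ) ≤ k ∧
      ¬ ∀ j, |A (X.mulVec p.1 + p.2) j - p.1 j| ≤ r} ≤ ENNReal.ofReal η := by
  have := isProbabilityMeasure_prior hq
  have hm : MeasurableSet {p : (Fin d → ℝ) × (Fin n → ℝ) | (nnz p.1 : ℝ) ≤ k ∧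
      ¬ ∀ j, |A (X.mulVec p.1 + p.2) j - p.1 j| ≤ r} := by
    have h0 : {p : (Fin d → ℝ) × (Fin n → ℝ) | ∀ j, |A (X.mulVec p.1 + p.2) j - p.1 j| ≤ r} =
        ⋂ j, {p | |A (X.mulVec p.1 + p.2) j - p.1 j| ≤ r} := by
      ext
      simp
    have h3 : MeasurableSet {p : (Fin d → ℝ) × (Fin n → ℝ) |
        ∀ j, |A (X.mulVec p.1 + p.2) j - p.1 j| ≤ r} := by
      rw [h0]
      refine MeasurableSet.iInter fun j => measurableSet_le ?_ measurable_const
      have h1 : Measurable fun p : (Fin d → ℝ) × (Fin n → ℝ) => A (X.mulVec p.1 + p.2) :=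
        hA.comp (by fun_prop)
      have h2 : Measurable fun p : (Fin d → ℝ) × (Fin n → ℝ) => A (X.mulVec p.1 + p.2) j - p.1 j := by
        fun_prop
      exact continuous_abs.measurable.comp h2
    exact MeasurableSet.inter (measurableSet_le (measurable_nnz.comp measurable_fst)
      measurable_const) h3.compl
  rw [Measure.prod_apply hm]
  have h : ∀ θ : Fin d → ℝ, noise n σ (Prod.mk θ ⁻¹' {p : (Fin d → ℝ) × (Fin n → ℝ) |
      (nnz p.1 : ℝ) ≤ k ∧ ¬ ∀ j, |A (X.mulVec p.1 + p.2) j - p.1 j| ≤ r}) ≤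
      ENNReal.ofReal η := fun θ => by
    by_cases hθ : (nnz θ : ℝ) ≤ k
    · exact (measure_mono fun ξ hξ => hξ.2).trans (hrec θ hθ)
    · refine le_of_eq_of_le ?_ (zero_le (a := ENNReal.ofReal η))
      have h0 : Prod.mk θ ⁻¹' {p : (Fin d → ℝ) × (Fin n → ℝ) | (nnz p.1 : ℝ) ≤ k ∧
          ¬ ∀ j, |A (X.mulVec p.1 + p.2) j - p.1 j| ≤ r} = ∅ :=
        Set.eq_empty_of_forall_notMem fun ξ hξ => hθ hξ.1
      rw [h0, measure_empty]
  exact (lintegral_mono h).trans (by simp)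

end

/-! ### Numerical constants -/

section

variable {d : ℕ}

/-- The sparsity is at least `16 log (40 / δ) > 57`, so that the isometry constant is tiny. -/
lemma rip_budget {k : ℕ} {ε δ R : ℝ} (hε : 0 < ε) (hδ : 0 < δ) (hδ1 : δ < 1)
    (hk : 16 * Real.log (40 / δ) ≤ k) (hεk : ε ≤ 1 / (32 * k * (R ^ 2 + Real.log (40 / δ)))) :
    18 / 5 ≤ Real.log (40 / δ) ∧ ε * k * (R ^ 2 + Real.log (40 / δ)) ≤ 1 / 32 ∧
      ε * k ≤ 1 / 100 ∧ ε ≤ 1 / 5000 := by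
  have hL : 18 / 5 ≤ Real.log (40 / δ) := by
    have h1 : Real.log 40 ≤ Real.log (40 / δ) :=
      Real.log_le_log (by norm_num) ((le_div_iff₀ hδ).2 (by linarith))
    have h2 : Real.log 40 = 5 * Real.log 2 + Real.log (5 / 4) := by
      rw [show (40 : ℝ) = 2 ^ 5 * (5 / 4) by norm_num, Real.log_mul (by norm_num) (by norm_num),
        Real.log_pow]
      norm_num
    have h3 := Real.one_sub_inv_le_log_of_pos (show (0 : ℝ) < 5 / 4 by norm_num)
    have h4 := Real.log_two_gt_d9
    norm_num at h3
    linarith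
  set L := Real.log (40 / δ) with hLdef
  have hk0 : (57 : ℝ) ≤ k := by linarith
  have hB : 18 / 5 ≤ R ^ 2 + L := by nlinarith
  have h1 : ε * k * (R ^ 2 + L) ≤ 1 / 32 := by
    rw [le_div_iff₀ (by positivity)] at hεk
    linarith
  have h2 : ε * k ≤ 1 / 100 := by
    have : 0 ≤ ε * k := by positivity
    nlinarith
  exact ⟨hL, h1, h2, by nlinarith⟩

/-- The level `τ` at which the noise correlations `Xᵀ ξ` exceed `σ √τ` with probability `δ / 4` is
within the error budget, because the recovery guarantee forces `log d = O(R² + log (40 / δ))`. -/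
lemma noise_budget {ε δ R τ : ℝ} (hd : 0 < d) (hε : 0 < ε) (hε1 : ε ≤ 1 / 5000) (hδ : 0 < δ)
    (hδ1 : δ < 1) (hL : 18 / 5 ≤ Real.log (40 / δ))
    (hlog : Real.log d + 2 * Real.log (1 - δ ^ 2 / 320) ≤
      4 * (1 + ε) * (R ^ 2 + Real.log (40 / δ)))
    (hτ : τ = 2 * (1 + ε) * Real.log (8 * d / δ)) :
    0 ≤ τ ∧ 17 * R ^ 2 + 3 * τ + 1 / 2 ≤ 48 * (R ^ 2 + Real.log (40 / δ)) := by
  have hd1 : (1 : ℝ) ≤ d := by exact_mod_cast hd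
  set L := Real.log (40 / δ) with hLdef
  set B := R ^ 2 + L with hB
  have hR : 0 ≤ R ^ 2 := sq_nonneg R
  have hδ2 : δ ^ 2 ≤ 1 := pow_le_one₀ hδ.le hδ1.le
  have h1 : -(1 / 300) ≤ Real.log (1 - δ ^ 2 / 320) := by
    have hpos : 0 < 1 - δ ^ 2 / 320 := by linarith
    have h2 := Real.one_sub_inv_le_log_of_pos hpos
    have h3 : (1 - δ ^ 2 / 320)⁻¹ ≤ 301 / 300 := by
      rw [inv_le_comm₀ hpos (by norm_num)]
      norm_num
      linarith
    linarith
  have h4 : Real.log (8 * d / δ) ≤ Real.log d + L := by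
    rw [hLdef, ← Real.log_mul (by positivity) (by positivity)]
    refine Real.log_le_log (by positivity) ?_
    rw [mul_div_assoc', div_le_div_iff_of_pos_right hδ]
    linarith
  have h5 : 0 ≤ Real.log (8 * d / δ) :=
    Real.log_nonneg ((le_div_iff₀ hδ).2 (by linarith))
  have hBL : L ≤ B := by linarith
  have h6 : Real.log (8 * d / δ) ≤ 26 / 5 * B := by nlinarith
  have h7 : τ ≤ 21 / 2 * B - B / 10 := by
    rw [hτ]
    nlinarith
  refine ⟨by rw [hτ]; positivity, ?_⟩
  nlinarith

end

end SpikeSlab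

theorem proposition3p6 (ω : ℝ) (hω : 2 ≤ ω) :
    ∃ K : ℝ, 0 < K ∧
      ∀ (n d : ℕ), 0 < d →
      ∀ (q : Fin d → ℝ), (∀ i, 0 ≤ q i ∧ q i ≤ 1) →
      ∀ (σ : ℝ), 0 < σ →
      ∀ (X : Matrix (Fin n) (Fin d) ℝ)
        (C_A : ℝ), 1 ≤ C_A →
      ∀ (R : ℕ → ℝ → ℝ → NNReal) (A : (Fin n → ℝ) → (Fin d → ℝ)), Measurable A →
      ∀ (kstar : ℕ) (ε δ : ℝ), 0 < ε → 0 < δ → δ < 1 →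
        16 * (∑ i, q i + Real.log (40 / δ)) ≤ kstar →
        ε ≤ 1 / (32 * kstar * ((R kstar ε (δ ^ 2 / 320) : ℝ) ^ 2 + Real.log (40 / δ))) →
        SparseRecovery X σ C_A R A kstar ε →
        IsRIP X ε (C_A * kstar) →
        -- with probability at least `1 - δ` over the model, the output law is `δ`-accurate
        ((prior q).prod (noise n σ))
            {ω' | ¬ tvDist
                (posteriorSampleGaussian X (X.mulVec ω'.1 + ω'.2)
                  (hint A R σ kstar ε δ (X.mulVec ω'.1 + ω'.2)) σ q kstar δ).law
                (posteriorSupp X σ q (X.mulVec ω'.1 + ω'.2)) ≤ δ} ≤ ENNReal.ofReal δ ∧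
        -- running time, for every observation and every given hint
        ∀ (y : Fin n → ℝ) (θhat : Fin d → ℝ),
          (posteriorSampleGaussian X y θhat σ q kstar δ).worstTime ω ≤
            ENNReal.ofReal (K * (n * d + (d * kstar + n * (kstar : ℝ) ^ (ω - 1))
              * Real.log (2 / δ))) := by
  refine ⟨2000, by norm_num, fun n d hd q hq σ hσ X C_A hC R A hA k ε δ hε hδ hδ1 hk hεk hrec
    hRIP => ?_⟩
  set ρ : ℝ := ((R k ε (δ ^ 2 / 320) : ℝ≥0) : ℝ) with hρ
  set L := Real.log (40 / δ) with hL
  have hq0 : 0 ≤ ∑ i, q i := Finset.sum_nonneg fun i _ => (hq i).1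
  obtain ⟨hL1, hB1, hεk1, hε1⟩ := rip_budget hε hδ hδ1 (by linarith) hεk
  rw [← hL] at hL1 hB1
  have hk0 : (57 : ℝ) ≤ k := by linarith
  have hk1 : 1 ≤ k := by
    have : (1 : ℝ) ≤ k := by linarith
    exact_mod_cast this
  have hX : IsRIP X ε k := fun θ hθ => hRIP θ (hθ.trans (by nlinarith))
  refine ⟨?_, fun y θhat => worstTime_posteriorSampleGaussian_le hω hd X y θhat σ q hk1 hδ hδ1
    (by linarith) hX⟩
  set η : ℝ := δ ^ 2 / 320 with hη
  have hη0 : 0 < η := by positivity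
  have hδ2 : δ ^ 2 ≤ δ := by nlinarith
  have hη1 : η < 1 := by linarith
  have hrec' : ∀ θ : Fin d → ℝ, nnz θ ≤ k →
      noise n σ {ξ | ¬ ∀ j, |A (X.mulVec θ + ξ) j - θ j| ≤ σ * ρ} ≤ ENNReal.ofReal η :=
    fun θ hθ => hrec hRIP θ hθ η hη0 hη1
  have hlog : Real.log d + 2 * Real.log (1 - η) ≤ 4 * (1 + ε) * (ρ ^ 2 + L) := by
    have hρ0 : 0 ≤ ρ := NNReal.coe_nonneg _
    have h1 : ρ < √(ρ ^ 2 + L) := Real.lt_sqrt_of_sq_lt (by linarith)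
    -- The signal strength `t = 2 σ √(ρ² + L)` exceeds twice the error `σ ρ` of the estimator.
    refine (log_card_le_of_recovery hσ hX (by linarith) hd hA (R := ρ) (η := η)
      (t := 2 * (σ * √(ρ ^ 2 + L))) (by gcongr) hη0 hη1
      fun θ hθ => hrec' θ (hθ.trans hk1)).trans (le_of_eq ?_)
    rw [mul_pow, mul_pow, Real.sq_sqrt (by positivity)]
    field_simp
    ring
  set τ := 2 * (1 + ε) * Real.log (8 * d / δ) with hτ
  obtain ⟨hτ0, hτB⟩ := noise_budget hd hε hε1 hδ hδ1 hL1 hlog hτ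
  rw [← hL] at hτB
  have hεB : ε * (k * (17 * ρ ^ 2 + 3 * τ + 1 / 2)) ≤ 3 / 2 := by
    have h1 : 0 ≤ ε * k := by positivity
    have := mul_le_mul_of_nonneg_left hτB h1
    linarith
  have := isProbabilityMeasure_prior hq
  have hthr : 3 * (σ * ρ) = 3 * σ * ρ := by ring
  have hΩ : ∀ S, MeasurableSet {y | S ∈ candidates (suppSet (clip (A y) (3 * (σ * ρ)))) (3 * k / 4)} :=
    fun S => measurableSet_mem_candidates (fun j => measurable_clip hA _ j) S _
  -- Each of the events in `e1`, ..., `e5` spoils the accuracy; their probabilities sum to less than `δ`.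
  have hexp : Real.exp (-L) = δ / 40 := by
    rw [hL, Real.exp_neg, Real.exp_log (by positivity), inv_div]
  have hfst : ∀ P : Set (Fin d → ℝ), (prior q).prod (noise n σ) {p | p.1 ∈ P} = prior q P :=
    fun P => by
      rw [show {p : (Fin d → ℝ) × (Fin n → ℝ) | p.1 ∈ P} = P ×ˢ Set.univ by ext; simp,
        Measure.prod_prod, measure_univ, mul_one]
  have hsnd : ∀ P : Set (Fin n → ℝ), (prior q).prod (noise n σ) {p | p.2 ∈ P} = noise n σ P :=
    fun P => by
      rw [show {p : (Fin d → ℝ) × (Fin n → ℝ) | p.2 ∈ P} = Set.univ ×ˢ P by ext; simp,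
        Measure.prod_prod, measure_univ, one_mul]
  have e1 : (prior q).prod (noise n σ) {p | (k : ℝ) / 4 < nnz p.1} ≤ ENNReal.ofReal (δ / 40) := by
    refine (hfst {θ | (k : ℝ) / 4 < nnz θ}).trans_le ((prior_nnz_le hq _).trans
      (ENNReal.ofReal_le_ofReal ?_))
    rw [← hexp]
    exact Real.exp_le_exp.2 (by linarith)
  have e2 : (prior q).prod (noise n σ) {p | (k : ℝ) / 2 < ∑ j, p.1 j ^ 2} ≤
      ENNReal.ofReal (δ / 40) := by
    refine (hfst {θ | (k : ℝ) / 2 < ∑ j, θ j ^ 2}).trans_le ((prior_sum_sq_le hq _).trans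
      (ENNReal.ofReal_le_ofReal ?_))
    rw [← hexp]
    exact Real.exp_le_exp.2 (by linarith)
  have e3 : (prior q).prod (noise n σ) {p | (nnz p.1 : ℝ) ≤ k ∧
      ¬ ∀ j, |A (X.mulVec p.1 + p.2) j - p.1 j| ≤ σ * ρ} ≤ ENNReal.ofReal η :=
    prior_prod_noise_recovery_le hq hA fun θ hθ => hrec' θ (by exact_mod_cast hθ)
  have e4 : (prior q).prod (noise n σ) {p | ¬ ∀ j, (∑ i, X i j * p.2 i) ^ 2 ≤ σ ^ 2 * τ} ≤
      ENNReal.ofReal (δ / 4) := by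
    refine (hsnd {ξ | ¬ ∀ j, (∑ i, X i j * ξ i) ^ 2 ≤ σ ^ 2 * τ}).trans_le
      ((noise_exists_col_le hσ hX (by linarith) hε.le hτ0).trans (ENNReal.ofReal_le_ofReal ?_))
    have hd0 : (0 : ℝ) < d := by exact_mod_cast hd
    have h1 : τ / (2 * (1 + ε)) = Real.log (8 * d / δ) := by
      rw [hτ]
      field_simp
    rw [h1, Real.exp_neg, Real.exp_log (by positivity)]
    refine le_of_eq ?_
    field_simp
    ring
  have e5 : (prior q).prod (noise n σ) {p | δ / 2 * ∑ S, suppWeight X σ q (X.mulVec p.1 + p.2) S <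
        ∑ S ∈ (candidates (suppSet (clip (A (X.mulVec p.1 + p.2)) (3 * (σ * ρ)))) (3 * k / 4))ᶜ,
          suppWeight X σ q (X.mulVec p.1 + p.2) S} ≤
      ENNReal.ofReal (δ / 100) := by
    refine (posterior_outside_le hσ hq X hΩ (half_pos hδ)).trans
      ((mul_le_mul_right (sum_suppPrior_notMem_candidates_le hq hη0.le hrec') _).trans ?_)
    rw [← ENNReal.ofReal_mul (by positivity)]
    refine ENNReal.ofReal_le_ofReal ?_
    have h1 : Real.exp (2 * ∑ i, q i - 3 / 4 * k) ≤ (δ / 40) ^ 2 := by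
      rw [← hexp, ← Real.exp_nat_mul]
      refine Real.exp_le_exp.2 ?_
      push_cast
      linarith
    calc (δ / 2)⁻¹ * (η + Real.exp (2 * ∑ i, q i - 3 / 4 * k))
        ≤ (δ / 2)⁻¹ * (η + (δ / 40) ^ 2) := by gcongr
      _ = 3 / 400 * δ := by
        rw [hη]
        field_simp
        ring
      _ ≤ δ / 100 := by linarith
  refine (measure_mono (fun p hp => ?_)).trans ((measure_union_le _ _).trans (add_le_add
    ((measure_union_le _ _).trans (add_le_add ((measure_union_le _ _).trans (add_le_add
      ((measure_union_le _ _).trans (add_le_add e1 e2)) e3)) e4)) e5)) |>.trans ?_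
  · by_contra hgood
    simp only [Set.mem_union, not_or] at hgood
    obtain ⟨⟨⟨⟨g1, g2⟩, g3⟩, g4⟩, g5⟩ := hgood
    have g1' : (nnz p.1 : ℝ) ≤ k / 4 := not_lt.1 g1
    have g3' : ∀ j, |A (X.mulVec p.1 + p.2) j - p.1 j| ≤ σ * ρ := by
      by_contra h
      exact g3 ⟨by linarith, h⟩
    refine hp (?_ : tvDist (posteriorSampleGaussian X _ (clip _ (3 * σ * ρ)) σ q k δ).law _ ≤ δ)
    rw [← hthr]
    refine tvDist_posteriorSupp_le hσ hq hX hδ hδ1 hε.le (by linarith) (by linarith) hεB g1'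
      (suppSet_clip_subset g3') (fun j => ?_) (not_lt.1 g2) hτ0 (not_not.1 g4) (not_lt.1 g5)
    rw [mul_assoc]
    exact abs_sub_clip_le g3' j
  · rw [← ENNReal.ofReal_add (by positivity) (by positivity),
      ← ENNReal.ofReal_add (by positivity) hη0.le,
      ← ENNReal.ofReal_add (by positivity) (by positivity),
      ← ENNReal.ofReal_add (by positivity) (by positivity)]
    exact ENNReal.ofReal_le_ofReal (by linarith)
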